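/- **Setting.** *Algebras and grammars.* Let $\Gamma$ be an $S$-sorted signature and $(\mathcal L,\phi)$ an $S$-sorted $\Gamma$-algebra. The set $\mathrm{factors}(a)$ is the least set that contains $a$ and, with each $b=\phi(\sigma)(b_1,\dots,b_k)$, the elements $b_1,\dots,b_k$; $\mathcal L$ is *finitely decomposable* if $\mathrm{factors}(a)$ is finite for all $a$. An $S$-sorted regular tree grammar $G=(N,\Sigma,A_0,R)$ has finitely many sorted nonterminals $N$ and a finite set $R$ of rules $A\to t$, where $t$ is a term over $\Gamma$ with leaves in $N$ and of the same sort as $A$. If $A_1,\dots,A_k$ are the occurrences of nonterminals in $t$ from left to right, the rule has rank $k$, argument sorts $A_1\dots A_k$ and target sort $A$; $\mathrm T_R$ is the set of trees over $R$ that are well-sorted in this sense, and $\mathrm{AST}(G)$ is the set of those with root sort $A_0$. Each $d\in\mathrm T_R$ represents a ground term $\pi(d)$ (nest the right-hand sides) with value $\pi(d)_{\mathcal L}\in\mathcal L$. Put $L(G)=\{\pi(d)\mid d\in \mathrm{AST}(G)\}$, $L(G)_{\mathcal L}=\{\pi(d)_{\mathcal L}\mid d\in\mathrm{AST}(G)\}$,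 and $\mathrm{AST}(G,a)=\{d\in\mathrm{AST}(G)\mid \pi(d)_{\mathcal L}=a\}$. The pair $(G,\mathcal L)$ is *nonlooping* if no $d\in \mathrm T_R$ has a proper subtree with the same root rule and the same value as $d$; $G$ is *acyclic* if no rule occurs twice on a path of a tree in $\mathrm T_R$. *Weights.* A *complete M-monoid* $(\mathbb K,\oplus,0,\Omega,\sum)$ is a commutative monoid with a sum for all countable families (empty sum $0$, singleton sums, two-element sums $=\oplus$, invariance under arbitrary partitions of the index set) and a ranked set $\Omega$ of operations on $\mathbb K$ that contains a null operation (constantly $0$) of each rank. It is *distributive* if each operation distributes over $\oplus$ in each argument and has value $0$ whenever some argument is $0$. A *wRTG-LM* $((G,\mathcal L),\mathbb K,\mathrm{wt})$ assigns to each rule $r$ an operation $\mathrm{wt}(r)\in\Omega$ of the same rank; $\mathrm{wt}(d)$ is the resulting value of $d\in\mathrm T_R$, and $\mathrm{parse}(a)=\sum_{d\in\mathrm{AST}(G,a)}\mathrm{wt}(d)$ for $a\in\mathcal L_{\mathrm{sort}(A_0)}$. *The M-monoid parsing algorithm* on input $((G,\mathcal L),\mathbb K,\mathrm{wt})$ ($\mathcal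 L$ finitely decomposable) and $a$. First, build the finite grammar whose nonterminals (*items*) are $[A_0,a]$ and all $[A,t,b]$ with $A\in N$, $t$ the right-hand side of some rule and $b\in\mathrm{factors}(a)$, whose initial item is $[A_0,a]$, and whose rules are (i) $[A,t,b]\to\langle x_1\dots x_k\rangle([A_1,t_1,b_1],\dots,[A_k,t_k,b_k])$ for each rule $r=(A\to t)$ with nonterminal occurrences $A_1,\dots,A_k$, all $b,b_1,\dots,b_k\in\mathrm{factors}(a)$ such that $t$ has value $b$ if $b_1,\dots,b_k$ are put for these occurrences, and all right-hand sides $t_i$ with $\mathrm{sort}(t_i)=\mathrm{sort}(A_i)$, with operation $\mathrm{wt}(r)$; (ii) $[A_0,a]\to\langle x_1\rangle([A_0,t,a])$ for each rule $A_0\to t$, with the identity of $\mathbb K$ as operation. Call this weighted grammar $\mathrm{cnc}(a)$. Then compute values of the items: set $V(B)=0$ for all items $B$; in each round visit every item $B$ once, in an arbitrary order that may change from round to round, and set $V(B)$ to $\bigoplus\omega(V(B_1),\dots,V(B_k))$, summed over all rules with left-hand side $B$ ($B_1,\dots,B_k$ are the items on the right-hand side and $\omega$ is the operation of the rule); stop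 after the first round in which no value has changed and output $V([A_0,a])$. The algorithm is *applicable* to a wRTG-LM if $\mathcal L$ is finitely decomposable and, for every $a\in\mathcal L_{\mathrm{sort}(A_0)}$ and all visiting orders, it terminates with output $\mathrm{parse}(a)$. **Claim.** The M-monoid parsing algorithm is applicable to each of the following wRTG-LMs. 1. $(G,\mathcal L)$ is nonlooping, $\mathcal L$ is finitely decomposable, and the weight algebra is the M-monoid of an arbitrary complete semiring, with the operations $(k_1,\dots,k_m)\mapsto k\otimes k_1\otimes\dots\otimes k_m$. Moreover (inputs of semiring parsing): for every semiring-weighted wRTG-LM with finitely decomposable $\mathcal L$ and every $a$ such that $\mathrm{cnc}(a)$ is acyclic, the algorithm terminates on $a$ with output $\mathrm{parse}(a)$. 2. $\mathcal L$ is finitely decomposable and the weight algebra is superior (these are the weight algebras of weighted deductive parsing): it is distributive, and there is a total order on $\mathbb K$ with a least element such that $\oplus=\min$, $\sum=\inf$, and each operation is monotone in each argument and has a value $\succeq$ each of its arguments. 3. $\mathcal L$ is finitely decomposable, the weight algebra is the best derivation M-monoid over a ranked set $R_\infty$, and each $\mathrm{wt}(r)$ is an operation $\mathrm{tc}_{p,\rho}$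 with $\rho \in R_\infty$ and $0<p<1$. Here $\mathbb K=[0,1]\times\mathcal P(\mathrm T_{R_\infty})$, $\sum_i(p_i,D_i)=(s,\bigcup_{i:\,p_i=s}D_i)$ with $s=\sup_i p_i$ ($\oplus$ is the sum of two elements), and $\mathrm{tc}_{p,\rho}((p_i,D_i)_{i\le k})=(p\,p_1\cdots p_k,\ \{\rho(d_1,\dots,d_k)\mid d_i\in D_i\})$. 4. $\mathcal L$ is finitely decomposable and the weight algebra is the $n$-best M-monoid, $n\ge1$: its elements are the nonincreasing $n$-tuples in $[0,1]$, the sum of a family consists of the $n$ greatest components of all its tuples, with multiplicity (padded by $0$; where a greatest remaining component does not exist, the supremum of the remaining components is taken for all remaining positions), and its operations are $(k_1,\dots,k_m)\mapsto \kappa\cdot_n k_1\cdot_n\dots\cdot_n k_m$ (left-associated) for all elements $\kappa$, where $x\cdot_n y$ consists of the $n$ greatest products $x_iy_j$. 5. $\mathcal L$ is finitely decomposable and the weight algebra is the intersection M-monoid of some $(G',\mathcal L')$ and $a'$, where $\mathcal L'$ is finitely decomposable. The intersection M-monoid of $(G,\mathcal L)$ and $a$ consists of the subsets of the set $P$ of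 all rules $[A,b]\to t([A_1,a_1],\dots,[A_k,a_k])$ such that $A\to t(A_1,\dots,A_k)$ is a rule of $G$, $a_1,\dots,a_k, b\in\mathrm{factors}(a)$, and $b$ is the value of $t$ at $(a_1,\dots,a_k)$; $\oplus$ and $\sum$ are union. Besides the null operations it has, for each rule $r=(A\to t(A_1,\dots,A_k))$ of $G$, the operation $\omega_r$: if some $V_i=\emptyset$, then $\omega_r(V_1,\dots,V_k)=\emptyset$; otherwise $\omega_r(V_1,\dots,V_k)=V_1\cup\dots\cup V_k\cup V$, where $V$ is the set of all elements of $P$ that come from $r$ and for which each $[A_i,a_i]$ is the left-hand side of a rule in $V_i$. Moreover, for every $(G,\mathcal L)$ with finitely decomposable $\mathcal L$ and every $a$, with the intersection M-monoid of $(G,\mathcal L)$ and $a$ and $\mathrm{wt}(r)=\omega_r$, the algorithm terminates on $a$, and its output $V$ is the set of rules of the intersection of $G$ and $a$: every nonterminal on a right-hand side in $V$ is a left-hand side in $V$, and the grammar $G_a$ with initial nonterminal $[A_0,a]$ and rules $V$ satisfies $L(G_a)_{\mathcal L}=L(G)_{\mathcal L}\cap\{a\}$, and the relabeling of trees induced by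 $[A,b]\mapsto A$ is a bijection $\mathrm{AST}(G_a)\to\mathrm{AST}(G,a)$. 6. $(G,\mathcal L)$ is a nonlooping yield grammar and the weight algebra is an ADP M-monoid. Yield grammar: $\mathcal L$ is the algebra of the words over the nullary symbols of a finite sorted signature $\Delta$, where a nullary symbol denotes itself and every other symbol denotes concatenation. ADP M-monoid: let $\Sigma$ be a signature over the sorts $\mathsf a,\mathsf i$ whose symbols with target sort $\mathsf a$ are not nullary and whose symbols with target sort $\mathsf i$ are nullary, let $(\mathbb K,\psi)$ be a $\Sigma$-algebra, and let $h$ be an objective function for $\mathbb K$, i.e., $h_{\mathsf i}=\mathrm{id}$ on $\mathcal P(\mathbb K_{\mathsf i})$, $h_{\mathsf a}(F)\subseteq F\subseteq \mathbb K_{\mathsf a}$ is nonempty if $F$ is, and $h_{\mathsf a}(\bigcup_{i\in I}F_i)=h_{\mathsf a}(\bigcup_{i\in I} h_{\mathsf a}(F_i))$ for countable families with nonempty union. Assume Bellman's principle: $h_{\mathsf a}(\psi(\sigma)(F_1,\dots,F_k))=h_{\mathsf a}(\psi(\sigma)(h(F_1),\dots,h(F_k)))$ for all $\sigma$ of sort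 $\mathsf a$. The carrier consists of the sets $h_s(F)$, $F\subseteq\mathbb K_s$, and a new element $\bot$; $\sum_iF_i=h_s(\bigcup_iF_i)$ if all $F_i\subseteq\mathbb K_s$ for some $s$, and $\bot$ otherwise; besides the null operations there is an operation for each term $t$ over $\Sigma$, of some sort $s$, with sorted variables $x_1,\dots,x_k$ of which none occurs twice in $t$: it maps $(F_1,\dots,F_k)$ to $\emptyset$ if some $F_i$ is empty, otherwise to $h_s(\{t_{\mathbb K}(y_1,\dots,y_k)\mid y_i\in F_i\})$ if each $F_i$ is a set of elements of the sort of $x_i$, and otherwise to $\bot$. Moreover, if $\Sigma$ is finite, $(G,\mathcal L)$ is a nonlooping yield grammar over $\Sigma$ whose initial nonterminal has sort $\mathsf a$, and $\mathrm{wt}(A\to t)$ is the operation of the term obtained from $t$ by replacing its nonterminal occurrences from left to right by $x_1,\dots,x_k$, then for each word $w$ the algorithm terminates with output $\mathrm{adp}(w)=h_{\mathsf a}(\{t_{\mathbb K}\mid t\in L(G),\ \mathrm{yield}(t)=w\})$. -/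

import Mathlib

universe u v w

noncomputable section

namespace MMP

/-! ### Sorted signatures, terms and algebras -/

/-- An `(S^* × S)`-sorted set: each symbol has a list of argument sorts and a target sort. -/
structure Signature (S : Type u) where
  Op : Type u
  ar : Op → ℕ
  dom : ∀ σ : Op, Fin (ar σ) → S
  cod : Op → S

/-- Terms over the signature `Γ` with leaves from the `S`-sorted set `(X, sort)`. -/
inductive Term {S : Type u} (Γ : Signature S) {X : Type u} (sort : X → S) : S → Type u
  | var (x : X) : Term Γ sort (sort x)
  | op (σ : Γ.Op) (ts : ∀ i : Fin (Γ.ar σ), Term Γ sort (Γ.dom σ i)) : Term Γ sort (Γ.cod σ)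

/-- An `S`-sorted `Γ`-algebra. -/
structure SortedAlgebra {S : Type u} (Γ : Signature S) where
  carrier : S → Type v
  interp : ∀ σ : Γ.Op, (∀ i, carrier (Γ.dom σ i)) → carrier (Γ.cod σ)

namespace Term

variable {S : Type u} {Γ : Signature S} {X : Type u} {sort : X → S}

/-- The occurrences of elements of `X` in a term. -/
def Occ : {s : S} → Term Γ sort s → Type
  | _, var _ => Unit
  | _, op _ ts => Σ i, Occ (ts i)

/-- The element of `X` at an occurrence. -/
def label : {s : S} → (t : Term Γ sort s) → t.Occ → X
  | _, var x, _ => x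
  | _, op _ ts, o => label (ts o.1) o.2

/-- The number of occurrences of elements of `X` in a term. -/
def count : {s : S} → Term Γ sort s → ℕ
  | _, var _ => 1
  | _, op _ ts => ∑ i, count (ts i)

/-- The enumeration of the occurrences from left to right. -/
def occEquiv : {s : S} → (t : Term Γ sort s) → Fin t.count ≃ t.Occ
  | _, var _ => (finOneEquiv : Fin 1 ≃ Unit)
  | _, op _ ts => finSigmaFinEquiv.symm.trans (Equiv.sigmaCongrRight fun i => occEquiv (ts i))

instance {s : S} (t : Term Γ sort s) : Finite t.Occ := Finite.of_equiv _ t.occEquiv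

/-- The value of a term in the algebra `A` if the leaves have the given values. -/
def eval (A : SortedAlgebra.{u, v} Γ) :
    {s : S} → (t : Term Γ sort s) → (∀ o : t.Occ, A.carrier (sort (t.label o))) → A.carrier s
  | _, var _, x => x ()
  | _, op σ ts, x => A.interp σ fun i => (ts i).eval A fun o => x ⟨i, o⟩

/-- Substitution of a term for each occurrence of an element of `X`. -/
def subst {Y : Type u} {sortY : Y → S} :
    {s : S} → (t : Term Γ sort s) → (∀ o : t.Occ, Term Γ sortY (sort (t.label o))) →
      Term Γ sortY s
  | _, var _, f => f ()
  | _, op σ ts, f => op σ fun i => (ts i).subst fun o => f ⟨i, o⟩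

/-- Replacement of each occurrence `o` of an element of `X` by the element `g o` of the same
sort. -/
def relabel {Y : Type u} {sortY : Y → S} {s : S} (t : Term Γ sort s) (g : t.Occ → Y)
    (h : ∀ o, sortY (g o) = sort (t.label o)) : Term Γ sortY s :=
  t.subst fun o => h o ▸ var (g o)

/-- Each element of `X` occurs at most once. -/
def Linear {s : S} (t : Term Γ sort s) : Prop := Function.Injective t.label

theorem relabel_occ {Y : Type u} {sortY : Y → S} {s : S} (t : Term Γ sort s) (g : t.Occ → Y)
    (h : ∀ o, sortY (g o) = sort (t.label o)) :
    ∃ e : (t.relabel g h).Occ → t.Occ, Function.Injective e ∧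
      ∀ o, (t.relabel g h).label o = g (e o) := by
  induction t with
  | var x =>
    have key : ∀ {s : S} (y : Y) (hy : sortY y = s),
        ∃ e : (hy ▸ var (Γ := Γ) (sort := sortY) y : Term Γ sortY s).Occ → Unit,
          Function.Injective e ∧
          ∀ o, (hy ▸ var (Γ := Γ) (sort := sortY) y : Term Γ sortY s).label o = y := by
      intro s y hy
      subst hy
      exact ⟨fun o => o, fun _ _ ho => ho, fun _ => rfl⟩
    exact key (g ()) (h ())
  | op σ ts ih =>
    choose e he he' using fun i => ih i (fun o => g ⟨i, o⟩) fun o => h ⟨i, o⟩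
    refine ⟨fun o => ⟨o.1, e o.1 o.2⟩, ?_, fun o => he' o.1 o.2⟩
    rintro ⟨i, o⟩ ⟨i', o'⟩ ho
    obtain ⟨rfl, ho⟩ := Sigma.mk.inj ho
    exact congrArg (Sigma.mk i) (he i (eq_of_heq ho))

theorem linear_relabel {Y : Type u} {sortY : Y → S} {s : S} (t : Term Γ sort s) (g : t.Occ → Y)
    (h : ∀ o, sortY (g o) = sort (t.label o)) (hg : Function.Injective g) :
    (t.relabel g h).Linear := by
  obtain ⟨e, he, hl⟩ := t.relabel_occ g h
  intro o o' ho
  rw [hl, hl] at ho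
  exact he (hg ho)

/-- Attaching to each occurrence `o` of an element of `X` the element `an o`. -/
def annotate {F : X → Type u} :
    {s : S} → (t : Term Γ sort s) → (∀ o : t.Occ, F (t.label o)) →
      Term Γ (fun p : Σ x, F x => sort p.1) s
  | _, var x, an => var (sort := fun p : Σ x, F x => sort p.1) ⟨x, an ()⟩
  | _, op σ ts, an => op σ fun i => (ts i).annotate fun o => an ⟨i, o⟩

/-- Forgetting annotations. -/
def erase {F : X → Type u} :
    {s : S} → Term Γ (fun p : Σ x, F x => sort p.1) s → Term Γ sort s
  | _, var p => var p.1
  | _, op σ ts => op σ fun i => (ts i).erase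

theorem erase_annotate {F : X → Type u} {s : S} (t : Term Γ sort s)
    (an : ∀ o : t.Occ, F (t.label o)) : (t.annotate an).erase = t := by
  induction t with
  | var x => rfl
  | op σ ts ih =>
    simp only [annotate, erase]
    exact congrArg (op σ) (funext fun i => ih i _)

/-- The label of a term that is a single leaf. -/
def leafLabel : {s : S} → Term Γ sort s → Option X
  | _, var x => some x
  | _, op _ _ => none

theorem annotate_injective {F : X → Type u} {s : S} (t : Term Γ sort s)
    (an an' : ∀ o : t.Occ, F (t.label o)) (h : t.annotate an = t.annotate an') : an = an' := by
  induction t with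
  | var x =>
    funext o
    have h1 := congrArg leafLabel h
    simp only [annotate, leafLabel, Option.some.injEq] at h1
    exact eq_of_heq (Sigma.mk.inj h1).2
  | op σ ts ih =>
    simp only [annotate, Term.op.injEq] at h
    funext o
    obtain ⟨i, o⟩ := o
    exact congrFun (ih i _ _ (congrFun h i)) o

end Term

/-- Ground terms. -/
abbrev GTerm {S : Type u} (Γ : Signature S) (s : S) : Type u :=
  Term Γ (X := PEmpty.{u + 1}) (fun x => x.elim) s

namespace SortedAlgebra

variable {S : Type u} {Γ : Signature S}

/-- The unique homomorphism from ground terms to `A`. -/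
def evalGround (A : SortedAlgebra.{u, v} Γ) {s : S} (t : GTerm Γ s) : A.carrier s :=
  t.eval A fun o => (t.label o).elim

/-- The sorted carrier set. -/
abbrev Obj (A : SortedAlgebra.{u, v} Γ) : Type (max u v) := Σ s, A.carrier s

/-- `b` occurs in a tuple that some operation maps to `a`. -/
def IsFactor (A : SortedAlgebra.{u, v} Γ) (b a : A.Obj) : Prop :=
  ∃ (σ : Γ.Op) (x : ∀ i, A.carrier (Γ.dom σ i)) (i : Fin (Γ.ar σ)),
    (⟨Γ.dom σ i, x i⟩ : A.Obj) = b ∧ (⟨Γ.cod σ, A.interp σ x⟩ : A.Obj) = a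

def factors (A : SortedAlgebra.{u, v} Γ) (a : A.Obj) : Set A.Obj :=
  {b | Relation.ReflTransGen A.IsFactor b a}

def FinitelyDecomposable (A : SortedAlgebra.{u, v} Γ) : Prop :=
  ∀ a : A.Obj, (A.factors a).Finite

/-- The factors of `a` of sort `s`. -/
def FactorsAt (A : SortedAlgebra.{u, v} Γ) (a : A.Obj) (s : S) : Type v :=
  {y : A.carrier s // (⟨s, y⟩ : A.Obj) ∈ A.factors a}

theorem FinitelyDecomposable.finite_at {A : SortedAlgebra.{u, v} Γ}
    (h : A.FinitelyDecomposable) (a : A.Obj) (s : S) : Finite (A.FactorsAt a s) := by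
  have : Finite (A.factors a) := h a
  refine Finite.of_injective (β := A.factors a) (fun y => ⟨⟨s, y.1⟩, y.2⟩) ?_
  intro x y hxy
  have := congrArg Subtype.val hxy
  exact Subtype.ext (eq_of_heq (Sigma.mk.inj this).2)

end SortedAlgebra

/-! ### Regular tree grammars -/

/-- The ranked trees over a ranked set. -/
abbrev RTree {α : Type u} (rk : α → ℕ) : Type u := WType fun a => Fin (rk a)

/-- The tree relabeling induced by a rank-preserving mapping. -/
def RTree.map {α β : Type u} {rk : α → ℕ} {rk' : β → ℕ} (f : α → β)
    (h : ∀ a, rk' (f a) = rk a) : RTree rk → RTree rk'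
  | ⟨a, ts⟩ => ⟨f a, fun i => RTree.map f h (ts (Fin.cast (h a) i))⟩

/-- An `S`-sorted regular tree grammar whose terminals are symbols of `Γ`.  The rules are
(indexed by `R` without repetition) pairs of a nonterminal and a term of the same sort with
nonterminals as leaves. -/
structure RTG {S : Type u} (Γ : Signature S) where
  N : Type u
  finN : Finite N
  sort : N → S
  start : N
  R : Type u
  finR : Finite R
  lhs : R → N
  rhs : ∀ r : R, Term Γ sort (sort (lhs r))
  inj : Function.Injective fun r => (⟨lhs r, rhs r⟩ : Σ A, Term Γ sort (sort A))

namespace RTG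

variable {S : Type u} {Γ : Signature S}

instance (G : RTG Γ) : Finite G.N := G.finN
instance (G : RTG Γ) : Finite G.R := G.finR

/-- The rank of a rule: the number of occurrences of nonterminals in its right-hand side. -/
def rank (G : RTG Γ) (r : G.R) : ℕ := (G.rhs r).count

/-- The nonterminal at an occurrence in the right-hand side of a rule. -/
abbrev child (G : RTG Γ) (r : G.R) (o : (G.rhs r).Occ) : G.N := (G.rhs r).label o

/-- `G.Deriv A` is the set of abstract syntax trees over the rules of `G` with root sort `A`. -/
inductive Deriv (G : RTG Γ) : G.N → Type u
  | node (r : G.R) (ds : ∀ o : (G.rhs r).Occ, Deriv G (G.child r o)) : Deriv G (G.lhs r)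

namespace Deriv

variable {G : RTG Γ}

/-- The rule at the root. -/
def root : {A : G.N} → G.Deriv A → G.R
  | _, node r _ => r

/-- The tree over the terminal symbols that is represented by a syntax tree. -/
def proj : {A : G.N} → G.Deriv A → GTerm Γ (G.sort A)
  | _, node r ds => (G.rhs r).subst fun o => (ds o).proj

/-- The syntactic object to which a syntax tree evaluates. -/
def value (L : SortedAlgebra.{u, v} Γ) {A : G.N} (d : G.Deriv A) : L.carrier (G.sort A) :=
  L.evalGround d.proj

/-- A syntax tree as a ranked tree over the rules. -/
def toTree : {A : G.N} → G.Deriv A → RTree G.rank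
  | _, node r ds => ⟨r, fun i => (ds ((G.rhs r).occEquiv i)).toTree⟩

/-- `x` is a direct subtree of `y`. -/
def IsChild (x y : Σ A, G.Deriv A) : Prop :=
  ∃ (r : G.R) (ds : ∀ o, G.Deriv (G.child r o)) (o : (G.rhs r).Occ),
    y = ⟨G.lhs r, node r ds⟩ ∧ x = ⟨G.child r o, ds o⟩

/-- `x` is the subtree of `y` at some position other than the root. -/
def IsProperSubtree (x y : Σ A, G.Deriv A) : Prop := Relation.TransGen IsChild x y

theorem toTree_injective_aux {A : G.N} (d : G.Deriv A) :
    ∀ {B : G.N} (e : G.Deriv B), d.toTree = e.toTree →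
      (⟨A, d⟩ : Σ A, G.Deriv A) = ⟨B, e⟩ := by
  induction d with
  | node r ds ih =>
    intro B e h
    cases e with
    | node r' ds' =>
      simp only [toTree, WType.mk.injEq] at h
      obtain ⟨rfl, h⟩ := h
      have h := eq_of_heq h
      have : ds = ds' := by
        funext o
        have h1 := congrFun h ((G.rhs r).occEquiv.symm o)
        have h2 := ih _ _ h1
        have h3 := eq_of_heq (Sigma.mk.inj h2).2
        rw [Equiv.apply_symm_apply] at h3
        exact h3
      rw [this]

theorem toTree_injective (A : G.N) : Function.Injective (toTree (G := G) (A := A)) := by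
  intro d e h
  exact eq_of_heq (Sigma.mk.inj (toTree_injective_aux d e h)).2

instance (A : G.N) : Countable (G.Deriv A) := by
  have : Countable (RTree G.rank) := by
    have := Encodable.ofCountable G.R
    infer_instance
  exact (toTree_injective A).countable

end Deriv

/-- The formal tree language. -/
def treeLanguage (G : RTG Γ) : Set (GTerm Γ (G.sort G.start)) :=
  Set.range fun d : G.Deriv G.start => d.proj

/-- The language generated by the language model `(G, L)`. -/
def language (G : RTG Γ) (L : SortedAlgebra.{u, v} Γ) : Set L.Obj :=
  Set.range fun d : G.Deriv G.start => ⟨G.sort G.start, d.value L⟩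

/-- The set of syntax trees of `G`, as ranked trees over the rules. -/
def ast (G : RTG Γ) : Set (RTree G.rank) :=
  Set.range fun d : G.Deriv G.start => d.toTree

/-- The set of syntax trees of `G` that evaluate to `a`, as ranked trees over the rules. -/
def astOf (G : RTG Γ) (L : SortedAlgebra.{u, v} Γ) (a : L.carrier (G.sort G.start)) :
    Set (RTree G.rank) :=
  {t | ∃ d : G.Deriv G.start, d.value L = a ∧ d.toTree = t}

/-- No syntax tree has the same value and the same root rule as one of its proper subtrees. -/
def Nonlooping (G : RTG Γ) (L : SortedAlgebra.{u, v} Γ) : Prop :=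
  ∀ d p : Σ A, G.Deriv A, Deriv.IsProperSubtree p d →
    (⟨G.sort d.1, d.2.value L⟩ : L.Obj) = ⟨G.sort p.1, p.2.value L⟩ → d.2.root ≠ p.2.root

/-- No rule occurs twice on a path of a syntax tree. -/
def Acyclic (G : RTG Γ) : Prop :=
  ∀ d p : Σ A, G.Deriv A, Deriv.IsProperSubtree p d → d.2.root ≠ p.2.root

end RTG

/-! ### Complete M-monoids -/

/-- An infinitary sum operation for countable families that satisfies the laws of a complete
monoid; in the last law, the fibres of `p` are an arbitrary `J`-partition of `I`. -/
class InfSum (K : Type v) [AddCommMonoid K] where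
  isum : ∀ {I : Type u} [Countable I], (I → K) → K
  isum_empty : ∀ {I : Type u} [Countable I] [IsEmpty I] (f : I → K), isum f = 0
  isum_single : ∀ {I : Type u} [Countable I] (f : I → K) (j : I), (∀ i, i = j) → isum f = f j
  isum_pair : ∀ {I : Type u} [Countable I] (f : I → K) (j j' : I), j ≠ j' →
    (∀ i, i = j ∨ i = j') → isum f = f j + f j'
  isum_partition : ∀ {I J : Type u} [Countable I] [Countable J] (p : I → J) (f : I → K),
    isum f = isum fun j : J => isum fun i : {i // p i = j} => f i

/-- The data and laws from which a complete commutative monoid arises (the laws of a commutative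
monoid follow from those of the infinitary sum). -/
structure SumOp (K : Type v) where
  zero : K
  add : K → K → K
  isum : ∀ {I : Type u} [Countable I], (I → K) → K
  isum_empty : ∀ {I : Type u} [Countable I] [IsEmpty I] (f : I → K), isum f = zero
  isum_single : ∀ {I : Type u} [Countable I] (f : I → K) (j : I), (∀ i, i = j) → isum f = f j
  isum_pair : ∀ {I : Type u} [Countable I] (f : I → K) (j j' : I), j ≠ j' →
    (∀ i, i = j ∨ i = j') → isum f = add (f j) (f j')
  isum_partition : ∀ {I J : Type u} [Countable I] [Countable J] (p : I → J) (f : I → K),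
    isum f = isum fun j : J => isum fun i : {i // p i = j} => f i

namespace SumOp

variable {K : Type v} (s : SumOp.{u, v} K)

theorem add_comm' (a b : K) : s.add a b = s.add b a := by
  let f : ULift.{u} Bool → K := fun x => if x.down then a else b
  have h1 := s.isum_pair f ⟨true⟩ ⟨false⟩ (by simp) (by rintro ⟨_ | _⟩ <;> simp)
  have h2 := s.isum_pair f ⟨false⟩ ⟨true⟩ (by simp) (by rintro ⟨_ | _⟩ <;> simp)
  simpa [f] using h1.symm.trans h2

theorem add_zero' (a : K) : s.add a s.zero = a := by
  let f : PUnit.{u + 1} → K := fun _ => a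
  let p : PUnit.{u + 1} → ULift.{u} Bool := fun _ => ⟨true⟩
  have h := s.isum_partition p f
  rw [s.isum_single f ⟨⟩ (fun _ => rfl),
    s.isum_pair _ ⟨true⟩ ⟨false⟩ (by simp) (by rintro ⟨_ | _⟩ <;> simp)] at h
  have : IsEmpty {i // p i = ⟨false⟩} := ⟨fun i => by simpa [p] using i.2⟩
  rw [s.isum_empty (fun i : {i // p i = ⟨false⟩} => f i),
    s.isum_single (fun i : {i // p i = ⟨true⟩} => f i) ⟨⟨⟩, rfl⟩ (fun _ => rfl)] at h
  exact h.symm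

theorem add_assoc' (a b c : K) : s.add (s.add a b) c = s.add a (s.add b c) := by
  let f : ULift.{u} (Fin 3) → K := fun x => ![a, b, c] x.down
  let p : ULift.{u} (Fin 3) → ULift.{u} Bool := fun x => ⟨decide (x.down = 2)⟩
  let q : ULift.{u} (Fin 3) → ULift.{u} Bool := fun x => ⟨decide (x.down = 0)⟩
  have hp := s.isum_partition p f
  have hq := s.isum_partition q f
  rw [s.isum_pair (fun j : ULift.{u} Bool => s.isum fun i : {i // p i = j} => f i)
      ⟨false⟩ ⟨true⟩ (by simp) (by rintro ⟨_ | _⟩ <;> simp),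
    s.isum_pair (fun i : {i // p i = ⟨false⟩} => f i) ⟨⟨0⟩, rfl⟩ ⟨⟨1⟩, rfl⟩ (by simp)
      (by rintro ⟨⟨x⟩, hx⟩; fin_cases x <;> simp [p] at hx ⊢),
    s.isum_single (fun i : {i // p i = ⟨true⟩} => f i) ⟨⟨2⟩, rfl⟩
      (by rintro ⟨⟨x⟩, hx⟩; fin_cases x <;> simp [p] at hx ⊢)] at hp
  rw [s.isum_pair (fun j : ULift.{u} Bool => s.isum fun i : {i // q i = j} => f i)
      ⟨true⟩ ⟨false⟩ (by simp) (by rintro ⟨_ | _⟩ <;> simp),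
    s.isum_pair (fun i : {i // q i = ⟨false⟩} => f i) ⟨⟨1⟩, rfl⟩ ⟨⟨2⟩, rfl⟩ (by simp)
      (by rintro ⟨⟨x⟩, hx⟩; fin_cases x <;> simp [q] at hx ⊢),
    s.isum_single (fun i : {i // q i = ⟨true⟩} => f i) ⟨⟨0⟩, rfl⟩
      (by rintro ⟨⟨x⟩, hx⟩; fin_cases x <;> simp [q] at hx ⊢)] at hq
  simpa [f] using hp.symm.trans hq

/-- The commutative monoid `(K, add, zero)`. -/
abbrev toAddCommMonoid : AddCommMonoid K where
  add := s.add
  zero := s.zero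
  add_assoc := s.add_assoc'
  add_comm := s.add_comm'
  add_zero := s.add_zero'
  zero_add := fun a => (s.add_comm' s.zero a).trans (s.add_zero' a)
  nsmul := @nsmulRec K ⟨s.zero⟩ ⟨s.add⟩

abbrev toInfSum : @InfSum.{u, v} K s.toAddCommMonoid :=
  @InfSum.mk K s.toAddCommMonoid s.isum s.isum_empty s.isum_single s.isum_pair s.isum_partition

end SumOp

/-- A complete multioperator monoid: a complete commutative monoid `K` with a ranked set `Ω` of
operations on `K` that contains a null operation of each rank. -/
structure CompleteMMonoid where
  K : Type v
  monoid : AddCommMonoid K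
  infSum : InfSum.{u, v} K
  Ω : Type w
  ar : Ω → ℕ
  op : ∀ ω : Ω, (Fin (ar ω) → K) → K
  null : ∀ k : ℕ, ∃ ω : Ω, ar ω = k ∧ ∀ x, op ω x = 0

namespace CompleteMMonoid

instance (M : CompleteMMonoid.{u, v, w}) : AddCommMonoid M.K := M.monoid
instance (M : CompleteMMonoid.{u, v, w}) : InfSum.{u, v} M.K := M.infSum

/-- The M-monoid with the given operations and, in addition, the null operations. -/
def ofOps {K : Type v} (monoid : AddCommMonoid K) (infSum : InfSum.{u, v} K) {Ω : Type w}
    (ar : Ω → ℕ) (op : ∀ ω : Ω, (Fin (ar ω) → K) → K) : CompleteMMonoid.{u, v, w} where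
  K := K
  monoid := monoid
  infSum := infSum
  Ω := Ω ⊕ ℕ
  ar := Sum.elim ar id
  op
    | Sum.inl ω => op ω
    | Sum.inr _ => fun _ => 0
  null := fun k => ⟨Sum.inr k, rfl, fun _ => rfl⟩

/-- The M-monoid `M` with the identity mapping (`none`) added to its operations. -/
def addId (M : CompleteMMonoid.{u, v, w}) : CompleteMMonoid.{u, v, w} where
  K := M.K
  monoid := M.monoid
  infSum := M.infSum
  Ω := Option M.Ω
  ar
    | none => 1
    | some ω => M.ar ω
  op
    | none => fun x => x 0
    | some ω => M.op ω
  null := fun k => by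
    obtain ⟨ω, h, h'⟩ := M.null k
    exact ⟨some ω, h, h'⟩

/-- The operations distribute over `+`, and `0` is absorbing. -/
def Distributive (M : CompleteMMonoid.{u, v, w}) : Prop :=
  (∀ (ω : M.Ω) (x : Fin (M.ar ω) → M.K) (i : Fin (M.ar ω)) (a b : M.K),
    M.op ω (Function.update x i (a + b)) =
      M.op ω (Function.update x i a) + M.op ω (Function.update x i b)) ∧
  ∀ (ω : M.Ω) (x : Fin (M.ar ω) → M.K), (∃ i, x i = 0) → M.op ω x = 0

/-- Superior M-monoids: complete and distributive M-monoids whose addition and infinitary sum are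
minimum and infimum with respect to a total order with least element, and whose operations
are superior functions. -/
def Superior (M : CompleteMMonoid.{u, v, w}) : Prop :=
  M.Distributive ∧ ∃ _ : LinearOrder M.K,
    (∀ a b : M.K, a + b = min a b) ∧
    (∀ (I : Type u) [Countable I] (f : I → M.K), IsGLB (Set.range f) (InfSum.isum f)) ∧
    (∃ b : M.K, ∀ a, b ≤ a) ∧
    (∀ (ω : M.Ω) (x : Fin (M.ar ω) → M.K) (i : Fin (M.ar ω)) (a : M.K), a ≤ x i →
      M.op ω (Function.update x i a) ≤ M.op ω x) ∧
    ∀ (ω : M.Ω) (x : Fin (M.ar ω) → M.K) (i : Fin (M.ar ω)), x i ≤ M.op ω x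

end CompleteMMonoid

/-! ### Weighted language models, the parsing problem and the algorithm -/

/-- A weighted RTG-based language model with language algebra `L` and weight algebra `M`. -/
structure WRTGLM {S : Type u} {Γ : Signature S} (L : SortedAlgebra.{u, u} Γ)
    (M : CompleteMMonoid.{u, v, w}) where
  G : RTG Γ
  wt : G.R → M.Ω
  ar_wt : ∀ r, M.ar (wt r) = G.rank r

namespace WRTGLM

variable {S : Type u} {Γ : Signature S} {L : SortedAlgebra.{u, u} Γ}
  {M : CompleteMMonoid.{u, v, w}}

/-- The weight operation of a rule, applied to one argument for each occurrence of a nonterminal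
in the right-hand side (from left to right). -/
def ruleOp (LM : WRTGLM L M) (r : LM.G.R) (x : (LM.G.rhs r).Occ → M.K) : M.K :=
  M.op (LM.wt r) fun i => x ((LM.G.rhs r).occEquiv (Fin.cast (LM.ar_wt r) i))

/-- The weight of a syntax tree. -/
def weight (LM : WRTGLM L M) : {A : LM.G.N} → LM.G.Deriv A → M.K
  | _, .node r ds => LM.ruleOp r fun o => LM.weight (ds o)

/-- The syntactic objects that are to be parsed. -/
abbrev Input (LM : WRTGLM L M) : Type u := L.carrier (LM.G.sort LM.G.start)

/-- The solution of the M-monoid parsing problem. -/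
def parse (LM : WRTGLM L M) (a : LM.Input) : M.K :=
  InfSum.isum fun d : {d : LM.G.Deriv LM.G.start // d.value L = a} => LM.weight d.1

/-! The value computation algorithm. -/

/-- The value that is computed for the nonterminal `A` from the current values `V`. -/
def newVal (LM : WRTGLM L M) (V : LM.G.N → M.K) (A : LM.G.N) : M.K :=
  ∑ᶠ r : {r : LM.G.R // LM.G.lhs r = A}, LM.ruleOp r.1 fun o => V (LM.G.child r.1 o)

open Classical in
/-- The body of the inner loop; the state consists of the values and the variable `changed`. -/
def step (LM : WRTGLM L M) (st : (LM.G.N → M.K) × Prop) (A : LM.G.N) :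
    (LM.G.N → M.K) × Prop :=
  (Function.update st.1 A (LM.newVal st.1 A), st.2 ∨ st.1 A ≠ LM.newVal st.1 A)

/-- One iteration of the outer loop, which visits the nonterminals in the order `l`. -/
def round (LM : WRTGLM L M) (l : List LM.G.N) (V : LM.G.N → M.K) : (LM.G.N → M.K) × Prop :=
  l.foldl LM.step (V, False)

/-- The values before iteration `n` of the outer loop, where iteration `n` visits the nonterminals
in the order `ord n`. -/
def values (LM : WRTGLM L M) (ord : ℕ → List LM.G.N) : ℕ → LM.G.N → M.K
  | 0 => fun _ => 0
  | n + 1 => (LM.round (ord n) (LM.values ord n)).1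

/-- The value of `changed` at the end of iteration `n`. -/
def changed (LM : WRTGLM L M) (ord : ℕ → List LM.G.N) (n : ℕ) : Prop :=
  (LM.round (ord n) (LM.values ord n)).2

/-- Iteration `n` is the last one. -/
def HaltsAfter (LM : WRTGLM L M) (ord : ℕ → List LM.G.N) (n : ℕ) : Prop :=
  ¬ LM.changed ord n ∧ ∀ m < n, LM.changed ord m

/-- In each iteration of the outer loop, each nonterminal is visited exactly once. -/
def IsSchedule (LM : WRTGLM L M) (ord : ℕ → List LM.G.N) : Prop :=
  ∀ n, (ord n).Nodup ∧ ∀ A, A ∈ ord n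

/-- For every order in which the inner loop visits the nonterminals, the value computation
algorithm terminates with output `k`. -/
def Computes (LM : WRTGLM L M) (k : M.K) : Prop :=
  ∀ ord, LM.IsSchedule ord → ∃ n, LM.HaltsAfter ord n ∧ LM.values ord (n + 1) LM.G.start = k

end WRTGLM

/-! The canonical weighted deduction system. -/

/-- The signature with the symbols `⟨x₁ … x_k⟩`. -/
def cfgSig : Signature.{u} PUnit where
  Op := ULift ℕ
  ar := fun σ => σ.down
  dom := fun _ _ => ⟨⟩
  cod := fun _ => ⟨⟩

/-- The algebra of strings over the empty alphabet, in which `⟨x₁ … x_k⟩` is concatenation. -/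
def cfgAlg : SortedAlgebra.{u, u} cfgSig.{u} where
  carrier := fun _ => List PEmpty
  interp := fun _ x => (List.ofFn x).flatten

namespace WRTGLM

variable {S : Type u} {Γ : Signature S} {L : SortedAlgebra.{u, u} Γ}
  {M : CompleteMMonoid.{u, v, w}} (LM : WRTGLM L M) (a : LM.Input)

/-- The right-hand sides of rules. -/
def Rhs : Type u :=
  {t : Σ s, Term Γ LM.G.sort s //
    ∃ r, (⟨LM.G.sort (LM.G.lhs r), LM.G.rhs r⟩ : Σ s, Term Γ LM.G.sort s) = t}

/-- The input as an element of the sorted carrier set. -/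
abbrev inputObj : L.Obj := ⟨LM.G.sort LM.G.start, a⟩

/-- The items: the triples `[A, t, b]` and the goal item (`none`). -/
abbrev Item : Type u := Option (LM.G.N × LM.Rhs × L.factors (LM.inputObj a))

/-- For a rule of `G`, a choice of factors and right-hand sides for the nonterminals. -/
def InstOf (r : LM.G.R) : Type u :=
  {p : (∀ o, L.FactorsAt (LM.inputObj a) (LM.G.sort (LM.G.child r o))) ×
      (∀ o, {t : LM.Rhs // t.1.1 = LM.G.sort (LM.G.child r o)}) //
    (⟨LM.G.sort (LM.G.lhs r), (LM.G.rhs r).eval L fun o => (p.1 o).1⟩ : L.Obj)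
      ∈ L.factors (LM.inputObj a)}

/-- The rules: the instances of the rules of `G`, and the rules for the goal item. -/
abbrev Inst : Type u := (Σ r, LM.InstOf a r) ⊕ {r : LM.G.R // LM.G.lhs r = LM.G.start}

/-- The right-hand side of a rule as an element of `LM.Rhs`. -/
def rhsOf (r : LM.G.R) : LM.Rhs := ⟨⟨_, LM.G.rhs r⟩, r, rfl⟩

variable {LM a}

/-- The item at an occurrence in the right-hand side of an instance. -/
def InstOf.childItem {r : LM.G.R} (p : LM.InstOf a r) (o : (LM.G.rhs r).Occ) : LM.Item a :=
  some (LM.G.child r o, (p.1.2 o).1, ⟨_, (p.1.1 o).2⟩)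

/-- The rule `A' → ⟨x₁ … x_k⟩(B₁, …, B_k)`. -/
def itemTerm {X : Type u} (k : ℕ) (B : Fin k → X) :
    Term cfgSig.{u} (fun _ : X => PUnit.unit) PUnit.unit :=
  Term.op (Γ := cfgSig.{u}) (sort := fun _ : X => PUnit.unit) (ULift.up k : ULift ℕ)
    fun i => Term.var (Γ := cfgSig.{u}) (sort := fun _ : X => PUnit.unit) (B i)

theorem count_itemTerm {X : Type u} (k : ℕ) (B : Fin k → X) : (itemTerm k B).count = k := by
  change ∑ _i : Fin k, 1 = k
  simp

/-- The left-hand side of a rule. -/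
def instLhs : LM.Inst a → LM.Item a
  | Sum.inl ⟨r, p⟩ => some (LM.G.lhs r, LM.rhsOf r, ⟨_, p.2⟩)
  | Sum.inr _ => none

/-- The right-hand side of a rule. -/
def instRhs : LM.Inst a → Term cfgSig.{u} (fun _ : LM.Item a => PUnit.unit) PUnit.unit
  | Sum.inl ⟨r, p⟩ => itemTerm (LM.G.rank r) fun i => p.childItem ((LM.G.rhs r).occEquiv i)
  | Sum.inr r => itemTerm 1 fun _ => some (LM.G.start, LM.rhsOf r.1, ⟨_, .refl⟩)

end WRTGLM

theorem RTG.rule_ext {S : Type u} {Γ : Signature S} (G : RTG Γ) {r r' : G.R}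
    (h : G.lhs r = G.lhs r') (h' : HEq (G.rhs r) (G.rhs r')) : r = r' :=
  G.inj (Sigma.ext h h')

namespace WRTGLM

variable {S : Type u} {Γ : Signature S} {L : SortedAlgebra.{u, u} Γ}
  {M : CompleteMMonoid.{u, v, w}} {LM : WRTGLM L M} {a : LM.Input}

theorem itemTerm_injective {X : Type u} (k : ℕ) :
    Function.Injective (itemTerm (X := X) k) := by
  intro B B' h
  have h1 := Term.op.inj h
  funext i
  have h2 := congrArg Term.leafLabel (congrFun h1 i)
  simpa [Term.leafLabel] using h2

theorem InstOf.ext_childItem {r : LM.G.R} {p q : LM.InstOf a r}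
    (h : ∀ o, p.childItem o = q.childItem o) : p = q := by
  apply Subtype.ext
  apply Prod.ext
  · funext o
    have := h o
    simp only [InstOf.childItem, Option.some.injEq, Prod.mk.injEq, true_and] at this
    have h2 := congrArg Subtype.val this.2
    exact Subtype.ext (eq_of_heq (Sigma.mk.inj h2).2)
  · funext o
    have := h o
    simp only [InstOf.childItem, Option.some.injEq, Prod.mk.injEq, true_and] at this
    exact Subtype.ext this.1

theorem inst_injective :
    Function.Injective fun i : LM.Inst a =>
      (⟨instLhs i, instRhs i⟩ : Σ _ : LM.Item a, Term cfgSig.{u} (fun _ => PUnit.unit) _) := by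
  intro i j h
  have h1 : instLhs i = instLhs j := congrArg Sigma.fst h
  have h2 : instRhs i = instRhs j := eq_of_heq (Sigma.mk.inj h).2
  rcases i with ⟨r, p⟩ | ⟨r, hr⟩ <;> rcases j with ⟨r', p'⟩ | ⟨r', hr'⟩
  · simp only [instLhs, Option.some.injEq, Prod.mk.injEq] at h1
    have h3 : r = r' := LM.G.rule_ext h1.1 (Sigma.mk.inj (congrArg Subtype.val h1.2.1)).2
    subst h3
    have h4 := itemTerm_injective _ h2
    have h5 : p = p' := by
      apply InstOf.ext_childItem
      intro o
      have := congrFun h4 ((LM.G.rhs r).occEquiv.symm o)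
      simpa using this
    rw [h5]
  · simp [instLhs] at h1
  · simp [instLhs] at h1
  · have h4 := congrFun (itemTerm_injective _ h2) 0
    simp only [Option.some.injEq, Prod.mk.injEq] at h4
    have h5 : r = r' :=
      LM.G.rule_ext (hr.trans hr'.symm) (Sigma.mk.inj (congrArg Subtype.val h4.2.1)).2
    subst h5
    rfl

instance : Finite LM.Rhs := by
  refine Finite.of_surjective (fun r : LM.G.R => LM.rhsOf r) ?_
  rintro ⟨t, r, rfl⟩
  exact ⟨r, rfl⟩

theorem finite_item (hL : L.FinitelyDecomposable) : Finite (LM.Item a) := by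
  have : Finite (L.factors (LM.inputObj a)) := hL _
  infer_instance

theorem finite_inst (hL : L.FinitelyDecomposable) : Finite (LM.Inst a) := by
  have := fun s => hL.finite_at (LM.inputObj a) s
  have : ∀ r, Finite (LM.InstOf a r) := fun r => by
    unfold InstOf
    infer_instance
  infer_instance

theorem rank_instRhs (i : LM.Inst a) :
    (instRhs i).count = Sum.elim (fun q => LM.G.rank q.1) (fun _ => 1) i := by
  rcases i with ⟨r, p⟩ | r <;> exact count_itemTerm _ _

/-- The canonical weighted deduction system, applied to `LM` and `a`. -/
def cnc (LM : WRTGLM L M) (hL : L.FinitelyDecomposable) (a : LM.Input) :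
    WRTGLM cfgAlg.{u} M.addId where
  G :=
    { N := LM.Item a
      finN := finite_item hL
      sort := fun _ => ⟨⟩
      start := none
      R := LM.Inst a
      finR := finite_inst hL
      lhs := instLhs
      rhs := instRhs
      inj := inst_injective }
  wt
    | Sum.inl q => some (LM.wt q.1)
    | Sum.inr _ => none
  ar_wt
    | Sum.inl q => (LM.ar_wt q.1).trans (rank_instRhs (Sum.inl q)).symm
    | Sum.inr r => (rank_instRhs (Sum.inr r)).symm

/-- On the input `(LM, a)`, the M-monoid parsing algorithm terminates, and its output is `k`. -/
def ParserOutputs (LM : WRTGLM L M) (a : LM.Input) (k : M.K) : Prop :=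
  ∃ hL : L.FinitelyDecomposable, (LM.cnc hL a).Computes k

/-- The M-monoid parsing algorithm is applicable to `LM`: for every syntactic object, it
terminates and computes the solution of the M-monoid parsing problem. -/
def Applicable (LM : WRTGLM L M) : Prop :=
  ∀ a : LM.Input, LM.ParserOutputs a (LM.parse a)

end WRTGLM

/-! ### M-monoids associated with complete semirings -/

/-- A complete semiring. -/
class CompleteSemiring (K : Type v) [Semiring K] extends InfSum.{u, v} K where
  mul_isum : ∀ {I : Type u} [Countable I] (k : K) (f : I → K),
    k * isum f = isum fun i => k * f i
  isum_mul : ∀ {I : Type u} [Countable I] (k : K) (f : I → K),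
    isum f * k = isum fun i => f i * k

/-- The M-monoid associated with a complete semiring: for each `k` and each rank `n`, the
operation `(k₁, …, k_n) ↦ k * k₁ * ⋯ * k_n`. -/
def semiringMMonoid (K : Type v) [Semiring K] [CompleteSemiring.{u, v} K] :
    CompleteMMonoid.{u, v, v} :=
  .ofOps (Ω := ℕ × K) inferInstance inferInstance Prod.fst fun ω x => ω.2 * (List.ofFn x).prod

/-! ### The best derivation M-monoid -/

namespace BD

variable {R : Type u} (rk : R → ℕ)

/-- Pairs of a probability and a set of ranked trees. -/
abbrev Carrier : Type u := unitInterval × Set (RTree rk)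

variable {rk}

def maxv (x y : Carrier rk) : Carrier rk :=
  if y.1 < x.1 then x else if x.1 < y.1 then y else (x.1, x.2 ∪ y.2)

def isum {I : Type u} (f : I → Carrier rk) : Carrier rk :=
  (⨆ i, (f i).1, ⋃ i : {i // (f i).1 = ⨆ i, (f i).1}, (f i.1).2)

variable (rk)

theorem mem_isum {I : Type u} (f : I → Carrier rk) (t : RTree rk) :
    t ∈ (isum f).2 ↔ ∃ i, (f i).1 = (⨆ i, (f i).1) ∧ t ∈ (f i).2 := by
  simp [isum]

def sumOp : SumOp.{u, u} (Carrier rk) where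
  zero := (0, ∅)
  add := maxv
  isum := isum
  isum_empty f := by
    apply Prod.ext
    · exact (iSup_of_empty _).trans bot_eq_zero
    · ext t
      simp [mem_isum]
  isum_single f j hj := by
    have hs : (⨆ i, (f i).1) = (f j).1 :=
      le_antisymm (iSup_le fun i => by rw [hj i]) (le_iSup (fun i => (f i).1) j)
    apply Prod.ext
    · exact hs
    · ext t
      rw [mem_isum, hs]
      exact ⟨fun ⟨i, _, h⟩ => hj i ▸ h, fun h => ⟨j, rfl, h⟩⟩
  isum_pair f j j' hne hj := by
    have hs : (⨆ i, (f i).1) = max (f j).1 (f j').1 := by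
      apply le_antisymm
      · refine iSup_le fun i => ?_
        rcases hj i with h | h <;> simp [h]
      · exact max_le (le_iSup (fun i => (f i).1) j) (le_iSup (fun i => (f i).1) j')
    have key : ∀ t, t ∈ (isum f).2 ↔ ((f j).1 = max (f j).1 (f j').1 ∧ t ∈ (f j).2) ∨
        ((f j').1 = max (f j).1 (f j').1 ∧ t ∈ (f j').2) := by
      intro t
      rw [mem_isum, hs]
      constructor
      · rintro ⟨i, h⟩
        rcases hj i with rfl | rfl
        · exact Or.inl h
        · exact Or.inr h
      · rintro (h | h)
        · exact ⟨_, h⟩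
        · exact ⟨_, h⟩
    unfold maxv
    split_ifs with h1 h2
    · apply Prod.ext
      · exact hs.trans (max_eq_left h1.le)
      · ext t
        rw [key, max_eq_left h1.le]
        simp [h1.ne]
    · apply Prod.ext
      · exact hs.trans (max_eq_right h2.le)
      · ext t
        rw [key, max_eq_right h2.le]
        simp [h2.ne]
    · have h3 : (f j).1 = (f j').1 := le_antisymm (not_lt.1 h1) (not_lt.1 h2)
      apply Prod.ext
      · exact hs.trans (by simp [h3])
      · ext t
        rw [key, h3]
        simp
  isum_partition p f := by
    have hs : (⨆ i, (f i).1) = ⨆ j, ⨆ i : {i // p i = j}, (f i).1 := by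
      apply le_antisymm
      · exact iSup_le fun i => le_iSup_of_le (p i)
          (le_iSup (fun i' : {i' // p i' = p i} => (f i').1) ⟨i, rfl⟩)
      · exact iSup_le fun j => iSup_le fun i => le_iSup (fun i => (f i).1) i.1
    apply Prod.ext
    · exact hs
    · ext t
      rw [mem_isum, mem_isum]
      simp only [mem_isum]
      change (∃ i, (f i).1 = (⨆ i, (f i).1) ∧ t ∈ (f i).2) ↔
        ∃ j, (⨆ i : {i // p i = j}, (f i).1) = (⨆ j, ⨆ i : {i // p i = j}, (f i).1) ∧
          ∃ i : {i // p i = j}, (f i).1 = (⨆ i : {i // p i = j}, (f i).1) ∧ t ∈ (f i).2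
      rw [← hs]
      constructor
      · rintro ⟨i, h1, h2⟩
        have h3 : (⨆ i' : {i' // p i' = p i}, (f i').1) = (f i).1 := by
          apply le_antisymm
          · rw [h1]
            exact iSup_le fun i' => le_iSup (fun i => (f i).1) i'.1
          · exact le_iSup (fun i' : {i' // p i' = p i} => (f i').1) ⟨i, rfl⟩
        exact ⟨p i, h3.trans h1, ⟨i, rfl⟩, h3.symm, h2⟩
      · rintro ⟨j, h1, i, h2, h3⟩
        exact ⟨i.1, h2.trans h1, h3⟩

/-- Top concatenation. -/
def tc (p : unitInterval) (r : R) (x : Fin (rk r) → Carrier rk) : Carrier rk :=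
  (p * ∏ i, (x i).1, {t | ∃ d : Fin (rk r) → RTree rk, (∀ i, d i ∈ (x i).2) ∧ t = ⟨r, d⟩})

/-- The best derivation M-monoid over the ranked set `(R, rk)`. -/
def mmonoid : CompleteMMonoid.{u, u, u} :=
  .ofOps (sumOp rk).toAddCommMonoid (sumOp rk).toInfSum (Ω := unitInterval × R)
    (fun ω => rk ω.2) fun ω => tc rk ω.1 ω.2

/-- The operation `tc` with probability `p` for the symbol `r`. -/
def tcOp (p : unitInterval) (r : R) : (mmonoid rk).Ω := Sum.inl (p, r)

end BD

/-! ### The `n`-best M-monoid -/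

namespace NBest

/-- Nonincreasing `n`-tuples of probabilities. -/
abbrev Carrier (n : ℕ) : Type := {f : Fin n → unitInterval // Antitone f}

/-- The `n` greatest members of a family, counted with multiplicity.  The member number `i`
(counted from `0`) is the supremum of all `x` such that at least `i + 1` members are `≥ x`; hence,
for an infinite family, the supremum of the remaining members is repeated as soon as it
is not attained, and a family with fewer than `n` members is padded with `0`. -/
def takeNBest (n : ℕ) {ι : Type u} (f : ι → unitInterval) : Carrier n :=
  ⟨fun i => sSup {x | ∃ s : Finset ι, s.card = i + 1 ∧ ∀ j ∈ s, x ≤ f j}, by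
    intro i j hij
    apply sSup_le_sSup
    rintro x ⟨s, hs, hx⟩
    obtain ⟨t, hts, ht⟩ := Finset.exists_subset_card_eq (s := s) (n := i.1 + 1)
      (by have : i.1 ≤ j.1 := hij; omega)
    exact ⟨t, ht, fun j hj => hx j (hts hj)⟩⟩

variable (n : ℕ)

/-- The `n` greatest members of the concatenation of two tuples. -/
def maxn (a b : Carrier n) : Carrier n := takeNBest n (Sum.elim a.1 b.1)

/-- The `n` greatest products. -/
def muln (a b : Carrier n) : Carrier n :=
  takeNBest n fun ij : Fin n × Fin n => a.1 ij.1 * b.1 ij.2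

/-- The `n` greatest members of all tuples of a family. -/
def isum {I : Type u} (f : I → Carrier n) : Carrier n :=
  takeNBest n fun ik : I × Fin n => (f ik.1).1 ik.2

variable {n}

theorem lt_takeNBest {ι : Type u} (f : ι → unitInterval) (i : Fin n) (x : unitInterval) :
    x < (takeNBest n f).1 i ↔ ((i.1 + 1 : ℕ) : ℕ∞) ≤ {j | x < f j}.encard := by
  change x < sSup _ ↔ _
  rw [lt_sSup_iff]
  constructor
  · rintro ⟨y, ⟨s, hs, hy⟩, hxy⟩
    rw [← hs, ← Set.encard_coe_eq_coe_finsetCard]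
    exact Set.encard_le_encard fun j hj => lt_of_lt_of_le hxy (hy j hj)
  · intro h
    obtain ⟨t, ht, hc⟩ := Set.exists_subset_encard_eq h
    have hfin : t.Finite := Set.finite_of_encard_eq_coe hc
    have hcard : hfin.toFinset.card = i.1 + 1 := by
      have := hfin.encard_eq_coe_toFinset_card
      rw [hc] at this
      exact_mod_cast this.symm
    have hne : hfin.toFinset.Nonempty := by
      rw [← Finset.card_pos, hcard]
      omega
    obtain ⟨j, hj, hmin⟩ := hfin.toFinset.exists_min_image f hne
    exact ⟨f j, ⟨_, hcard, hmin⟩, ht (hfin.mem_toFinset.1 hj)⟩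

theorem ext_lt {a b : Carrier n} (h : ∀ i x, x < a.1 i ↔ x < b.1 i) : a = b :=
  Subtype.ext (funext fun i => eq_of_forall_lt_iff (h i))

theorem takeNBest_congr {ι κ : Type*} (f : ι → unitInterval) (g : κ → unitInterval)
    (h : ∀ x, {j | x < f j}.encard = {j | x < g j}.encard) :
    takeNBest n f = takeNBest n g :=
  ext_lt fun i x => by rw [lt_takeNBest, lt_takeNBest, h]

theorem takeNBest_self (a : Carrier n) : takeNBest n a.1 = a := by
  refine ext_lt fun i x => ?_
  rw [lt_takeNBest]
  constructor
  · intro h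
    by_contra hx
    have hsub : {j | x < a.1 j} ⊆ ((Finset.Iio i : Finset (Fin n)) : Set (Fin n)) := by
      intro j hj
      rw [Finset.coe_Iio, Set.mem_Iio]
      by_contra hji
      exact hx (lt_of_lt_of_le hj (a.2 (not_lt.1 hji)))
    have := h.trans (Set.encard_le_encard hsub)
    rw [Set.encard_coe_eq_coe_finsetCard, Fin.card_Iio] at this
    have h2 : i.1 + 1 ≤ i.1 := by exact_mod_cast this
    omega
  · intro h
    have hsub : ((Finset.Iic i : Finset (Fin n)) : Set (Fin n)) ⊆ {j | x < a.1 j} := by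
      intro j hj
      rw [Finset.coe_Iic, Set.mem_Iic] at hj
      exact lt_of_lt_of_le h (a.2 hj)
    have := Set.encard_le_encard hsub
    rw [Set.encard_coe_eq_coe_finsetCard, Fin.card_Iic] at this
    exact this

theorem encard_eq_of_equiv {ι κ : Type*} (e : ι ≃ κ) (f : ι → unitInterval)
    (g : κ → unitInterval) (h : ∀ j, f j = g (e j)) (x : unitInterval) :
    {j | x < f j}.encard = {j | x < g j}.encard := by
  have : {j | x < g j} = e '' {j | x < f j} := by
    ext k
    simp only [Set.mem_ofPred_eq, Set.mem_image, h]
    exact ⟨fun hk => ⟨e.symm k, by simpa using hk, by simp⟩, by rintro ⟨j, hj, rfl⟩; exact hj⟩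
  rw [this, e.injective.encard_image]

theorem encard_le_of_fibers {α β : Type*} {J : Type u} (A : Set α) (T : Set β) (p : α → J)
    (q : β → J) (hfin : ∀ j, {a | a ∈ A ∧ p a = j}.Finite)
    (hle : ∀ j, {a | a ∈ A ∧ p a = j}.encard ≤ {b | b ∈ T ∧ q b = j}.encard) :
    A.encard ≤ T.encard := by
  rcases A.eq_empty_or_nonempty with rfl | ⟨a₀, ha₀⟩
  · simp
  have hne : Nonempty β := by
    have h1 : {a | a ∈ A ∧ p a = p a₀}.Nonempty := ⟨a₀, ha₀, rfl⟩
    have h2 := (Set.encard_pos.2 h1).trans_le (hle (p a₀))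
    obtain ⟨b, -⟩ := Set.encard_pos.1 h2
    exact ⟨b⟩
  choose g hg hinj using fun j => (hfin j).exists_injOn_of_encard_le (hle j)
  refine Set.encard_le_encard_of_injOn (f := fun a => g (p a) a) ?_ ?_
  · intro a ha
    exact (hg (p a) (show a ∈ A ∧ p a = p a from ⟨ha, rfl⟩)).1
  · intro a ha b hb hab
    have h1 := (hg (p a) (show a ∈ A ∧ p a = p a from ⟨ha, rfl⟩)).2
    have h2 := (hg (p b) (show b ∈ A ∧ p b = p b from ⟨hb, rfl⟩)).2
    have h3 : p a = p b := by
      rw [← h1, ← h2]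
      exact congrArg q hab
    refine hinj (p b) (show a ∈ A ∧ p a = p b from ⟨ha, h3⟩)
      (show b ∈ A ∧ p b = p b from ⟨hb, rfl⟩) ?_
    simpa only [h3] using hab

theorem encard_positions (n : ℕ) (e : ℕ∞) :
    {k : Fin n | ((k.1 + 1 : ℕ) : ℕ∞) ≤ e}.encard = min (n : ℕ∞) e := by
  induction e using ENat.recTopCoe with
  | top => simp
  | coe c =>
    have : {k : Fin n | ((k.1 + 1 : ℕ) : ℕ∞) ≤ (c : ℕ∞)} =
        ((Finset.univ.filter fun k : Fin n => k.1 < c : Finset (Fin n)) : Set (Fin n)) := by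
      ext k
      rw [Finset.coe_filter]
      change ((k.1 + 1 : ℕ) : ℕ∞) ≤ (c : ℕ∞) ↔ k ∈ Finset.univ ∧ k.1 < c
      rw [Nat.cast_le, Nat.succ_le_iff]
      simp
    rw [this, Set.encard_coe_eq_coe_finsetCard, Fin.card_filter_val_lt]
    rcases le_total n c with h | h
    · rw [min_eq_left h, min_eq_left (Nat.cast_le.2 h)]
    · rw [min_eq_right h, min_eq_right (Nat.cast_le.2 h)]

theorem isum_partition {I J : Type u} (p : I → J) (f : I → Carrier n) :
    isum n f = isum n fun j : J => isum n fun i : {i // p i = j} => f i := by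
  refine ext_lt fun m x => ?_
  unfold isum
  rw [lt_takeNBest, lt_takeNBest]
  let A : Set (I × Fin n) := {ik | x < (f ik.1).1 ik.2}
  let F : J → Set (I × Fin n) := fun j => {ik | ik ∈ A ∧ p ik.1 = j}
  have hF : ∀ j, {ik : {i // p i = j} × Fin n | x < (f ik.1).1 ik.2}.encard = (F j).encard := by
    intro j
    have hinj : Function.Injective
        fun ik : {i // p i = j} × Fin n => ((ik.1.1, ik.2) : I × Fin n) := by
      rintro ⟨⟨i, hi⟩, k⟩ ⟨⟨i', hi'⟩, k'⟩ h
      simp only [Prod.mk.injEq] at h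
      obtain ⟨rfl, rfl⟩ := h
      rfl
    rw [← hinj.encard_image]
    congr 1
    ext ⟨i, k⟩
    constructor
    · rintro ⟨⟨⟨i', hi'⟩, k'⟩, h, h'⟩
      cases h'
      exact ⟨h, hi'⟩
    · rintro ⟨h1, h2⟩
      exact ⟨⟨⟨i, h2⟩, k⟩, h1, rfl⟩
  let T : Set (J × Fin n) := {jk | ((jk.2.1 + 1 : ℕ) : ℕ∞) ≤ (F jk.1).encard}
  have hT : {jk : J × Fin n | x < (takeNBest n fun ik : {i // p i = jk.1} × Fin n =>
      (f ik.1).1 ik.2).1 jk.2} = T := by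
    ext ⟨j, k⟩
    change x < (takeNBest n fun ik : {i // p i = j} × Fin n => (f ik.1).1 ik.2).1 k ↔
      ((k.1 + 1 : ℕ) : ℕ∞) ≤ (F j).encard
    rw [lt_takeNBest, hF]
  rw [hT]
  change _ ≤ A.encard ↔ _
  have hTj : ∀ j, {b | b ∈ T ∧ b.1 = j}.encard = min (n : ℕ∞) (F j).encard := by
    intro j
    rw [← encard_positions n (F j).encard,
      ← (Prod.mk_right_injective (β := Fin n) j).encard_image]
    congr 1
    ext ⟨j', k⟩
    constructor
    · rintro ⟨h, rfl⟩
      exact ⟨k, h, rfl⟩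
    · rintro ⟨k', h, h'⟩
      cases h'
      exact ⟨h, rfl⟩
  have hTfin : ∀ j, {b | b ∈ T ∧ b.1 = j}.Finite := by
    intro j
    rw [← Set.encard_lt_top_iff, hTj]
    exact lt_of_le_of_lt (min_le_left _ _) (ENat.natCast_lt_top n)
  have hmn : ((m.1 + 1 : ℕ) : ℕ∞) ≤ (n : ℕ∞) := by exact_mod_cast m.2
  constructor
  · intro h
    by_cases hbig : ∃ j, (n : ℕ∞) ≤ (F j).encard
    · obtain ⟨j, hj⟩ := hbig
      calc ((m.1 + 1 : ℕ) : ℕ∞) ≤ (n : ℕ∞) := hmn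
        _ = {b | b ∈ T ∧ b.1 = j}.encard := by rw [hTj, min_eq_left hj]
        _ ≤ T.encard := Set.encard_le_encard fun b hb => hb.1
    · push Not at hbig
      refine h.trans (encard_le_of_fibers A T (fun ik => p ik.1) Prod.fst ?_ ?_)
      · intro j
        rw [← Set.encard_lt_top_iff]
        exact lt_of_lt_of_le (hbig j) le_top
      · intro j
        rw [hTj, min_eq_right (hbig j).le]
  · intro h
    refine h.trans (encard_le_of_fibers T A Prod.fst (fun ik => p ik.1) hTfin ?_)
    intro j
    rw [hTj]
    exact min_le_right _ _

def sumOp (n : ℕ) : SumOp.{u, 0} (Carrier n) where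
  zero := ⟨fun _ => 0, antitone_const⟩
  add := maxn n
  isum := isum n
  isum_empty f := by
    refine ext_lt fun i x => ?_
    unfold isum
    rw [lt_takeNBest, Set.encard_eq_zero.2 (Set.eq_empty_of_forall_notMem fun j => isEmptyElim j.1)]
    simp
  isum_single f j hj := by
    refine (takeNBest_congr _ (f j).1 fun x => ?_).trans (takeNBest_self _)
    refine encard_eq_of_equiv ⟨fun ik => ik.2, fun k => (j, k), ?_, fun _ => rfl⟩ _ _ ?_ x
    · rintro ⟨i, k⟩
      rw [hj i]
    · rintro ⟨i, k⟩
      rw [hj i]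
      rfl
  isum_pair f j j' hne hj := by
    classical
    refine takeNBest_congr _ _ fun x => ?_
    refine (encard_eq_of_equiv (Equiv.ofBijective
      (Sum.elim (fun k => (j, k)) fun k => (j', k)) ⟨?_, ?_⟩) _ _ ?_ x).symm
    · rintro (k | k) (k' | k') h
      · cases h
        rfl
      · exact absurd (congrArg Prod.fst h) hne
      · exact absurd (congrArg Prod.fst h).symm hne
      · cases h
        rfl
    · rintro ⟨i, k⟩
      rcases hj i with rfl | rfl
      · exact ⟨Sum.inl k, rfl⟩
      · exact ⟨Sum.inr k, rfl⟩
    · rintro (k | k) <;> rfl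
  isum_partition p f := isum_partition p f

/-- The `n`-best M-monoid; its operations are `(k₁, …, k_m) ↦ κ ·ₙ k₁ ·ₙ ⋯ ·ₙ k_m`. -/
def mmonoid (n : ℕ) : CompleteMMonoid.{u, 0, 0} :=
  .ofOps (sumOp.{u} n).toAddCommMonoid (sumOp.{u} n).toInfSum (Ω := ℕ × Carrier n)
    Prod.fst fun ω x => (List.ofFn x).foldl (muln n) ω.2

end NBest

/-! ### The intersection M-monoid -/

namespace Intersection

variable {S : Type u} {Γ : Signature S} (G : RTG Γ) (L : SortedAlgebra.{u, u} Γ)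
  (a : L.carrier (G.sort G.start))

/-- The nonterminals `[A, b]`, where `b` is a factor of `a` of the sort of `A`. -/
abbrev NT : Type u := Σ A : G.N, L.FactorsAt ⟨_, a⟩ (G.sort A)

/-- The rules `[A, b] → t([A₁, a₁], …, [A_k, a_k])` such that `A → t(A₁, …, A_k)` is a rule of `G`
and `b` is the value of `t` at `(a₁, …, a_k)`; the factors `a₁, …, a_k` form the component `an`. -/
structure Rule where
  r : G.R
  an : ∀ o : (G.rhs r).Occ, L.FactorsAt ⟨_, a⟩ (G.sort (G.child r o))
  mem : (⟨_, (G.rhs r).eval L fun o => (an o).1⟩ : L.Obj) ∈ L.factors ⟨_, a⟩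

variable {G L a}

/-- The left-hand side `[A, b]`. -/
def Rule.lhs (p : Rule G L a) : NT G L a := ⟨G.lhs p.r, _, p.mem⟩

/-- The nonterminal `[A_i, a_i]` at an occurrence in the right-hand side. -/
def Rule.child (p : Rule G L a) (o : (G.rhs p.r).Occ) : NT G L a := ⟨G.child p.r o, p.an o⟩

/-- The right-hand side. -/
def Rule.rhs (p : Rule G L a) : Term Γ (fun B : NT G L a => G.sort B.1) (G.sort p.lhs.1) :=
  (G.rhs p.r).annotate p.an

theorem Rule.inj : Function.Injective fun p : Rule G L a =>
    (⟨p.lhs, p.rhs⟩ : Σ A : NT G L a, Term Γ (fun B : NT G L a => G.sort B.1) (G.sort A.1)) := by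
  rintro ⟨r, an, h⟩ ⟨r', an', h'⟩ heq
  have h1 : (⟨G.lhs r, G.rhs r⟩ : Σ A, Term Γ G.sort (G.sort A)) = ⟨G.lhs r', G.rhs r'⟩ := by
    have := congrArg (fun q : Σ A : NT G L a,
      Term Γ (fun B : NT G L a => G.sort B.1) (G.sort A.1) =>
        (⟨q.1.1, q.2.erase⟩ : Σ A, Term Γ G.sort (G.sort A))) heq
    simpa only [Rule.lhs, Rule.rhs, Term.erase_annotate] using this
  have h2 : r = r' := G.inj h1
  subst h2
  have h3 : an = an' := by
    refine Term.annotate_injective (F := fun A => L.FactorsAt ⟨_, a⟩ (G.sort A)) (G.rhs r) an an' ?_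
    have h4 : (⟨G.sort (G.lhs r), (G.rhs r).annotate an⟩ :
        Σ s, Term Γ (fun B : NT G L a => G.sort B.1) s) =
        ⟨G.sort (G.lhs r), (G.rhs r).annotate an'⟩ :=
      congrArg (fun q : Σ A : NT G L a,
        Term Γ (fun B : NT G L a => G.sort B.1) (G.sort A.1) =>
          (⟨G.sort q.1.1, q.2⟩ : Σ s, Term Γ (fun B : NT G L a => G.sort B.1) s)) heq
    exact eq_of_heq (Sigma.mk.inj h4).2
  subst h3
  rfl

theorem finite_NT (hL : L.FinitelyDecomposable) : Finite (NT G L a) := by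
  have := fun s => hL.finite_at ⟨_, a⟩ s
  infer_instance

theorem finite_rule (hL : L.FinitelyDecomposable) : Finite (Rule G L a) := by
  have := fun s => hL.finite_at ⟨_, a⟩ s
  refine Finite.of_injective (β := Σ r : G.R, ∀ o : (G.rhs r).Occ,
    L.FactorsAt ⟨_, a⟩ (G.sort (G.child r o))) (fun p => ⟨p.r, p.an⟩) ?_
  rintro ⟨r, an, h⟩ ⟨r', an', h'⟩ heq
  obtain ⟨rfl, h⟩ := Sigma.mk.inj heq
  cases h
  rfl

variable (G L a)

/-- The sets of rules, with union as addition and as infinitary sum. -/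
def sumOp : SumOp.{u, u} (Set (Rule G L a)) where
  zero := ∅
  add := fun V W => V ∪ W
  isum f := ⋃ i, f i
  isum_empty f := Set.iUnion_of_empty f
  isum_single f j hj := by
    ext t
    simp only [Set.mem_iUnion]
    exact ⟨fun ⟨i, h⟩ => hj i ▸ h, fun h => ⟨j, h⟩⟩
  isum_pair f j j' hne hj := by
    ext t
    simp only [Set.mem_iUnion, Set.mem_union]
    constructor
    · rintro ⟨i, h⟩
      rcases hj i with rfl | rfl
      · exact Or.inl h
      · exact Or.inr h
    · rintro (h | h)
      · exact ⟨_, h⟩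
      · exact ⟨_, h⟩
  isum_partition p f := by
    ext t
    simp only [Set.mem_iUnion]
    exact ⟨fun ⟨i, h⟩ => ⟨p i, ⟨i, rfl⟩, h⟩, fun ⟨_, i, h⟩ => ⟨i.1, h⟩⟩

open Classical in
/-- The operation of the rule `r`: if one of the arguments is `∅`, then its value is `∅`; otherwise
it adds to the rules in the arguments all rules that come from `r` and whose nonterminals on the
right-hand side are left-hand sides of rules in the respective arguments. -/
def ruleOp (r : G.R) (V : Fin (G.rank r) → Set (Rule G L a)) : Set (Rule G L a) :=
  if ∃ i, V i = ∅ then ∅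
  else (⋃ i, V i) ∪ {p | ∃ an mem, p = ⟨r, an, mem⟩ ∧
    ∀ i : Fin (G.rank r),
      (⟨G.child r ((G.rhs r).occEquiv i), an ((G.rhs r).occEquiv i)⟩ : NT G L a)
        ∈ Rule.lhs '' V i}

/-- The intersection M-monoid of `(G, L)` and `a`. -/
def mmonoid : CompleteMMonoid.{u, u, u} :=
  .ofOps (sumOp G L a).toAddCommMonoid (sumOp G L a).toInfSum (Ω := G.R) G.rank
    (ruleOp G L a)

/-- The language model `(G, L)` where the weight of each rule `r` is the operation of `r`. -/
def lm : WRTGLM L (mmonoid G L a) where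
  G := G
  wt := fun r => Sum.inl r
  ar_wt := fun _ => rfl

variable {L a}

/-- The grammar with initial nonterminal `[A₀, a]` and with the rules in `V`. -/
def grammar (hL : L.FinitelyDecomposable) (V : Set (Rule G L a)) : RTG Γ where
  N := NT G L a
  finN := finite_NT hL
  sort := fun B => G.sort B.1
  start := ⟨G.start, a, .refl⟩
  R := V
  finR := by
    have := finite_rule (G := G) (a := a) hL
    infer_instance
  lhs := fun p => p.1.lhs
  rhs := fun p => p.1.rhs
  inj := fun _ _ h => Subtype.ext (Rule.inj h)

end Intersection

/-- `G'` is the `ψ`-intersection of `G` and `a`, where `ψ` maps the nonterminals of `G'` to those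
of `G`: `ψ` extends to rules, the language of `G'` is the part `{a}` of the language of `G`, and
the relabeling of syntax trees that `ψ` induces is a bijection between the syntax trees of `G'`
and the syntax trees of `G` that evaluate to `a`. -/
def IsIntersection {S : Type u} {Γ : Signature S} (L : SortedAlgebra.{u, v} Γ) (G : RTG Γ)
    (a : L.carrier (G.sort G.start)) (G' : RTG Γ) (ψ : G'.N → G.N) : Prop :=
  ψ G'.start = G.start ∧
  ∃ (hs : ∀ B, G.sort (ψ B) = G'.sort B) (ψR : G'.R → G.R)
    (hrk : ∀ p, G.rank (ψR p) = G'.rank p),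
    (∀ p, G.lhs (ψR p) = ψ (G'.lhs p) ∧
      HEq (G.rhs (ψR p))
        ((G'.rhs p).relabel (sortY := G.sort) (fun o => ψ (G'.child p o)) fun _ => hs _)) ∧
    G'.language L = G.language L ∩ {⟨_, a⟩} ∧
    Set.BijOn (RTree.map ψR hrk) G'.ast (G.astOf L a)

/-! ### Yield algebras and algebraic dynamic programming -/

/-- The yield algebra over a sorted set of symbols: words over the nullary symbols. -/
def yieldAlg {S : Type u} (Γ : Signature S) : SortedAlgebra.{u, u} Γ where
  carrier := fun _ => List {σ : Γ.Op // Γ.ar σ = 0}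
  interp := fun σ x => open Classical in
    if h : Γ.ar σ = 0 then [⟨σ, h⟩] else (List.ofFn x).flatten

namespace ADP

/-- The sorts: answers and input. -/
inductive Srt : Type u
  | answer
  | input

/-- The symbols of sort `answer` are not nullary, and those of sort `input` are nullary. -/
def IsADPSignature (Γ : Signature Srt.{u}) : Prop :=
  ∀ σ, (Γ.cod σ = .answer → Γ.ar σ ≠ 0) ∧ (Γ.cod σ = .input → Γ.ar σ = 0)

variable {Γ : Signature Srt.{u}} (K : SortedAlgebra.{u, v} Γ)

/-- An objective function for `K`. -/
structure ObjectiveFunction where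
  h : ∀ s, Set (K.carrier s) → Set (K.carrier s)
  h_input : ∀ F, h .input F = F
  h_subset : ∀ F, h .answer F ⊆ F
  h_nonempty : ∀ F, F.Nonempty → (h .answer F).Nonempty
  h_iUnion : ∀ {I : Type} [Countable I] (F : I → Set (K.carrier .answer)), (⋃ i, F i).Nonempty →
    h .answer (⋃ i, F i) = h .answer (⋃ i, h .answer (F i))

variable {K}

/-- The image of sets of arguments under an operation of `K`. -/
def imageOp (σ : Γ.Op) (F : ∀ i, Set (K.carrier (Γ.dom σ i))) : Set (K.carrier (Γ.cod σ)) :=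
  {y | ∃ x : ∀ i, K.carrier (Γ.dom σ i), (∀ i, x i ∈ F i) ∧ y = K.interp σ x}

namespace ObjectiveFunction

variable (h : ObjectiveFunction K)

/-- Bellman's principle of optimality. -/
def Bellman : Prop :=
  ∀ σ : Γ.Op, Γ.cod σ = .answer → Γ.ar σ ≠ 0 → ∀ F : ∀ i, Set (K.carrier (Γ.dom σ i)),
    h.h (Γ.cod σ) (imageOp σ F) = h.h (Γ.cod σ) (imageOp σ fun i => h.h _ (F i))

/-- The objective function, applied to the elements of each sort of a set. -/
def onObj (T : Set K.Obj) : Set K.Obj := {y | y.2 ∈ h.h y.1 {x | (⟨y.1, x⟩ : K.Obj) ∈ T}}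

theorem subset (s : Srt) (F : Set (K.carrier s)) : h.h s F ⊆ F := by
  cases s
  · exact h.h_subset F
  · exact (h.h_input F).subset

theorem nonempty (s : Srt) (F : Set (K.carrier s)) (hF : F.Nonempty) : (h.h s F).Nonempty := by
  cases s
  · exact h.h_nonempty F hF
  · rwa [h.h_input]

theorem empty (s : Srt) : h.h s ∅ = ∅ := Set.subset_empty_iff.1 (h.subset s ∅)

theorem iUnion {I : Type w} [Countable I] (s : Srt) (F : I → Set (K.carrier s)) :
    h.h s (⋃ i, F i) = h.h s (⋃ i, h.h s (F i)) := by
  cases s with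
  | input => simp only [h.h_input]
  | answer =>
    rcases (⋃ i, F i).eq_empty_or_nonempty with he | hne
    · rw [he, Set.subset_empty_iff.1 ((Set.iUnion_mono fun i => h.h_subset (F i)).trans he.subset)]
    · obtain ⟨i, -⟩ := Set.nonempty_iUnion.1 hne
      have : Nonempty I := ⟨i⟩
      obtain ⟨g, hg⟩ := exists_surjective_nat I
      rw [← hg.iUnion_comp, ← hg.iUnion_comp (fun i => h.h .answer (F i))]
      rcases (⋃ n, F (g n)).eq_empty_or_nonempty with he | hne
      · rw [he, Set.subset_empty_iff.1
          ((Set.iUnion_mono fun n => h.h_subset (F (g n))).trans he.subset)]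
      · exact h.h_iUnion (fun n => F (g n)) hne

theorem onObj_subset (T : Set K.Obj) : h.onObj T ⊆ T := fun _ hy => h.subset _ _ hy

theorem onObj_empty : h.onObj ∅ = ∅ := Set.subset_empty_iff.1 (h.onObj_subset ∅)

theorem onObj_nonempty {T : Set K.Obj} {y : K.Obj} (hy : y ∈ T) :
    ∃ z ∈ h.onObj T, z.1 = y.1 := by
  obtain ⟨x, hx⟩ := h.nonempty y.1 {x | (⟨y.1, x⟩ : K.Obj) ∈ T} ⟨y.2, hy⟩
  exact ⟨⟨y.1, x⟩, hx, rfl⟩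

theorem onObj_iUnion {I : Type w} [Countable I] (T : I → Set K.Obj) :
    h.onObj (⋃ i, T i) = h.onObj (⋃ i, h.onObj (T i)) := by
  ext ⟨s, x⟩
  change x ∈ h.h s {x | (⟨s, x⟩ : K.Obj) ∈ ⋃ i, T i} ↔
    x ∈ h.h s {x | (⟨s, x⟩ : K.Obj) ∈ ⋃ i, h.onObj (T i)}
  have h1 : {x | (⟨s, x⟩ : K.Obj) ∈ ⋃ i, T i} = ⋃ i, {x | (⟨s, x⟩ : K.Obj) ∈ T i} := by
    ext x
    simp
  have h2 : {x | (⟨s, x⟩ : K.Obj) ∈ ⋃ i, h.onObj (T i)} =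
      ⋃ i, h.h s {x | (⟨s, x⟩ : K.Obj) ∈ T i} := by
    ext x
    simp [onObj]
  rw [h1, h2, h.iUnion]

theorem onObj_idem (T : Set K.Obj) : h.onObj (h.onObj T) = h.onObj T := by
  have := h.onObj_iUnion (I := Unit) fun _ => T
  simpa only [Set.iUnion_const] using this.symm

end ObjectiveFunction

/-- All elements have the same sort. -/
def Homogeneous (T : Set K.Obj) : Prop := ∃ s, ∀ y ∈ T, y.1 = s

variable (h : ObjectiveFunction K)

/-- The carrier set of the ADP M-monoid: the sets `h_s(F)`, where `F` is a set of elements of the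
same sort `s`, and a new element `⊥` (`none`). -/
def Carrier : Type (max u v) :=
  {x : Option (Set K.Obj) // ∀ T, x = some T → ∃ F, Homogeneous F ∧ T = h.onObj F}

variable {h}

namespace Carrier

/-- The element `⊥`. -/
def bot : Carrier h := ⟨none, fun _ hT => by cases hT⟩

/-- The element `h_s(F)`. -/
def mk (F : Set K.Obj) (hF : Homogeneous F) : Carrier h :=
  ⟨some (h.onObj F), fun _ hT => ⟨F, hF, (Option.some.inj hT).symm⟩⟩

/-- The members of a set (`⊥` has no members). -/
def elems (x : Carrier h) : Set K.Obj := x.1.getD ∅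

theorem homogeneous_empty : Homogeneous (∅ : Set K.Obj) :=
  ⟨.answer, fun _ hy => absurd hy (Set.notMem_empty _)⟩

theorem elems_mk (F : Set K.Obj) (hF : Homogeneous F) : (mk (h := h) F hF).elems = h.onObj F := rfl

theorem mk_ne_bot (F : Set K.Obj) (hF : Homogeneous F) : mk (h := h) F hF ≠ bot := fun he => by
  have := congrArg Subtype.val he
  simp [mk, bot] at this

theorem eq_bot_or (x : Carrier h) : x = bot ∨ ∃ F hF, x = mk F hF := by
  obtain ⟨_ | T, hx⟩ := x
  · exact Or.inl rfl
  · obtain ⟨F, hF, hT⟩ := hx T rfl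
    exact Or.inr ⟨F, hF, Subtype.ext (congrArg some hT)⟩

theorem homogeneous_elems (x : Carrier h) : Homogeneous x.elems := by
  rcases x.eq_bot_or with rfl | ⟨F, ⟨s, hs⟩, rfl⟩
  · exact homogeneous_empty
  · exact ⟨s, fun y hy => hs y (h.onObj_subset F hy)⟩

theorem mk_elems (x : Carrier h) (hx : x ≠ bot) : mk x.elems x.homogeneous_elems = x := by
  rcases x.eq_bot_or with rfl | ⟨F, hF, rfl⟩
  · exact absurd rfl hx
  · exact Subtype.ext (congrArg some (h.onObj_idem F))

theorem mk_congr {F F' : Set K.Obj} {hF : Homogeneous F} {hF' : Homogeneous F'}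
    (he : h.onObj F = h.onObj F') : mk (h := h) F hF = mk F' hF' :=
  Subtype.ext (congrArg some he)

open Classical in
/-- The infinitary sum: `h_s` of the union if all members of the family are sets of elements of
the same sort `s`, and `⊥` otherwise. -/
def isum {I : Type w} (f : I → Carrier h) : Carrier h :=
  if H : (∀ i, f i ≠ bot) ∧ Homogeneous (⋃ i, (f i).elems) then mk _ H.2 else bot

open Classical in
/-- The addition. -/
def add (x y : Carrier h) : Carrier h :=
  if H : (x ≠ bot ∧ y ≠ bot) ∧ Homogeneous (x.elems ∪ y.elems) then mk _ H.2 else bot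

theorem isum_ne_bot {I : Type w} {f : I → Carrier h} :
    isum f ≠ bot ↔ (∀ i, f i ≠ bot) ∧ Homogeneous (⋃ i, (f i).elems) := by
  unfold isum
  split_ifs with H
  · exact ⟨fun _ => H, fun _ => mk_ne_bot _ _⟩
  · exact ⟨fun hn => absurd rfl hn, fun H' => absurd H' H⟩

theorem isum_eq {I : Type w} {f : I → Carrier h}
    (H : (∀ i, f i ≠ bot) ∧ Homogeneous (⋃ i, (f i).elems)) : isum f = mk _ H.2 := dif_pos H

theorem isum_partition {I J : Type u} [Countable I] [Countable J] (p : I → J)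
    (f : I → Carrier h) :
    isum f = isum fun j : J => isum fun i : {i // p i = j} => f i := by
  have hU : ⋃ i, (f i).elems = ⋃ j, ⋃ i : {i // p i = j}, (f i).elems := by
    ext t
    simp only [Set.mem_iUnion]
    exact ⟨fun ⟨i, hi⟩ => ⟨p i, ⟨i, rfl⟩, hi⟩, fun ⟨_, i, hi⟩ => ⟨i.1, hi⟩⟩
  by_cases H : (∀ i, f i ≠ bot) ∧ Homogeneous (⋃ i, (f i).elems)
  · have h1 : ∀ j, (∀ i : {i // p i = j}, f i ≠ bot) ∧
        Homogeneous (⋃ i : {i // p i = j}, (f i).elems) := by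
      refine fun j => ⟨fun i => H.1 i, ?_⟩
      obtain ⟨s, hs⟩ := H.2
      refine ⟨s, fun y hy => hs y ?_⟩
      rw [hU]
      exact Set.mem_iUnion.2 ⟨j, hy⟩
    have h2 : ∀ j, (isum fun i : {i // p i = j} => f i).elems =
        h.onObj (⋃ i : {i // p i = j}, (f i).elems) := by
      intro j
      rw [isum_eq (h1 j), elems_mk]
    have h3 : (∀ j, (isum fun i : {i // p i = j} => f i) ≠ bot) ∧
        Homogeneous (⋃ j, (isum fun i : {i // p i = j} => f i).elems) := by
      refine ⟨fun j => isum_ne_bot.2 (h1 j), ?_⟩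
      obtain ⟨s, hs⟩ := H.2
      refine ⟨s, fun y hy => hs y ?_⟩
      obtain ⟨j, hj⟩ := Set.mem_iUnion.1 hy
      rw [h2 j] at hj
      rw [hU]
      exact Set.mem_iUnion.2 ⟨j, h.onObj_subset _ hj⟩
    rw [isum_eq H, isum_eq h3]
    apply mk_congr
    simp only [h2]
    rw [hU, h.onObj_iUnion]
  · have hb : isum f = bot := dif_neg H
    rw [hb]
    by_contra hne
    have H2 := isum_ne_bot.1 (Ne.symm hne)
    apply H
    have h1 := fun j => isum_ne_bot.1 (H2.1 j)
    refine ⟨fun i => (h1 (p i)).1 ⟨i, rfl⟩, ?_⟩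
    obtain ⟨s, hs⟩ := H2.2
    refine ⟨s, fun y hy => ?_⟩
    rw [hU] at hy
    obtain ⟨j, hj⟩ := Set.mem_iUnion.1 hy
    obtain ⟨z, hz, hzy⟩ := h.onObj_nonempty hj
    rw [← hzy]
    refine hs z (Set.mem_iUnion.2 ⟨j, ?_⟩)
    rw [isum_eq (h1 j), elems_mk]
    exact hz

theorem isum_single {I : Type u} (f : I → Carrier h) (j : I) (hj : ∀ i, i = j) :
    isum f = f j := by
  have hU : ⋃ i, (f i).elems = (f j).elems := by
    ext t
    simp only [Set.mem_iUnion]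
    exact ⟨fun ⟨i, hi⟩ => hj i ▸ hi, fun hi => ⟨j, hi⟩⟩
  by_cases hb : f j = bot
  · rw [hb]
    exact dif_neg fun H => H.1 j hb
  · have H : (∀ i, f i ≠ bot) ∧ Homogeneous (⋃ i, (f i).elems) :=
      ⟨fun i => hj i ▸ hb, hU ▸ (f j).homogeneous_elems⟩
    rw [isum_eq H]
    exact (mk_congr (congrArg _ hU)).trans (mk_elems _ hb)

theorem isum_pair {I : Type u} (f : I → Carrier h) (j j' : I) (hj : ∀ i, i = j ∨ i = j') :
    isum f = add (f j) (f j') := by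
  have hU : ⋃ i, (f i).elems = (f j).elems ∪ (f j').elems := by
    ext t
    simp only [Set.mem_iUnion, Set.mem_union]
    constructor
    · rintro ⟨i, hi⟩
      rcases hj i with rfl | rfl
      · exact Or.inl hi
      · exact Or.inr hi
    · rintro (hi | hi)
      · exact ⟨_, hi⟩
      · exact ⟨_, hi⟩
  have hN : (∀ i, f i ≠ bot) ↔ f j ≠ bot ∧ f j' ≠ bot := by
    refine ⟨fun H => ⟨H j, H j'⟩, fun H i => ?_⟩
    rcases hj i with rfl | rfl
    · exact H.1
    · exact H.2
  by_cases H : (∀ i, f i ≠ bot) ∧ Homogeneous (⋃ i, (f i).elems)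
  · rw [isum_eq H]
    have H' : (f j ≠ bot ∧ f j' ≠ bot) ∧ Homogeneous ((f j).elems ∪ (f j').elems) :=
      ⟨hN.1 H.1, hU ▸ H.2⟩
    rw [add, dif_pos H']
    exact mk_congr (congrArg _ hU)
  · have H' : ¬((f j ≠ bot ∧ f j' ≠ bot) ∧ Homogeneous ((f j).elems ∪ (f j').elems)) :=
      fun H' => H ⟨hN.2 H'.1, hU ▸ H'.2⟩
    rw [isum, add, dif_neg H, dif_neg H']

def sumOp (h : ObjectiveFunction K) : SumOp.{u, max u v} (Carrier h) where
  zero := mk ∅ homogeneous_empty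
  add := add
  isum := isum
  isum_empty f := by
    have hU : ⋃ i, (f i).elems = ∅ := Set.iUnion_of_empty _
    rw [isum_eq ⟨fun i => isEmptyElim i, hU ▸ homogeneous_empty⟩]
    exact mk_congr (congrArg _ hU)
  isum_single f j hj := isum_single f j hj
  isum_pair f j j' _ hj := isum_pair f j j' hj
  isum_partition p f := isum_partition p f

end Carrier

/-- A term with variables `x₁, …, x_k` of given sorts in which no variable occurs twice. -/
structure TermOp (Γ : Signature Srt.{u}) where
  k : ℕ
  srt : Fin k → Srt.{u}
  cod : Srt.{u}
  t : Term Γ (fun i : ULift.{u} (Fin k) => srt i.down) cod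
  linear : t.Linear

/-- The values of the term at the tuples of members of the arguments. -/
def TermOp.image (t : TermOp Γ) (F : Fin t.k → Set K.Obj) : Set K.Obj :=
  {y | ∃ x : ∀ i, K.carrier (t.srt i), (∀ i, (⟨t.srt i, x i⟩ : K.Obj) ∈ F i) ∧
    y = ⟨t.cod, t.t.eval K fun o => x (t.t.label o).down⟩}

theorem TermOp.homogeneous_image (t : TermOp Γ) (F : Fin t.k → Set K.Obj) :
    Homogeneous (t.image F) := ⟨t.cod, by rintro y ⟨x, -, rfl⟩; rfl⟩

open Classical in
/-- The operation of a term: `∅` if one of the arguments is `∅`; otherwise the set of optimal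
values of the term at tuples of members of the arguments if the arguments are sets of elements of
the appropriate sorts, and otherwise `⊥`. -/
def termOp (t : TermOp Γ) (F : Fin t.k → Carrier h) : Carrier h :=
  if ∃ i, F i = Carrier.mk ∅ Carrier.homogeneous_empty then
    Carrier.mk ∅ Carrier.homogeneous_empty
  else if ∀ i, F i ≠ Carrier.bot ∧ ∀ y ∈ (F i).elems, y.1 = t.srt i then
    Carrier.mk (t.image fun i => (F i).elems) (t.homogeneous_image _)
  else Carrier.bot

variable (h)

/-- The ADP M-monoid over `K` and `h`. -/
def mmonoid : CompleteMMonoid.{u, max u v, u} :=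
  .ofOps (Carrier.sumOp h).toAddCommMonoid (Carrier.sumOp h).toInfSum (Ω := TermOp Γ)
    TermOp.k termOp

/-- The term that is obtained from the right-hand side of a rule by replacing the occurrence
number `i` of a nonterminal by `x_i`. -/
def ruleTerm (G : RTG Γ) (r : G.R) : TermOp Γ where
  k := G.rank r
  srt := fun i => G.sort (G.child r ((G.rhs r).occEquiv i))
  cod := G.sort (G.lhs r)
  t := (G.rhs r).relabel (fun o => ULift.up ((G.rhs r).occEquiv.symm o)) fun o => by
    rw [Equiv.apply_symm_apply]
  linear := Term.linear_relabel _ _ _ fun o o' ho =>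
    ((G.rhs r).occEquiv.symm.injective (ULift.up.inj ho))

/-- The yield grammar `G`, where the weight of each rule is the operation of its right-hand
side. -/
def lm (G : RTG Γ) : WRTGLM (yieldAlg Γ) (mmonoid h) where
  G := G
  wt := fun r => Sum.inl (ruleTerm G r)
  ar_wt := fun _ => rfl

/-- The solution of the ADP problem for the input `w`: the optimal values of the trees in the
tree language of `G` whose yield is `w`. -/
def adp (G : RTG Γ) (w : List {σ : Γ.Op // Γ.ar σ = 0}) : Set (K.carrier (G.sort G.start)) :=
  h.h _ {y | ∃ t ∈ G.treeLanguage, (yieldAlg Γ).evalGround t = w ∧ y = K.evalGround t}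

end ADP

end MMP

end

/-!
The values that the algorithm computes are described by one invariant
(`WRTGLM.represents_values`): after `n` rounds, in whatever order the items have been visited, the
value of each item is the sum of the weights of a finite set of trees with that item at the root,
and this set contains all trees of height at most `n`.  The invariant needs only that the weight
operations are additive in each argument and have the value `0` if an argument is `0`, on some
submonoid that contains the weights (`AdditiveOn`).

Hence the algorithm terminates with the sum over all trees as soon as there is a height `N` such
that a sum over trees depends only on those of height at most `N`
(`WRTGLM.computes_of_sum_eq`).  Forgetting the items turns the trees of the deduction system
`cnc` whose root is the goal item bijectively, and with the same weights, into the syntax trees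
of the input (`WRTGLM.goalEquiv`), so that this sum is the value of the parsing problem.
Together these facts give the criterion `WRTGLM.parserOutputs_of_isum_eq`, which is verified
separately for each class of weight algebras.

* If the deduction system is acyclic, then the height of all trees is bounded by the number of
  rules.  This is the case for nonlooping language models: two occurrences of an instance of a
  rule on a path would give a subtree with the same root rule and the same value
  (`WRTGLM.acyclic_cnc`).  The operations of semirings and of ADP M-monoids are additive; for
  the latter, Bellman's principle is extended from symbols to terms, and linearity of the terms
  ensures that the values of the variables can be chosen independently (`ADP.termOp_add`).
* In the ordered cases, a tree of great height has a rule that occurs often on a path, by the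
  pigeonhole principle (`RTG.Deriv.exists_context_of_not_heightLE`).  Cutting out the part between
  two occurrences does not make the weight worse.  For superior M-monoids, this shows that the
  infimum is determined by the trees of bounded height.  For the best derivation M-monoid, the cut
  increases the probability strictly, so that tall trees do not contribute derivations.  For the
  `n`-best M-monoid, `n` different cuts give `n` trees that displace the tall tree.
* An intersection M-monoid consists of the subsets of a finite set, so that each union is
  exhausted by the trees up to some height.  The weight of a syntax tree in it contains rules
  from which the tree can be rebuilt (`Intersection.exists_mapTree_eq`); conversely, the second
  component of a nonterminal of the intersection grammar is the value of each of its trees, and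
  hence is redundant (`Intersection.toTree_eq_of_mapTree_eq`).
-/

namespace MMP

/-! ### Infinitary sums -/

namespace InfSum

variable {K : Type v} [AddCommMonoid K] [InfSum.{u, v} K]

theorem isum_equiv {I J : Type u} [Countable I] [Countable J] (e : I ≃ J) (f : J → K) :
    isum (fun i => f (e i)) = isum f := by
  rw [isum_partition e fun i => f (e i)]
  congr 1
  funext j
  exact (isum_single (fun i : {i // e i = j} => f (e i)) ⟨e.symm j, by simp⟩
    (by rintro ⟨i, rfl⟩; simp)).trans (by simp)

theorem isum_option {I : Type u} [Countable I] (f : Option I → K) :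
    isum f = f none + isum fun i => f (some i) := by
  let p : Option I → ULift.{u} Bool := fun i => ⟨i.isSome⟩
  rw [isum_partition p f,
    isum_pair _ (⟨false⟩ : ULift.{u} Bool) ⟨true⟩ (by simp) (by rintro ⟨_ | _⟩ <;> simp)]
  congr 1
  · exact isum_single (fun i : {i // p i = ⟨false⟩} => f i) ⟨none, rfl⟩
      (by rintro ⟨_ | i, hi⟩ <;> simp [p] at hi ⊢)
  · let e : I ≃ {i // p i = ⟨true⟩} :=
      { toFun := fun i => ⟨some i, rfl⟩
        invFun := fun i => i.1.get (congrArg ULift.down i.2)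
        left_inv := fun i => rfl
        right_inv := fun i => by simp }
    exact (isum_equiv e fun i => f i).symm

theorem isum_eq_sum {I : Type u} [Fintype I] (f : I → K) : isum f = ∑ i, f i := by
  revert f
  refine Fintype.induction_empty_option (P := fun I _ => ∀ f : I → K, isum f = ∑ i, f i)
    ?_ ?_ ?_ I
  · intro α β _ e ih f
    have := Fintype.ofEquiv β e.symm
    rw [← isum_equiv e, ← e.sum_comp f]
    convert ih _
  · intro f
    rw [isum_empty]
    simp
  · intro α _ ih f
    rw [isum_option, ih, Fintype.sum_option]

theorem isum_finset {I : Type u} [Countable I] (s : Finset I) (f : I → K) :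
    (isum fun i : {i // i ∈ s} => f i) = ∑ i ∈ s, f i := by
  rw [isum_eq_sum, Finset.univ_eq_attach, Finset.sum_attach]

end InfSum

/-! ### Syntax trees -/

namespace RTG.Deriv

variable {S : Type u} {Γ : Signature S} {G : RTG Γ}

theorem lhs_root {A : G.N} (d : G.Deriv A) : G.lhs d.root = A := by
  cases d
  rfl

/-- The number of nodes on each path is at most `n`. -/
def HeightLE : {A : G.N} → G.Deriv A → ℕ → Prop
  | _, node _ ds, n => ∃ m, n = m + 1 ∧ ∀ o, (ds o).HeightLE m

theorem not_heightLE_zero {A : G.N} (d : G.Deriv A) : ¬ d.HeightLE 0 := by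
  cases d
  rintro ⟨m, h, -⟩
  omega

theorem heightLE_node {r : G.R} {ds : ∀ o, G.Deriv (G.child r o)} {n : ℕ} :
    (node r ds).HeightLE (n + 1) ↔ ∀ o, (ds o).HeightLE n := by
  constructor
  · rintro ⟨m, h, h'⟩
    obtain rfl : n = m := by omega
    exact h'
  · exact fun h => ⟨n, rfl, h⟩

theorem HeightLE.succ {A : G.N} {d : G.Deriv A} {n : ℕ} (h : d.HeightLE n) :
    d.HeightLE (n + 1) := by
  induction d generalizing n with
  | node r ds ih =>
    obtain ⟨m, rfl, h⟩ := h
    exact ⟨m + 1, rfl, fun o => ih o (h o)⟩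

theorem HeightLE.mono {A : G.N} {d : G.Deriv A} {n m : ℕ} (h : d.HeightLE n) (hnm : n ≤ m) :
    d.HeightLE m := by
  induction hnm with
  | refl => exact h
  | step _ ih => exact ih.succ

theorem exists_heightLE {A : G.N} (d : G.Deriv A) : ∃ n, d.HeightLE n := by
  induction d with
  | node r ds ih =>
    choose n hn using ih
    obtain ⟨m, hm⟩ := Finite.bddAbove_range n
    exact ⟨m + 1, m, rfl, fun o => (hn o).mono (hm ⟨o, rfl⟩)⟩

/-- The number of nodes. -/
def size : {A : G.N} → G.Deriv A → ℕ
  | _, node r ds => 1 + ∑ i : Fin (G.rhs r).count, (ds ((G.rhs r).occEquiv i)).size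

theorem size_child_lt {r : G.R} (ds : ∀ o, G.Deriv (G.child r o)) (o : (G.rhs r).Occ) :
    (ds o).size < (node r ds).size := by
  have h := Finset.single_le_sum (f := fun i => (ds ((G.rhs r).occEquiv i)).size)
    (fun _ _ => Nat.zero_le _) (Finset.mem_univ ((G.rhs r).occEquiv.symm o))
  rw [Equiv.apply_symm_apply] at h
  simp only [size]
  omega

theorem IsProperSubtree.size_lt {x y : Σ A, G.Deriv A} (h : IsProperSubtree x y) :
    x.2.size < y.2.size := by
  induction h with
  | single h =>
    obtain ⟨r, ds, o, rfl, rfl⟩ := h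
    exact size_child_lt ds o
  | tail _ h ih =>
    obtain ⟨r, ds, o, rfl, rfl⟩ := h
    exact ih.trans (size_child_lt ds o)

open Classical in
/-- The mappings that plug a tree into a fixed position of a fixed tree. -/
inductive IsContext : {B A : G.N} → (G.Deriv B → G.Deriv A) → Prop
  | id {A : G.N} : IsContext fun x : G.Deriv A => x
  | node {B : G.N} (r : G.R) (ds : ∀ o, G.Deriv (G.child r o)) (o : (G.rhs r).Occ)
      (C : G.Deriv B → G.Deriv (G.child r o)) (hC : IsContext C) :
      IsContext fun x => node r (Function.update ds o (C x))

namespace IsContext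

variable {A B : G.N} {C : G.Deriv B → G.Deriv A}

theorem injective (hC : IsContext C) : Function.Injective C := by
  induction hC with
  | id => exact fun _ _ h => h
  | node r ds o C _ ih =>
    intro x y h
    have h1 := congrFun (node.inj h) o
    simp only [Function.update_self] at h1
    exact ih h1

open Classical in
theorem size_lt (hC : IsContext C) {x y : G.Deriv B} (h : x.size < y.size) :
    (C x).size < (C y).size := by
  induction hC with
  | id => exact h
  | node r ds o C _ ih =>
    have key : ∀ o', (Function.update ds o (C x) o').size ≤
        (Function.update ds o (C y) o').size := by
      intro o'
      rcases eq_or_ne o' o with rfl | ho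
      · simpa using ih.le
      · simp [ho]
    simp only [size]
    refine Nat.add_lt_add_left (Finset.sum_lt_sum (fun i _ => key _)
      ⟨(G.rhs r).occEquiv.symm o, Finset.mem_univ _, ?_⟩) 1
    rw [Equiv.apply_symm_apply]
    simpa using ih

open Classical in
theorem subtree (hC : IsContext C) (x : G.Deriv B) :
    Relation.ReflTransGen IsChild ⟨B, x⟩ ⟨A, C x⟩ := by
  induction hC with
  | id => exact .refl
  | node r ds o C _ ih =>
    exact ih.tail ⟨r, _, o, rfl, by rw [Function.update_self]⟩

end IsContext

/-- Pigeonhole principle on a longest path: if the height of `d` exceeds `∑ r, c r`, then some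
rule `r` occurs more than `c r` times on a path of `d`.  The topmost of these occurrences is the
root of `e`, and the next `c r` ones are the roots of the members of `s`. -/
theorem exists_context_of_not_heightLE [Fintype G.R] {A : G.N} (d : G.Deriv A) (c : G.R → ℕ)
    (hd : ¬ d.HeightLE (∑ r, c r)) :
    ∃ (r : G.R) (e : G.Deriv (G.lhs r)) (s : Finset (G.Deriv (G.lhs r)))
      (C : G.Deriv (G.lhs r) → G.Deriv A), IsContext C ∧ C e = d ∧ s.card = c r ∧ e.root = r ∧
      ∀ x ∈ s, x.root = r ∧ IsProperSubtree ⟨_, x⟩ ⟨_, e⟩ := by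
  classical
  induction d generalizing c with
  | node r ds ih =>
    rcases Nat.eq_zero_or_pos (c r) with h0 | hpos
    · exact ⟨r, node r ds, ∅, _, .id, rfl, by simp [h0], rfl, by simp⟩
    · have hsum : ∑ r', c r' = (∑ r', Function.update c r (c r - 1) r') + 1 := by
        have h1 := Finset.sum_update_of_mem (Finset.mem_univ r) c (c r - 1)
        have h2 := Finset.sum_update_of_mem (Finset.mem_univ r) c (c r)
        rw [Function.update_eq_self] at h2
        omega
      rw [hsum, heightLE_node] at hd
      push Not at hd
      obtain ⟨o, ho⟩ := hd
      obtain ⟨r', e, s, C, hC, hCe, hs, he, hse⟩ := ih o _ ho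
      rcases eq_or_ne r' r with rfl | hr
      · have hsub : IsProperSubtree ⟨_, e⟩ ⟨_, node r' ds⟩ := by
          have h1 := hC.subtree e
          rw [hCe] at h1
          exact Relation.TransGen.tail' h1 ⟨r', ds, o, rfl, rfl⟩
        refine ⟨r', node r' ds, insert e s, _, .id, rfl, ?_, rfl, ?_⟩
        · rw [Finset.card_insert_of_notMem fun h => lt_irrefl _ (hse e h).2.size_lt, hs,
            Function.update_self]
          omega
        · intro x hx
          rcases Finset.mem_insert.1 hx with rfl | hx
          · exact ⟨he, hsub⟩
          · exact ⟨(hse x hx).1, (hse x hx).2.trans hsub⟩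
      · refine ⟨r', e, s, _, .node r ds o C hC, ?_, ?_, he, hse⟩
        · rw [hCe, Function.update_eq_self]
        · rw [hs, Function.update_of_ne hr]

/-- A tree is a rule together with a tree for each occurrence in its right-hand side. -/
def equivSigma (A : G.N) :
    G.Deriv A ≃ Σ r : {r // G.lhs r = A}, ∀ o, G.Deriv (G.child r.1 o) where
  toFun := fun | node r ds => ⟨(⟨r, rfl⟩ : {r' // G.lhs r' = G.lhs r}), ds⟩
  invFun := fun x => x.1.2 ▸ node x.1.1 x.2
  left_inv := by rintro ⟨r, ds⟩; rfl
  right_inv := by rintro ⟨⟨r, rfl⟩, ds⟩; rfl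

end RTG.Deriv

theorem RTG.Acyclic.heightLE {S : Type u} {Γ : Signature S} {G : RTG Γ} (hG : G.Acyclic)
    {A : G.N} (d : G.Deriv A) : d.HeightLE (Nat.card G.R) := by
  have := Fintype.ofFinite G.R
  by_contra hd
  obtain ⟨r, e, s, C, -, -, hs, he, hse⟩ := d.exists_context_of_not_heightLE (fun _ => 1)
    (by simpa using hd)
  obtain ⟨x, hx⟩ := Finset.card_pos.1 (hs ▸ Nat.one_pos)
  exact hG ⟨_, e⟩ ⟨_, x⟩ (hse x hx).2 (he.trans (hse x hx).1.symm)

/-! ### Multi-additive operations -/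

/-- The operation `f` preserves the submonoid `D`, and on `D` it is additive in each argument and
has the value `0` if one of the arguments is `0`. -/
structure AdditiveOn {K : Type v} [AddCommMonoid K] (D : AddSubmonoid K) {k : ℕ}
    (f : (Fin k → K) → K) : Prop where
  mem : ∀ x, (∀ i, x i ∈ D) → f x ∈ D
  add : ∀ (x : Fin k → K) (i : Fin k) (a b : K), (∀ i, x i ∈ D) → a ∈ D → b ∈ D →
    f (Function.update x i (a + b)) = f (Function.update x i a) + f (Function.update x i b)
  zero : ∀ (x : Fin k → K) (i : Fin k), (∀ i, x i ∈ D) → x i = 0 → f x = 0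

namespace AdditiveOn

variable {K : Type v} [AddCommMonoid K] {D : AddSubmonoid K} {k : ℕ} {f : (Fin k → K) → K}

theorem proj {k : ℕ} (hk : ∀ i j : Fin k, i = j) (i : Fin k) :
    AdditiveOn D fun x : Fin k → K => x i where
  mem x hx := hx i
  add x j a b _ _ _ := by simp [hk j i]
  zero x j _ hx := by rw [hk i j, hx]

/-- An operation that is additive on `D`, with its arguments indexed by `ι`, as a multilinear
mapping. -/
noncomputable def toMultilinearMap (hf : AdditiveOn D f) {ι : Type*}
    (e : Fin k ≃ ι) : MultilinearMap ℕ (fun _ : ι => D) D :=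
  have key : ∀ [DecidableEq ι] (x : ι → D) (o : ι) (a : D),
      (fun i => ((Function.update x o a (e i) : D) : K)) =
        Function.update (fun i => ((x (e i) : D) : K)) (e.symm o) a := by
    intro _ x o a
    funext i
    rcases eq_or_ne (e i) o with rfl | ho
    · simp
    · rw [Function.update_of_ne ho, Function.update_of_ne fun h => ho (by simp [h])]
  have zero : ∀ (x : ι → D) (o : ι), x o = 0 → f (fun i => (x (e i) : K)) = 0 := by
    intro x o hx
    exact hf.zero _ (e.symm o) (fun i => (x (e i)).2) (by simp [hx])
  have add : ∀ [DecidableEq ι] (x : ι → D) (o : ι) (a b : D),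
      f (fun i => ((Function.update x o (a + b) (e i) : D) : K)) =
        f (fun i => ((Function.update x o a (e i) : D) : K)) +
          f (fun i => ((Function.update x o b (e i) : D) : K)) := by
    intro _ x o a b
    rw [key, key, key]
    exact hf.add _ _ _ _ (fun i => (x (e i)).2) a.2 b.2
  { toFun := fun x => ⟨f fun i => x (e i), hf.mem _ fun i => (x (e i)).2⟩
    map_update_add' := by
      intro _ x o a b
      exact Subtype.ext (add x o a b)
    map_update_smul' := by
      intro _ x o n a
      apply Subtype.ext
      induction n with
      | zero =>
        rw [zero_smul, zero_smul]
        exact zero _ o (Function.update_self _ _ _)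
      | succ n ih =>
        rw [succ_nsmul, succ_nsmul]
        refine (add x o (n • a) a).trans ?_
        exact congrArg (· + f fun i => ((Function.update x o a (e i) : D) : K)) ih }

/-- The distributive law for finite sums in all arguments. -/
theorem map_sum (hf : AdditiveOn D f) {ι : Type*} [DecidableEq ι] [Fintype ι] (e : Fin k ≃ ι)
    {α : ι → Type*} (T : ∀ o, Finset (α o)) (g : ∀ o, α o → K) (hg : ∀ o d, g o d ∈ D) :
    f (fun i => ∑ d ∈ T (e i), g (e i) d) =
      ∑ ds ∈ Fintype.piFinset T, f fun i => g (e i) (ds (e i)) := by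
  have h := congrArg (Subtype.val : D → K)
    ((hf.toMultilinearMap e).map_sum_finset (fun o d => (⟨g o d, hg o d⟩ : D)) T)
  rw [AddSubmonoid.coe_finsetSum] at h
  refine Eq.trans ?_ h
  refine congrArg f (funext fun i => ?_)
  exact (AddSubmonoid.coe_finsetSum D (fun d => (⟨g (e i) d, hg _ d⟩ : D)) _).symm

end AdditiveOn

/-! ### The value computation algorithm -/

namespace WRTGLM

variable {S : Type u} {Γ : Signature S} {L : SortedAlgebra.{u, u} Γ}
  {M : CompleteMMonoid.{u, v, w}} {LM : WRTGLM L M}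

/-- The arguments of the weight operation of a rule correspond to the occurrences of nonterminals
in the right-hand side. -/
def argEquiv (LM : WRTGLM L M) (r : LM.G.R) : Fin (M.ar (LM.wt r)) ≃ (LM.G.rhs r).Occ :=
  (finCongr (LM.ar_wt r)).trans (LM.G.rhs r).occEquiv

theorem ruleOp_eq (r : LM.G.R) (x : (LM.G.rhs r).Occ → M.K) :
    LM.ruleOp r x = M.op (LM.wt r) fun i => x (LM.argEquiv r i) := rfl

theorem weight_node (r : LM.G.R) (ds : ∀ o, LM.G.Deriv (LM.G.child r o)) :
    LM.weight (.node r ds) = M.op (LM.wt r) fun i => LM.weight (ds (LM.argEquiv r i)) := by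
  rw [weight]
  rfl

variable {D : AddSubmonoid M.K}

theorem weight_mem (hD : ∀ r, AdditiveOn D (M.op (LM.wt r))) {A : LM.G.N} (d : LM.G.Deriv A) :
    LM.weight d ∈ D := by
  induction d with
  | node r ds ih =>
    rw [weight_node]
    exact (hD r).mem _ fun i => ih _

open Classical in
/-- The trees whose direct subtrees belong to the given sets. -/
noncomputable def extend (G : RTG Γ) [Fintype G.R] [∀ r, Fintype (G.rhs r).Occ]
    (T : ∀ A, Finset (G.Deriv A)) (A : G.N) : Finset (G.Deriv A) :=
  (Finset.univ.sigma fun r : {r // G.lhs r = A} =>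
    Fintype.piFinset fun o => T (G.child r.1 o)).map (RTG.Deriv.equivSigma A).symm.toEmbedding

theorem node_mem_extend {G : RTG Γ} [Fintype G.R] [∀ r, Fintype (G.rhs r).Occ]
    {T : ∀ A, Finset (G.Deriv A)} {r : G.R} {ds : ∀ o, G.Deriv (G.child r o)} :
    RTG.Deriv.node r ds ∈ extend G T (G.lhs r) ↔ ∀ o, ds o ∈ T _ := by
  have : RTG.Deriv.node r ds = (RTG.Deriv.equivSigma (G.lhs r)).symm ⟨⟨r, rfl⟩, ds⟩ := rfl
  rw [this]
  simp [extend]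

/-- If the current values are sums of weights of syntax trees, then so are the new values. -/
theorem newVal_eq_sum [Fintype LM.G.R] [∀ r, Fintype (LM.G.rhs r).Occ]
    (hD : ∀ r, AdditiveOn D (M.op (LM.wt r))) {V : LM.G.N → M.K}
    {T : ∀ A, Finset (LM.G.Deriv A)} (hV : ∀ A, V A = ∑ d ∈ T A, LM.weight d) (A : LM.G.N) :
    LM.newVal V A = ∑ d ∈ extend LM.G T A, LM.weight d := by
  classical
  rw [newVal, finsum_eq_sum_of_fintype, extend, Finset.sum_map, Finset.sum_sigma]
  refine Finset.sum_congr rfl ?_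
  rintro ⟨r, rfl⟩ -
  rw [ruleOp_eq]
  simp only [hV]
  rw [(hD r).map_sum (LM.argEquiv r) (fun o => T (LM.G.child r o)) (fun o d => LM.weight d)
    fun o d => weight_mem hD d]
  refine Finset.sum_congr rfl fun ds _ => ?_
  exact (weight_node r ds).symm

/-- The values are sums of weights of trees, among them all trees of height at most `n`. -/
def Represents (LM : WRTGLM L M) (n : ℕ) (V : LM.G.N → M.K) : Prop :=
  ∃ T : ∀ A, Finset (LM.G.Deriv A), (∀ A, V A = ∑ d ∈ T A, LM.weight d) ∧
    ∀ A (d : LM.G.Deriv A), d.HeightLE n → d ∈ T A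

theorem heightLE_mem_extend {G : RTG Γ} [Fintype G.R] [∀ r, Fintype (G.rhs r).Occ]
    {T : ∀ A, Finset (G.Deriv A)} {n : ℕ} (hT : ∀ A (d : G.Deriv A), d.HeightLE n → d ∈ T A)
    {A : G.N} {d : G.Deriv A} (hd : d.HeightLE (n + 1)) : d ∈ extend G T A := by
  cases d with
  | node r ds => exact node_mem_extend.2 fun o => hT _ _ (RTG.Deriv.heightLE_node.1 hd o)

/-- The invariant within a round: at the items in `vis`, which have been visited already, the trees
of height `n + 1` are included. -/
theorem foldl_step_eq_sum [Fintype LM.G.R] [∀ r, Fintype (LM.G.rhs r).Occ]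
    (hD : ∀ r, AdditiveOn D (M.op (LM.wt r))) {n : ℕ} (l : List LM.G.N)
    (st : (LM.G.N → M.K) × Prop) (vis : Set LM.G.N) (T : ∀ A, Finset (LM.G.Deriv A))
    (hV : ∀ A, st.1 A = ∑ d ∈ T A, LM.weight d)
    (hT : ∀ A (d : LM.G.Deriv A), d.HeightLE n → d ∈ T A)
    (hT' : ∀ A ∈ vis, ∀ d : LM.G.Deriv A, d.HeightLE (n + 1) → d ∈ T A) :
    ∃ T' : ∀ A, Finset (LM.G.Deriv A),
      (∀ A, (l.foldl LM.step st).1 A = ∑ d ∈ T' A, LM.weight d) ∧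
      (∀ A (d : LM.G.Deriv A), (A ∈ vis ∨ A ∈ l) → d.HeightLE (n + 1) → d ∈ T' A) := by
  classical
  induction l generalizing st vis T with
  | nil => exact ⟨T, hV, fun A d hA => hT' A (by simpa using hA) d⟩
  | cons B l ih =>
    have hnew : ∀ A (d : LM.G.Deriv A), d.HeightLE (n + 1) → d ∈ extend LM.G T A :=
      fun A d hd => heightLE_mem_extend hT hd
    have hV1 : ∀ A, (LM.step st B).1 A =
        ∑ d ∈ Function.update T B (extend LM.G T B) A, LM.weight d := by
      intro A
      simp only [step]
      rcases eq_or_ne A B with rfl | hA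
      · rw [Function.update_self, Function.update_self, newVal_eq_sum hD hV]
      · rw [Function.update_of_ne hA, Function.update_of_ne hA, hV]
    have hT1 : ∀ A (d : LM.G.Deriv A), d.HeightLE n →
        d ∈ Function.update T B (extend LM.G T B) A := by
      intro A d hd
      rcases eq_or_ne A B with rfl | hA
      · rw [Function.update_self]
        exact hnew A d hd.succ
      · rw [Function.update_of_ne hA]
        exact hT A d hd
    have hT2 : ∀ A ∈ insert B vis, ∀ d : LM.G.Deriv A, d.HeightLE (n + 1) →
        d ∈ Function.update T B (extend LM.G T B) A := by
      intro A hA d hd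
      rcases eq_or_ne A B with rfl | hAB
      · rw [Function.update_self]
        exact hnew A d hd
      · rw [Function.update_of_ne hAB]
        exact hT' A (hA.resolve_left hAB) d hd
    obtain ⟨T', h1, h2⟩ := ih _ (insert B vis) _ hV1 hT1 hT2
    refine ⟨T', h1, fun A d hA => h2 A d ?_⟩
    simp only [List.mem_cons, Set.mem_insert_iff] at hA ⊢
    tauto

theorem represents_values (hD : ∀ r, AdditiveOn D (M.op (LM.wt r))) {ord : ℕ → List LM.G.N}
    (hord : LM.IsSchedule ord) (n : ℕ) : LM.Represents n (LM.values ord n) := by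
  have := Fintype.ofFinite LM.G.R
  have := fun r => Fintype.ofFinite (LM.G.rhs r).Occ
  induction n with
  | zero => exact ⟨fun _ => ∅, fun A => by simp [values],
      fun A d hd => absurd hd d.not_heightLE_zero⟩
  | succ n ih =>
    obtain ⟨T, hV, hT⟩ := ih
    obtain ⟨T', h1, h2⟩ := foldl_step_eq_sum hD (ord n) (LM.values ord n, False) ∅ T hV hT
      (by simp)
    exact ⟨T', h1, fun A d hd => h2 A d (Or.inr ((hord n).2 A)) hd⟩

theorem foldl_step_of_fixed {V : LM.G.N → M.K} (hV : ∀ A, LM.newVal V A = V A)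
    (l : List LM.G.N) : l.foldl LM.step (V, False) = (V, False) := by
  classical
  induction l with
  | nil => rfl
  | cons B l ih =>
    have : LM.step (V, False) B = (V, False) := by
      simp [step, hV]
    rw [List.foldl_cons, this, ih]

theorem foldl_step_of_not_changed (l : List LM.G.N) (st : (LM.G.N → M.K) × Prop)
    (h : ¬ (l.foldl LM.step st).2) : ¬ st.2 ∧ ∀ A ∈ l, LM.newVal st.1 A = st.1 A := by
  classical
  induction l generalizing st with
  | nil => exact ⟨h, by simp⟩
  | cons B l ih =>
    obtain ⟨h1, h2⟩ := ih (LM.step st B) h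
    simp only [step, not_or, ne_eq, not_not] at h1
    refine ⟨h1.1, fun A hA => ?_⟩
    have h3 : (LM.step st B).1 = st.1 := by
      simp only [step]
      rw [← h1.2, Function.update_eq_self]
    rw [h3] at h2
    rcases List.mem_cons.1 hA with rfl | hA
    · exact h1.2.symm
    · exact h2 A hA

/-- If the sum of the weights of a finite set of trees does not depend on the set, provided that
it contains all trees of height at most `N`, then the value computation algorithm
terminates with these sums. -/
theorem computes_of_sum_eq (hD : ∀ r, AdditiveOn D (M.op (LM.wt r))) (N : ℕ)
    (P : LM.G.N → M.K) (hP : ∀ A (T : Finset (LM.G.Deriv A)),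
      (∀ d : LM.G.Deriv A, d.HeightLE N → d ∈ T) → ∑ d ∈ T, LM.weight d = P A) :
    LM.Computes (P LM.G.start) := by
  classical
  intro ord hord
  have := Fintype.ofFinite LM.G.R
  have := fun r => Fintype.ofFinite (LM.G.rhs r).Occ
  have hval : ∀ n, N ≤ n → LM.values ord n = P := by
    intro n hn
    obtain ⟨T, hV, hT⟩ := represents_values hD hord n
    funext A
    rw [hV, hP A (T A) fun d hd => hT A d (hd.mono hn)]
  have hfix : ∀ A, LM.newVal P A = P A := by
    intro A
    obtain ⟨T, hV, hT⟩ := represents_values hD hord N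
    rw [hval N le_rfl] at hV
    rw [newVal_eq_sum hD hV, hP A _ fun d hd => heightLE_mem_extend hT hd.succ]
  have hex : ∃ n, ¬ LM.changed ord n := by
    refine ⟨N, ?_⟩
    rw [changed, round, hval N le_rfl, foldl_step_of_fixed hfix]
    exact id
  refine ⟨Nat.find hex, ⟨Nat.find_spec hex, fun m hm => not_not.1 (Nat.find_min hex hm)⟩, ?_⟩
  -- The state in which the algorithm halts is a fixpoint, hence it equals all later states.
  have hhalt : ∀ A, LM.newVal (LM.values ord (Nat.find hex)) A =
      LM.values ord (Nat.find hex) A := fun A =>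
    (foldl_step_of_not_changed _ _ (Nat.find_spec hex)).2 A ((hord _).2 A)
  have hlater : ∀ m, LM.values ord (Nat.find hex + m) = LM.values ord (Nat.find hex) := by
    intro m
    induction m with
    | zero => rfl
    | succ m ih =>
      rw [← Nat.add_assoc, values, round, ih, foldl_step_of_fixed hhalt]
  rw [hlater 1, ← hlater N, hval _ (Nat.le_add_left _ _)]

/-- As `computes_of_sum_eq`, for infinitary sums: the output is the sum over all trees. -/
theorem computes_of_isum_eq (hD : ∀ r, AdditiveOn D (M.op (LM.wt r))) (N : ℕ)
    (hN : ∀ A (T : Set (LM.G.Deriv A)), (∀ d : LM.G.Deriv A, d.HeightLE N → d ∈ T) →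
      (InfSum.isum fun d : T => LM.weight d.1) =
        InfSum.isum fun d : {d : LM.G.Deriv A // d.HeightLE N} => LM.weight d.1) :
    LM.Computes (InfSum.isum fun d : LM.G.Deriv LM.G.start => LM.weight d) := by
  have h := computes_of_sum_eq hD N
    (fun A => InfSum.isum fun d : {d : LM.G.Deriv A // d.HeightLE N} => LM.weight d.1)
    fun A T hT => by
      rw [← InfSum.isum_finset]
      exact hN A {d | d ∈ T} hT
  rw [← hN _ Set.univ fun _ _ => trivial] at h
  rwa [← InfSum.isum_equiv (Equiv.Set.univ _)]

end WRTGLM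

/-! ### Values of terms and trees -/

namespace Term

variable {S : Type u} {Γ : Signature S} {X : Type u} {sort : X → S}

theorem evalGround_subst (A : SortedAlgebra.{u, v} Γ) {s : S} (t : Term Γ sort s)
    (f : ∀ o : t.Occ, GTerm Γ (sort (t.label o))) :
    A.evalGround (t.subst f) = t.eval A fun o => A.evalGround (f o) := by
  induction t with
  | var x => rfl
  | op σ ts ih =>
    simp only [subst, eval, SortedAlgebra.evalGround]
    exact congrArg _ (funext fun i => ih i fun o => f ⟨i, o⟩)

theorem mem_factors_eval (A : SortedAlgebra.{u, v} Γ) {s : S} (t : Term Γ sort s)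
    (x : ∀ o : t.Occ, A.carrier (sort (t.label o))) (o : t.Occ) :
    (⟨sort (t.label o), x o⟩ : A.Obj) ∈ A.factors ⟨s, t.eval A x⟩ := by
  induction t with
  | var y => exact Relation.ReflTransGen.refl
  | op σ ts ih =>
    obtain ⟨i, o⟩ := o
    refine Relation.ReflTransGen.tail (ih i (fun o => x ⟨i, o⟩) o) ?_
    exact ⟨σ, fun i => (ts i).eval A fun o => x ⟨i, o⟩, i, rfl, rfl⟩

end Term

namespace RTG.Deriv

variable {S : Type u} {Γ : Signature S} {G : RTG Γ} (L : SortedAlgebra.{u, v} Γ)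

theorem value_node (r : G.R) (ds : ∀ o, G.Deriv (G.child r o)) :
    (node r ds).value L = (G.rhs r).eval L fun o => (ds o).value L :=
  (G.rhs r).evalGround_subst L _

/-- The value of a tree as an element of the sorted carrier set. -/
abbrev obj {A : G.N} (d : G.Deriv A) : L.Obj := ⟨G.sort A, d.value L⟩

theorem obj_child_mem_factors (r : G.R) (ds : ∀ o, G.Deriv (G.child r o)) (o : (G.rhs r).Occ) :
    (ds o).obj L ∈ L.factors ((node r ds).obj L) := by
  rw [obj, obj, value_node]
  exact (G.rhs r).mem_factors_eval L (fun o => (ds o).value L) o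

end RTG.Deriv

/-! ### Syntax trees of the canonical weighted deduction system -/

namespace WRTGLM

theorem occEquiv_itemTerm {X : Type u} (k : ℕ) (B : Fin k → X) (i : Fin (itemTerm k B).count) :
    (itemTerm k B).occEquiv i = ⟨Fin.cast (count_itemTerm k B) i, ()⟩ := by
  apply (itemTerm k B).occEquiv.symm.injective
  rw [Equiv.symm_apply_apply]
  apply Fin.ext
  change i.1 = (finSigmaFinEquiv (n := fun _ : Fin k => 1) ⟨Fin.cast (count_itemTerm k B) i, 0⟩).1
  rw [finSigmaFinEquiv_apply]
  simp

variable {S : Type u} {Γ : Signature S} {L : SortedAlgebra.{u, u} Γ}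
  {M : CompleteMMonoid.{u, v, w}} {LM : WRTGLM L M} {a : LM.Input}
  {hL : L.FinitelyDecomposable}

/-- The type of the trees over the rules of `LM.G` that correspond to the trees of the deduction
system whose root is the given item. -/
def ItemTree (LM : WRTGLM L M) (a : LM.Input) : LM.Item a → Type u
  | none => LM.G.Deriv LM.G.start
  | some x => LM.G.Deriv x.1

/-- The tree over the rules of `LM.G` from which the rules at the nodes of a tree of the deduction
system come. -/
def forget : {x : LM.Item a} → (LM.cnc hL a).G.Deriv x → LM.ItemTree a x
  | _, .node (Sum.inl ⟨r, p⟩) ds =>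
    RTG.Deriv.node r (Equiv.piCongrLeft (fun o => LM.G.Deriv (LM.G.child r o))
      (LM.G.rhs r).occEquiv fun i =>
        forget (x := p.childItem ((LM.G.rhs r).occEquiv i)) (ds ⟨i, ()⟩))
  | _, .node (Sum.inr r) ds =>
    forget (x := some (LM.G.start, LM.rhsOf r.1, ⟨_, .refl⟩)) (ds ⟨(0 : Fin 1), ()⟩)

/-- The tree has the nonterminal, the right-hand side and the value that the item prescribes. -/
def ItemTree.Matches : (x : LM.Item a) → LM.ItemTree a x → Prop
  | none, d => RTG.Deriv.value (G := LM.G) L d = a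
  | some x, d => LM.rhsOf (RTG.Deriv.root (G := LM.G) d) = x.2.1 ∧
      RTG.Deriv.obj (G := LM.G) L d = x.2.2.1

/-- The children of `forget d` come from the children of `d`. -/
theorem exists_forget_inl {r : LM.G.R} (p : LM.InstOf a r)
    (ds : ∀ o, (LM.cnc hL a).G.Deriv ((LM.cnc hL a).G.child (Sum.inl ⟨r, p⟩) o)) :
    ∃ ds' : ∀ o, LM.G.Deriv (LM.G.child r o),
      forget (.node (G := (LM.cnc hL a).G) (Sum.inl ⟨r, p⟩) ds) = RTG.Deriv.node r ds' ∧
      ∀ i, ds' ((LM.G.rhs r).occEquiv i) =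
        forget (x := p.childItem ((LM.G.rhs r).occEquiv i)) (ds ⟨i, ()⟩) :=
  ⟨_, rfl, fun i => Equiv.piCongrLeft_apply_apply _ _ _ i⟩

theorem forget_matches {x : (LM.cnc hL a).G.N} (d : (LM.cnc hL a).G.Deriv x) :
    ItemTree.Matches (LM := LM) x (forget d) := by
  induction d with
  | node i ds ih =>
    rcases i with ⟨r, p⟩ | r
    · obtain ⟨ds', h1, h2⟩ := exists_forget_inl p ds
      rw [h1]
      refine ⟨rfl, ?_⟩
      change RTG.Deriv.obj (G := LM.G) L (RTG.Deriv.node r ds') =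
        ⟨_, (LM.G.rhs r).eval L fun o => (p.1.1 o).1⟩
      rw [RTG.Deriv.obj, RTG.Deriv.value_node]
      congr 2
      funext o
      obtain ⟨i, rfl⟩ := (LM.G.rhs r).occEquiv.surjective o
      rw [h2]
      exact eq_of_heq (Sigma.mk.inj (ih ⟨i, ()⟩).2).2
    · exact eq_of_heq (Sigma.mk.inj (ih ⟨(0 : Fin 1), ()⟩).2).2

/-- The item at the root of a tree of the deduction system is determined by the tree over the rules
of `LM.G`, unless it is the goal item. -/
theorem eq_of_forget_eq {x y : LM.G.N × LM.Rhs × L.factors (LM.inputObj a)}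
    {d : (LM.cnc hL a).G.Deriv (some x : LM.Item a)}
    {e : (LM.cnc hL a).G.Deriv (some y : LM.Item a)} (hN : x.1 = y.1)
    (h : (forget d : LM.G.Deriv x.1) ≍ (forget e : LM.G.Deriv y.1)) : x = y := by
  obtain ⟨A, t, b⟩ := x
  obtain ⟨B, t', b'⟩ := y
  obtain rfl : A = B := hN
  have h := eq_of_heq h
  have hd := forget_matches d
  have he := forget_matches e
  rw [ItemTree.Matches] at hd he
  rw [h] at hd
  obtain rfl : t = t' := hd.1.symm.trans he.1
  obtain rfl : b = b' := Subtype.ext (hd.2.symm.trans he.2)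
  rfl

theorem forget_injective_aux {x : (LM.cnc hL a).G.N} (d : (LM.cnc hL a).G.Deriv x) :
    ∀ {y : (LM.cnc hL a).G.N} (e : (LM.cnc hL a).G.Deriv y), x = y → forget d ≍ forget e →
      d ≍ e := by
  induction d with
  | node i ds ih =>
    intro y e hxy h
    cases e with
    | node j es =>
      rcases i with ⟨r, p⟩ | r <;> rcases j with ⟨r', p'⟩ | r'
      · have hxy' : (some (LM.G.lhs r, LM.rhsOf r, ⟨_, p.2⟩) : LM.Item a) =
          some (LM.G.lhs r', LM.rhsOf r', ⟨_, p'.2⟩) := hxy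
        simp only [Option.some.injEq, Prod.mk.injEq] at hxy'
        obtain rfl : r = r' := LM.G.rule_ext hxy'.1
          (Sigma.mk.inj (congrArg Subtype.val hxy'.2.1)).2
        obtain ⟨ds', h1, h2⟩ := exists_forget_inl p ds
        obtain ⟨es', h3, h4⟩ := exists_forget_inl p' es
        rw [h1, h3] at h
        obtain rfl : ds' = es' := RTG.Deriv.node.inj (eq_of_heq h)
        have hc : ∀ o, p.childItem o = p'.childItem o := by
          intro o
          obtain ⟨i, rfl⟩ := (LM.G.rhs r).occEquiv.surjective o
          exact congrArg some (eq_of_forget_eq (hL := hL) (d := ds ⟨i, ()⟩) (e := es ⟨i, ()⟩) rfl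
            (heq_of_eq ((h2 i).symm.trans (h4 i))))
        obtain rfl : p = p' := InstOf.ext_childItem hc
        have : ds = es := by
          funext o
          obtain ⟨i, _⟩ := o
          exact eq_of_heq (ih ⟨i, ()⟩ (es ⟨i, ()⟩) rfl
            (heq_of_eq ((h2 i).symm.trans (h4 i))))
        rw [this]
      · exact absurd hxy (by simp [cnc, instLhs])
      · exact absurd hxy (by simp [cnc, instLhs])
      · have h' : (forget (x := some (LM.G.start, LM.rhsOf r.1, ⟨_, .refl⟩))
              (ds ⟨(0 : Fin 1), ()⟩) : LM.G.Deriv LM.G.start) =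
            forget (x := some (LM.G.start, LM.rhsOf r'.1, ⟨_, .refl⟩))
              (es ⟨(0 : Fin 1), ()⟩) := eq_of_heq h
        have hx := eq_of_forget_eq (hL := hL) (d := ds ⟨(0 : Fin 1), ()⟩)
          (e := es ⟨(0 : Fin 1), ()⟩) rfl (heq_of_eq h')
        simp only [Prod.mk.injEq] at hx
        obtain rfl : r = r' := Subtype.ext (LM.G.rule_ext (r.2.trans r'.2.symm)
          (Sigma.mk.inj (congrArg Subtype.val hx.2.1)).2)
        have : ds = es := by
          funext o
          obtain ⟨i, _⟩ := o
          obtain rfl : i = (0 : Fin 1) := Subsingleton.elim (α := Fin 1) _ _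
          exact eq_of_heq (ih ⟨(0 : Fin 1), ()⟩ (es ⟨(0 : Fin 1), ()⟩) rfl (heq_of_eq h'))
        rw [this]

/-- The items along a tree over the rules of `LM.G` can be restored: the values of the subtrees are
factors of the value of the tree. -/
theorem exists_forget_eq {A : LM.G.N} (d : LM.G.Deriv A) (b : L.factors (LM.inputObj a))
    (hb : d.obj L = b.1) :
    ∃ e : (LM.cnc hL a).G.Deriv (some (A, LM.rhsOf d.root, b) : LM.Item a), forget e = d := by
  induction d generalizing b with
  | node r ds ih =>
    have hf : ∀ o, (ds o).obj L ∈ L.factors (LM.inputObj a) := by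
      intro o
      refine Relation.ReflTransGen.trans (RTG.Deriv.obj_child_mem_factors L r ds o) ?_
      rw [hb]
      exact b.2
    choose es hes using fun o => ih o ⟨_, hf o⟩ rfl
    rw [RTG.Deriv.obj, RTG.Deriv.value_node] at hb
    obtain ⟨b, hbf⟩ := b
    obtain rfl := hb
    let p : LM.InstOf a r := ⟨(fun o => ⟨(ds o).value L, hf o⟩,
      fun o => ⟨LM.rhsOf (ds o).root, congrArg LM.G.sort (ds o).lhs_root⟩), hbf⟩
    let e : (LM.cnc hL a).G.Deriv ((LM.cnc hL a).G.lhs (Sum.inl ⟨r, p⟩)) :=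
      .node (G := (LM.cnc hL a).G) (Sum.inl ⟨r, p⟩)
        fun o : Σ _ : Fin (LM.G.rank r), Unit => es ((LM.G.rhs r).occEquiv o.1)
    refine ⟨e, ?_⟩
    obtain ⟨ds', h1, h2⟩ := exists_forget_inl (hL := hL) p
      fun o : Σ _ : Fin (LM.G.rank r), Unit => es ((LM.G.rhs r).occEquiv o.1)
    refine h1.trans (congrArg _ (funext fun o => ?_))
    obtain ⟨i, rfl⟩ := (LM.G.rhs r).occEquiv.surjective o
    rw [h2]
    exact hes _

theorem weight_forget {x : (LM.cnc hL a).G.N} (d : (LM.cnc hL a).G.Deriv x) :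
    (LM.cnc hL a).weight d = match (x : LM.Item a), forget d with
      | none, e => LM.weight (A := LM.G.start) e
      | some x, e => LM.weight (A := x.1) e := by
  induction d with
  | node i ds ih =>
    rw [weight_node]
    rcases i with ⟨r, p⟩ | r
    · obtain ⟨ds', h1, h2⟩ := exists_forget_inl p ds
      have h3 : ∀ i, (LM.cnc hL a).argEquiv (Sum.inl ⟨r, p⟩) i = ⟨Fin.cast (LM.ar_wt r) i, ()⟩ :=
        fun i => occEquiv_itemTerm (LM.G.rank r)
          (fun i => p.childItem ((LM.G.rhs r).occEquiv i))
          (finCongr ((LM.cnc hL a).ar_wt (Sum.inl ⟨r, p⟩)) i)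
      rw [h1]
      refine Eq.trans ?_ (weight_node r ds').symm
      refine congrArg (M.op (LM.wt r)) (funext fun i => ?_)
      rw [h3]
      refine (ih ⟨Fin.cast (LM.ar_wt r) i, ()⟩).trans ?_
      exact congrArg LM.weight (h2 (Fin.cast (LM.ar_wt r) i)).symm
    · refine Eq.trans ?_ (ih ⟨(0 : Fin 1), ()⟩)
      change (LM.cnc hL a).weight (ds ((LM.cnc hL a).argEquiv (Sum.inr r) (0 : Fin 1))) = _
      have h3 : (LM.cnc hL a).argEquiv (Sum.inr r) (0 : Fin 1) = ⟨(0 : Fin 1), ()⟩ :=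
        occEquiv_itemTerm 1
          (fun _ => (some (LM.G.start, LM.rhsOf r.1, ⟨_, .refl⟩) : LM.Item a))
          (finCongr ((LM.cnc hL a).ar_wt (Sum.inr r)) (0 : Fin 1))
      rw [h3]

/-- The trees of the deduction system for `a` correspond to the syntax trees of `a`. -/
noncomputable def goalEquiv (LM : WRTGLM L M) (hL : L.FinitelyDecomposable) (a : LM.Input) :
    (LM.cnc hL a).G.Deriv (LM.cnc hL a).G.start ≃ {d : LM.G.Deriv LM.G.start // d.value L = a} :=
  Equiv.ofBijective (fun d => ⟨forget d, forget_matches d⟩) <| by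
    constructor
    · intro d e h
      exact eq_of_heq (forget_injective_aux d e rfl (heq_of_eq (congrArg Subtype.val h)))
    · rintro ⟨d, rfl⟩
      obtain ⟨e, he⟩ := exists_forget_eq (hL := hL) (a := d.value L) d ⟨_, .refl⟩ rfl
      let e' : (LM.cnc hL (d.value L)).G.Deriv
          ((LM.cnc hL _).G.lhs (Sum.inr ⟨d.root, d.lhs_root⟩)) :=
        .node (G := (LM.cnc hL _).G) (Sum.inr ⟨d.root, d.lhs_root⟩) fun _ => e
      exact ⟨e', Subtype.ext he⟩

theorem parse_eq_isum (LM : WRTGLM L M) (hL : L.FinitelyDecomposable) (a : LM.Input) :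
    LM.parse a = InfSum.isum (K := M.K) fun d : (LM.cnc hL a).G.Deriv (LM.cnc hL a).G.start =>
      (LM.cnc hL a).weight d := by
  rw [parse, ← InfSum.isum_equiv (goalEquiv LM hL a)]
  congr 1
  funext d
  exact (weight_forget d).symm

theorem child_ne_none (i : (LM.cnc hL a).G.R) (o : ((LM.cnc hL a).G.rhs i).Occ) :
    (LM.cnc hL a).G.child i o ≠ (none : LM.Item a) := by
  rcases i with ⟨r, p⟩ | r <;> exact Option.some_ne_none _

/-- `forget` on pairs of an item and a tree. -/
def forgetSigma (q : Σ x, (LM.cnc hL a).G.Deriv x) : Σ A, LM.G.Deriv A :=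
  match (q.1 : LM.Item a), forget q.2 with
  | none, e => ⟨LM.G.start, e⟩
  | some x, e => ⟨x.1, e⟩

theorem isProperSubtree_forgetSigma {p d : Σ x, (LM.cnc hL a).G.Deriv x}
    (h : RTG.Deriv.IsProperSubtree p d) (hd : d.1 ≠ (none : LM.Item a)) :
    p.1 ≠ (none : LM.Item a) ∧ RTG.Deriv.IsProperSubtree (forgetSigma p) (forgetSigma d) := by
  have key : ∀ p d : Σ x, (LM.cnc hL a).G.Deriv x, RTG.Deriv.IsChild p d →
      d.1 ≠ (none : LM.Item a) →
      p.1 ≠ (none : LM.Item a) ∧ RTG.Deriv.IsChild (forgetSigma p) (forgetSigma d) := by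
    rintro p d ⟨i, ds, o, rfl, rfl⟩ hd
    refine ⟨child_ne_none i o, ?_⟩
    rcases i with ⟨r, q⟩ | r
    · obtain ⟨i, _⟩ := o
      obtain ⟨ds', h1, h2⟩ := exists_forget_inl q ds
      refine ⟨r, ds', (LM.G.rhs r).occEquiv i, ?_, ?_⟩
      · rw [← h1]
        rfl
      · exact congrArg (Sigma.mk (LM.G.child r ((LM.G.rhs r).occEquiv i))) (h2 i).symm
    · exact absurd rfl hd
  induction h with
  | single h => exact ⟨(key _ _ h hd).1, .single (key _ _ h hd).2⟩
  | tail _ h ih =>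
    have h1 := key _ _ h hd
    exact ⟨(ih h1.1).1, (ih h1.1).2.tail h1.2⟩

/-- Trees with the same item of the form `[A, t, b]` at the root come from trees with the same root
rule and the same value; the goal item does not occur below the root. -/
theorem acyclic_cnc (h : LM.G.Nonlooping L) : (LM.cnc hL a).G.Acyclic := by
  rintro ⟨x, d⟩ ⟨y, p⟩ hp hr
  have hxy : x = y := d.lhs_root.symm.trans ((congrArg (LM.cnc hL a).G.lhs hr).trans p.lhs_root)
  subst hxy
  have hx : x ≠ (none : LM.Item a) := by
    rcases Relation.TransGen.head'_iff.1 hp with ⟨_, ⟨i, ds, o, -, h⟩, -⟩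
    have h1 := congrArg Sigma.fst h
    exact fun hn => child_ne_none i o (h1.symm.trans hn)
  have h1 := (isProperSubtree_forgetSigma hp hx).2
  rcases x with _ | ⟨A, t, b⟩
  · exact hx rfl
  · have hd := forget_matches d
    have he := forget_matches p
    refine h _ _ h1 (hd.2.trans he.2.symm) (LM.G.rule_ext ?_ ?_)
    · exact (RTG.Deriv.lhs_root _).trans (RTG.Deriv.lhs_root _).symm
    · exact (Sigma.mk.inj (congrArg Subtype.val (hd.1.trans he.1.symm))).2

end WRTGLM

/-! ### Applicability for acyclic deduction systems -/

namespace WRTGLM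

variable {S : Type u} {Γ : Signature S} {L : SortedAlgebra.{u, u} Γ}
  {M : CompleteMMonoid.{u, v, w}} {LM : WRTGLM L M}

/-- A property of the weight operations that the identity mapping has is inherited by the canonical
weighted deduction system. -/
theorem cnc_op {P : ∀ k, ((Fin k → M.K) → M.K) → Prop} (hP : ∀ r, P _ (M.op (LM.wt r)))
    (hid : P 1 fun x => x 0) (hL : L.FinitelyDecomposable) (a : LM.Input)
    (i : (LM.cnc hL a).G.R) : P _ (M.addId.op ((LM.cnc hL a).wt i)) := by
  rcases i with ⟨r, p⟩ | r
  · exact hP r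
  · exact hid

theorem cnc_additiveOn {D : AddSubmonoid M.K} (hD : ∀ r, AdditiveOn D (M.op (LM.wt r)))
    (hL : L.FinitelyDecomposable) (a : LM.Input) (i : (LM.cnc hL a).G.R) :
    AdditiveOn (K := M.addId.K) D (M.addId.op ((LM.cnc hL a).wt i)) :=
  cnc_op (P := fun _ f => AdditiveOn D f) hD (.proj (fun i j => Subsingleton.elim i j) 0) hL a i

/-- A criterion for termination of the algorithm with the correct output: the sum of the weights of
a set of trees of the deduction system depends only on the trees of height at most `N`. -/
theorem parserOutputs_of_isum_eq {D : AddSubmonoid M.K}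
    (hD : ∀ r, AdditiveOn D (M.op (LM.wt r))) (hL : L.FinitelyDecomposable) (a : LM.Input)
    (N : ℕ) (hN : ∀ A (T : Set ((LM.cnc hL a).G.Deriv A)),
      (∀ d : (LM.cnc hL a).G.Deriv A, d.HeightLE N → d ∈ T) →
      (InfSum.isum (K := M.addId.K) fun d : T => (LM.cnc hL a).weight d.1) =
        InfSum.isum (K := M.addId.K) fun d : {d : (LM.cnc hL a).G.Deriv A // d.HeightLE N} =>
          (LM.cnc hL a).weight d.1) :
    LM.ParserOutputs a (LM.parse a) := by
  refine ⟨hL, ?_⟩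
  rw [parse_eq_isum LM hL a]
  exact computes_of_isum_eq (cnc_additiveOn hD hL a) N hN

theorem parserOutputs_of_acyclic {D : AddSubmonoid M.K}
    (hD : ∀ r, AdditiveOn D (M.op (LM.wt r))) (hL : L.FinitelyDecomposable) (a : LM.Input)
    (h : (LM.cnc hL a).G.Acyclic) : LM.ParserOutputs a (LM.parse a) := by
  refine parserOutputs_of_isum_eq hD hL a (Nat.card (LM.cnc hL a).G.R) fun A T hT => ?_
  have hT' : T = {d | d.HeightLE (Nat.card (LM.cnc hL a).G.R)} :=
    Set.ext fun d => ⟨fun _ => h.heightLE d, hT d⟩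
  subst hT'
  rfl

theorem applicable_of_nonlooping {D : AddSubmonoid M.K}
    (hD : ∀ r, AdditiveOn D (M.op (LM.wt r))) (hL : L.FinitelyDecomposable)
    (h : LM.G.Nonlooping L) : LM.Applicable :=
  fun a => parserOutputs_of_acyclic hD hL a (acyclic_cnc h)

end WRTGLM

/-! ### Semirings -/

/-- Folding a biadditive operation over the tuple of arguments. -/
theorem AdditiveOn.foldl {K : Type v} [AddCommMonoid K] (mul : K → K → K)
    (add_mul : ∀ a b c, mul (a + b) c = mul a c + mul b c)
    (mul_add : ∀ a b c, mul a (b + c) = mul a b + mul a c)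
    (zero_mul : ∀ a, mul 0 a = 0) (mul_zero : ∀ a, mul a 0 = 0) (κ : K) (k : ℕ) :
    AdditiveOn ⊤ fun x : Fin k → K => (List.ofFn x).foldl mul κ := by
  have hzero : ∀ l : List K, l.foldl mul 0 = 0 := by
    intro l
    induction l with
    | nil => rfl
    | cons a l ih => rw [List.foldl_cons, zero_mul, ih]
  have hadd : ∀ (l : List K) (a b : K),
      l.foldl mul (a + b) = l.foldl mul a + l.foldl mul b := by
    intro l
    induction l with
    | nil => exact fun _ _ => rfl
    | cons c l ih =>
      intro a b
      simp only [List.foldl_cons, add_mul, ih]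
  have hupd : ∀ {k : ℕ} (x : Fin (k + 1) → K) (i : Fin k) (a : K),
      (fun j : Fin k => Function.update x i.succ a j.succ) =
        Function.update (fun j : Fin k => x j.succ) i a :=
    fun x i a => Fin.tail_update_succ x i a
  refine ⟨fun _ _ => trivial, fun x i a b _ _ _ => ?_, fun x i _ hx => ?_⟩
  · induction k generalizing κ with
    | zero => exact i.elim0
    | succ k ih =>
      simp only [List.ofFn_succ, List.foldl_cons]
      cases i using Fin.cases with
      | zero =>
        have : ∀ c, (fun j : Fin k => Function.update x 0 c j.succ) = fun j => x j.succ :=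
          fun c => funext fun j => Function.update_of_ne (Fin.succ_ne_zero j) _ _
        simp only [this, Function.update_self, mul_add, hadd]
      | succ i =>
        simp only [hupd, Function.update_of_ne (Fin.succ_ne_zero i).symm]
        exact ih _ _ i (fun _ => trivial)
  · induction k generalizing κ with
    | zero => exact i.elim0
    | succ k ih =>
      simp only [List.ofFn_succ, List.foldl_cons]
      cases i using Fin.cases with
      | zero => rw [hx, mul_zero, hzero]
      | succ i => exact ih _ _ i (fun _ => trivial) hx

theorem AdditiveOn.const_zero {K : Type v} [AddCommMonoid K] (D : AddSubmonoid K) (k : ℕ) :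
    AdditiveOn D fun _ : Fin k → K => 0 :=
  ⟨fun _ _ => D.zero_mem, fun _ _ _ _ _ _ _ => (add_zero 0).symm, fun _ _ _ _ => rfl⟩

theorem semiringMMonoid_additiveOn (K : Type v) [Semiring K] [CompleteSemiring.{u, v} K]
    (ω : (semiringMMonoid.{u, v} K).Ω) :
    AdditiveOn (K := K) ⊤ ((semiringMMonoid.{u, v} K).op ω) := by
  rcases ω with ⟨k, κ⟩ | k
  · have h := AdditiveOn.foldl (K := K) (· * ·) add_mul mul_add zero_mul mul_zero κ k
    have hl : ∀ (l : List K) (κ : K), κ * l.prod = l.foldl (· * ·) κ := by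
      intro l
      induction l with
      | nil => simp
      | cons a l ih =>
        intro κ
        rw [List.prod_cons, List.foldl_cons, ← ih, mul_assoc]
    have hf : (fun x : Fin k → K => (List.ofFn x).foldl (· * ·) κ) =
        fun x => κ * (List.ofFn x).prod := funext fun x => (hl _ _).symm
    rw [hf] at h
    exact h
  · exact .const_zero (K := K) ⊤ k

/-! ### Superior M-monoids -/

namespace WRTGLM

variable {S : Type u} {Γ : Signature S} {L : SortedAlgebra.{u, u} Γ}
  {M : CompleteMMonoid.{u, v, w}} {LM : WRTGLM L M}

/-- The operation `f` is monotone and bounded by its arguments with respect to the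
measure `φ`. -/
def DecreasingFor {K : Type v} {Λ : Type*} [Preorder Λ] (φ : K → Λ) {k : ℕ}
    (f : (Fin k → K) → K) : Prop :=
  (∀ x y, (∀ i, φ (x i) ≤ φ (y i)) → φ (f x) ≤ φ (f y)) ∧ ∀ x i, φ (f x) ≤ φ (x i)

section Cut

variable {Λ : Type*} [Preorder Λ] {φ : M.K → Λ}

open RTG.Deriv

theorem weight_context_mono (hφ : ∀ r, DecreasingFor φ (M.op (LM.wt r))) {A B : LM.G.N}
    {C : LM.G.Deriv B → LM.G.Deriv A} (hC : IsContext C) {d e : LM.G.Deriv B}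
    (h : φ (LM.weight d) ≤ φ (LM.weight e)) :
    φ (LM.weight (C d)) ≤ φ (LM.weight (C e)) := by
  classical
  induction hC with
  | id => exact h
  | node r ds o C _ ih =>
    rw [weight_node, weight_node]
    refine (hφ r).1 _ _ fun i => ?_
    rcases eq_or_ne (LM.argEquiv r i) o with rfl | ho
    · simpa using ih
    · simp [ho]

theorem weight_node_le (hφ : ∀ r, DecreasingFor φ (M.op (LM.wt r))) (r : LM.G.R)
    (ds : ∀ o, LM.G.Deriv (LM.G.child r o)) (o : (LM.G.rhs r).Occ) :
    φ (LM.weight (.node r ds)) ≤ φ (LM.weight (ds o)) := by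
  obtain ⟨i, rfl⟩ := (LM.argEquiv r).surjective o
  rw [weight_node]
  exact (hφ r).2 _ i

theorem weight_le_of_subtree (hφ : ∀ r, DecreasingFor φ (M.op (LM.wt r)))
    {x y : Σ A, LM.G.Deriv A} (h : Relation.ReflTransGen IsChild x y) :
    φ (LM.weight y.2) ≤ φ (LM.weight x.2) := by
  induction h with
  | refl => exact le_rfl
  | tail _ h ih =>
    obtain ⟨r, ds, o, rfl, rfl⟩ := h
    exact (weight_node_le hφ r ds o).trans ih

/-- If some rule occurs more than `n` times on a path of `d`, then cutting out the part between
the first occurrence and each of the next `n` ones gives `n` smaller trees. -/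
theorem exists_smaller (hφ : ∀ r, DecreasingFor φ (M.op (LM.wt r))) (n : ℕ) {A : LM.G.N}
    (d : LM.G.Deriv A) (hd : ¬ d.HeightLE (n * Nat.card LM.G.R)) :
    ∃ s : Finset (LM.G.Deriv A), s.card = n ∧
      ∀ e ∈ s, e.size < d.size ∧ φ (LM.weight d) ≤ φ (LM.weight e) := by
  classical
  have := Fintype.ofFinite LM.G.R
  obtain ⟨r, e, s, C, hC, rfl, hs, -, hse⟩ := d.exists_context_of_not_heightLE (fun _ => n)
    (by simpa [Nat.mul_comm] using hd)
  refine ⟨s.map ⟨C, hC.injective⟩, by rw [Finset.card_map, hs], fun y hy => ?_⟩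
  obtain ⟨x, hx, rfl⟩ := Finset.mem_map.1 hy
  exact ⟨hC.size_lt (hse x hx).2.size_lt,
    weight_context_mono hφ hC (weight_le_of_subtree hφ (hse x hx).2.to_reflTransGen)⟩

/-- A tree of large height is dominated by `n` trees of small height. -/
theorem exists_finset_heightLE (hφ : ∀ r, DecreasingFor φ (M.op (LM.wt r))) (n : ℕ)
    {A : LM.G.N} (d : LM.G.Deriv A) (hd : ¬ d.HeightLE (n * Nat.card LM.G.R)) :
    ∃ s : Finset (LM.G.Deriv A), s.card = n ∧
      ∀ e ∈ s, e.HeightLE (n * Nat.card LM.G.R) ∧ φ (LM.weight d) ≤ φ (LM.weight e) := by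
  induction hm : d.size using Nat.strong_induction_on generalizing d with
  | _ m ih =>
    obtain ⟨s, hs, hse⟩ := exists_smaller hφ n d hd
    by_cases h : ∀ e ∈ s, e.HeightLE (n * Nat.card LM.G.R)
    · exact ⟨s, hs, fun e he => ⟨h e he, (hse e he).2⟩⟩
    · push Not at h
      obtain ⟨e, he, hN⟩ := h
      obtain ⟨s', hs', hse'⟩ := ih _ (hm ▸ (hse e he).1) e hN rfl
      exact ⟨s', hs', fun x hx => ⟨(hse' x hx).1, (hse e he).2.trans (hse' x hx).2⟩⟩

theorem exists_heightLE_le (hφ : ∀ r, DecreasingFor φ (M.op (LM.wt r))) {A : LM.G.N}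
    (d : LM.G.Deriv A) : ∃ e : LM.G.Deriv A, e.HeightLE (Nat.card LM.G.R) ∧
      φ (LM.weight d) ≤ φ (LM.weight e) := by
  by_cases hd : d.HeightLE (Nat.card LM.G.R)
  · exact ⟨d, hd, le_rfl⟩
  · obtain ⟨s, hs, hse⟩ := exists_finset_heightLE hφ 1 d (by simpa using hd)
    obtain ⟨e, he⟩ := Finset.card_pos.1 (hs ▸ Nat.one_pos)
    have := hse e he
    rw [Nat.one_mul] at this
    exact ⟨e, this⟩

end Cut

theorem applicable_of_superior (hL : L.FinitelyDecomposable) (hM : M.Superior) :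
    LM.Applicable := by
  intro a
  obtain ⟨⟨hadd, hzero⟩, inst, -, hinf, -, hmono, hle⟩ := hM
  have hD : ∀ r, AdditiveOn ⊤ (M.op (LM.wt r)) := fun r =>
    ⟨fun _ _ => trivial, fun x i a b _ _ _ => hadd _ x i a b, fun x i _ hx => hzero _ x ⟨i, hx⟩⟩
  -- With respect to the dual order, cutting a tree does not decrease its weight.
  have hφ : ∀ r, DecreasingFor (OrderDual.toDual : M.K → M.Kᵒᵈ) (M.op (LM.wt r)) := by
    intro r
    refine ⟨fun x y hxy => ?_, fun x i => hle _ x i⟩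
    have key : ∀ s : Finset (Fin (M.ar (LM.wt r))),
        M.op (LM.wt r) (s.piecewise y x) ≤ M.op (LM.wt r) x := by
      intro s
      induction s using Finset.induction_on with
      | empty => rw [Finset.piecewise_empty]
      | insert i s hi ih =>
        rw [Finset.piecewise_insert]
        refine (hmono _ (s.piecewise y x) i (y i) ?_).trans ih
        rw [Finset.piecewise_eq_of_notMem _ _ _ hi]
        exact hxy i
    have h := key Finset.univ
    rw [Finset.piecewise_univ] at h
    exact h
  have hφ' : ∀ i, DecreasingFor (OrderDual.toDual : M.K → M.Kᵒᵈ)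
      (M.addId.op ((LM.cnc hL a).wt i)) :=
    cnc_op (P := fun _ f => DecreasingFor (OrderDual.toDual : M.K → M.Kᵒᵈ) f) hφ
      ⟨fun x y h => h 0, fun x i => by rw [Subsingleton.elim i 0]⟩ hL a
  refine parserOutputs_of_isum_eq hD hL a (Nat.card (LM.cnc hL a).G.R) fun A T hT => ?_
  refine (hinf _ _).unique ⟨?_, fun b hb => (hinf _ _).2 ?_⟩
  · rintro _ ⟨⟨d, hd⟩, rfl⟩
    obtain ⟨e, he, hde⟩ := exists_heightLE_le hφ' d
    have key : ∀ x y : M.K, OrderDual.toDual x ≤ OrderDual.toDual y → y ≤ x := fun _ _ h => h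
    exact ((hinf _ _).1 ⟨⟨e, he⟩, rfl⟩).trans (key _ _ hde)
  · rintro _ ⟨⟨e, he⟩, rfl⟩
    exact hb ⟨⟨e, hT e he⟩, rfl⟩

end WRTGLM

/-! ### The best derivation M-monoid -/

namespace WRTGLM

variable {S : Type u} {Γ : Signature S} {L : SortedAlgebra.{u, u} Γ}
  {M : CompleteMMonoid.{u, v, w}} {LM : WRTGLM L M}

/-- The operation `f` is strictly monotone in each argument as long as the measures of all
arguments are positive. -/
def StrictFor {K : Type v} (φ : K → ℝ) {k : ℕ} (f : (Fin k → K) → K) : Prop :=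
  (∀ x, (∀ i, 0 < φ (x i)) → 0 < φ (f x)) ∧
  ∀ x y, (∀ i, 0 < φ (x i)) → (∀ i, φ (x i) ≤ φ (y i)) → (∃ i, φ (x i) < φ (y i)) →
    φ (f x) < φ (f y)

open RTG.Deriv

variable {φ : M.K → ℝ}

theorem weight_pos (hφ : ∀ r, StrictFor φ (M.op (LM.wt r))) {A : LM.G.N}
    (d : LM.G.Deriv A) : 0 < φ (LM.weight d) := by
  induction d with
  | node r ds ih =>
    rw [weight_node]
    exact (hφ r).1 _ fun i => ih _

theorem weight_context_strictMono (hφ : ∀ r, StrictFor φ (M.op (LM.wt r))) {A B : LM.G.N}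
    {C : LM.G.Deriv B → LM.G.Deriv A} (hC : IsContext C) {d e : LM.G.Deriv B}
    (h : φ (LM.weight d) < φ (LM.weight e)) :
    φ (LM.weight (C d)) < φ (LM.weight (C e)) := by
  classical
  induction hC with
  | id => exact h
  | node r ds o C _ ih =>
    rw [weight_node, weight_node]
    refine (hφ r).2 _ _ (fun i => weight_pos hφ _) (fun i => ?_) ⟨(LM.argEquiv r).symm o, ?_⟩
    · rcases eq_or_ne (LM.argEquiv r i) o with rfl | ho
      · simpa using ih.le
      · simp [ho]
    · rw [Equiv.apply_symm_apply]
      simpa using ih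

/-- If the rules that may occur below the root decrease the measure strictly, then a tree of
maximal measure has no repetition of a rule on a path. -/
theorem exists_weight_lt (hφ : ∀ r, StrictFor φ (M.op (LM.wt r)))
    (hφ' : ∀ r, DecreasingFor φ (M.op (LM.wt r)))
    (hlt : ∀ r, (∃ r' o, LM.G.child r' o = LM.G.lhs r) → ∀ x, (∀ i, 0 < φ (x i)) →
      ∀ i, φ (M.op (LM.wt r) x) < φ (x i))
    {A : LM.G.N} (d : LM.G.Deriv A) (hd : ¬ d.HeightLE (Nat.card LM.G.R)) :
    ∃ e : LM.G.Deriv A, φ (LM.weight d) < φ (LM.weight e) := by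
  have := Fintype.ofFinite LM.G.R
  obtain ⟨r, e, s, C, hC, rfl, hs, he, hse⟩ := d.exists_context_of_not_heightLE (fun _ => 1)
    (by simpa using hd)
  obtain ⟨x, hx⟩ := Finset.card_pos.1 (hs ▸ Nat.one_pos)
  refine ⟨C x, weight_context_strictMono hφ hC ?_⟩
  obtain ⟨⟨B, y⟩, hxy, r', ds, o, hde, hy⟩ := Relation.TransGen.tail'_iff.1 (hse x hx).2
  have hr' : r' = r := by
    have h1 := congrArg (fun q : Σ A, LM.G.Deriv A => q.2.root) hde
    exact h1.symm.trans he
  subst hr'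
  obtain rfl : e = node r' ds := eq_of_heq (Sigma.mk.inj hde).2
  have hchild : ∃ r o, LM.G.child r o = LM.G.lhs r' := by
    rcases Relation.TransGen.head'_iff.1 (hse x hx).2 with ⟨_, ⟨r, ds, o, -, h⟩, -⟩
    exact ⟨r, o, (congrArg Sigma.fst h).symm⟩
  have h1 := weight_le_of_subtree hφ' hxy
  rw [hy] at h1
  refine lt_of_lt_of_le ?_ h1
  obtain ⟨i, rfl⟩ := (LM.argEquiv r').surjective o
  rw [weight_node]
  exact hlt r' hchild _ (fun i => weight_pos hφ _) i

/-- The measure of the value of `f` is the product of the measures of the arguments and of the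
factor `c`. -/
def ProductFor {K : Type v} (φ : K → ℝ) (c : ℝ) {k : ℕ} (f : (Fin k → K) → K) : Prop :=
  ∀ x, φ (f x) = c * ∏ i, φ (x i)

namespace ProductFor

variable {K : Type v} {φ : K → ℝ} {c : ℝ} {k : ℕ} {f : (Fin k → K) → K}

theorem proj : ProductFor φ 1 fun x : Fin 1 → K => x 0 := fun x => by simp

theorem le_mul (hf : ProductFor φ c f) (hφ : ∀ x, 0 ≤ φ x ∧ φ x ≤ 1) (hc : 0 ≤ c)
    (x : Fin k → K) (i : Fin k) : φ (f x) ≤ c * φ (x i) := by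
  rw [hf x, ← Finset.mul_prod_erase Finset.univ _ (Finset.mem_univ i)]
  refine mul_le_mul_of_nonneg_left (mul_le_of_le_one_right (hφ _).1 ?_) hc
  exact Finset.prod_le_one (fun _ _ => (hφ _).1) fun _ _ => (hφ _).2

theorem decreasingFor (hf : ProductFor φ c f) (hφ : ∀ x, 0 ≤ φ x ∧ φ x ≤ 1) (hc : 0 ≤ c)
    (hc1 : c ≤ 1) : DecreasingFor φ f := by
  refine ⟨fun x y h => ?_, fun x i => (hf.le_mul hφ hc x i).trans
    (mul_le_of_le_one_left (hφ _).1 hc1)⟩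
  rw [hf x, hf y]
  exact mul_le_mul_of_nonneg_left (Finset.prod_le_prod (fun _ _ => (hφ _).1) fun i _ => h i) hc

theorem strictFor (hf : ProductFor φ c f) (hc : 0 < c) : StrictFor φ f := by
  refine ⟨fun x h => ?_, fun x y h h1 h2 => ?_⟩
  · rw [hf x]
    exact mul_pos hc (Finset.prod_pos fun i _ => h i)
  · rw [hf x, hf y]
    obtain ⟨i, hi⟩ := h2
    exact mul_lt_mul_of_pos_left (Finset.prod_lt_prod (fun i _ => h i) (fun i _ => h1 i)
      ⟨i, Finset.mem_univ i, hi⟩) hc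

end ProductFor

end WRTGLM

namespace BD

variable {R : Type u} (rk : R → ℕ)

/-- The pairs that do not consist of the probability `0` and a nonempty set.  The operations are
not additive on the whole carrier set, since multiplication by `0` identifies different
probabilities. -/
def proper : @AddSubmonoid (mmonoid rk).K (mmonoid rk).monoid.toAddMonoid.toAddZeroClass where
  carrier := {x : Carrier rk | x.1 = 0 → x.2 = ∅}
  zero_mem' := fun _ => rfl
  add_mem' := by
    intro (a : Carrier rk) (b : Carrier rk) (ha : a.1 = 0 → a.2 = ∅) (hb : b.1 = 0 → b.2 = ∅)
    change (maxv a b).1 = 0 → (maxv a b).2 = ∅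
    unfold maxv
    split_ifs with h1 h2
    · exact ha
    · exact hb
    · intro (h : a.1 = 0)
      have h3 : b.1 = 0 := (le_antisymm (not_lt.1 h1) (not_lt.1 h2)).symm.trans h
      simp [ha h, hb h3]

theorem mem_proper {x : Carrier rk} : x ∈ proper rk ↔ (x.1 = 0 → x.2 = ∅) := Iff.rfl

theorem maxv_fst (u v : Carrier rk) : (maxv u v).1 = max u.1 v.1 := by
  unfold maxv
  split_ifs with h1 h2
  · exact (max_eq_left h1.le).symm
  · exact (max_eq_right h2.le).symm
  · exact (max_eq_left (not_lt.1 h2)).symm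

theorem mem_maxv_snd (u v : Carrier rk) (t : RTree rk) :
    t ∈ (maxv u v).2 ↔ (v.1 ≤ u.1 ∧ t ∈ u.2) ∨ (u.1 ≤ v.1 ∧ t ∈ v.2) := by
  unfold maxv
  split_ifs with h1 h2
  · simp [h1.le, h1.not_ge]
  · simp [h2.le, h2.not_ge]
  · simp [not_lt.1 h1, not_lt.1 h2]

/-- The probability, as a real number. -/
def prob (x : Carrier rk) : ℝ := x.1

theorem prob_tc (p : unitInterval) (r : R) :
    WRTGLM.ProductFor (prob rk) p (tc rk p r) := fun x => by
  have h : ∀ s : Finset (Fin (rk r)),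
      ((∏ i ∈ s, (x i).1 : unitInterval) : ℝ) = ∏ i ∈ s, prob rk (x i) := by
    classical
    intro s
    induction s using Finset.induction_on with
    | empty => rfl
    | insert i s hi ih =>
      rw [Finset.prod_insert hi, Finset.prod_insert hi, Set.Icc.coe_mul, ih]
      rfl
  exact congrArg ((p : ℝ) * ·) (h Finset.univ)

theorem tc_additiveOn (p : unitInterval) (hp : 0 < p) (r : R) :
    AdditiveOn (proper rk) ((mmonoid rk).op (tcOp rk p r)) := by
  refine ⟨fun x hx => ?_, fun x i a b hx ha hb => ?_, fun x i hx hxi => ?_⟩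
  · intro (h : p * ∏ i, (x i).1 = 0)
    obtain ⟨i, -, hi⟩ := Finset.prod_eq_zero_iff.1 ((mul_eq_zero.1 h).resolve_left hp.ne')
    refine Set.eq_empty_of_forall_notMem ?_
    rintro _ ⟨d, hd, -⟩
    have h1 := hd i
    rw [(mem_proper rk).1 (hx i) hi] at h1
    exact h1
  · change Fin (rk r) → Carrier rk at x
    change Fin (rk r) at i
    change Carrier rk at a b
    change tc rk p r (Function.update x i (maxv a b)) =
      maxv (tc rk p r (Function.update x i a)) (tc rk p r (Function.update x i b))
    have h1 : ∀ c : Carrier rk, (tc rk p r (Function.update x i c)).1 =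
        p * (∏ j ∈ Finset.univ.erase i, (x j).1) * c.1 := by
      intro c
      change p * ∏ j, (Function.update x i c j).1 = _
      rw [← Finset.mul_prod_erase Finset.univ _ (Finset.mem_univ i), Function.update_self,
        Finset.prod_congr rfl fun j hj => by rw [Function.update_of_ne (Finset.ne_of_mem_erase hj)],
        mul_comm c.1, mul_assoc]
    have h2 : ∀ (c : Carrier rk) (t : RTree rk), t ∈ (tc rk p r (Function.update x i c)).2 ↔
        ∃ d : Fin (rk r) → RTree rk, (∀ j, j ≠ i → d j ∈ (x j).2) ∧ t = ⟨r, d⟩ ∧ d i ∈ c.2 := by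
      intro c t
      constructor
      · rintro ⟨d, hd, ht⟩
        refine ⟨d, fun j hj => ?_, ht, ?_⟩
        · simpa [hj] using hd j
        · simpa using hd i
      · rintro ⟨d, hd, ht, hi⟩
        refine ⟨d, fun j => ?_, ht⟩
        rcases eq_or_ne j i with rfl | hj
        · simpa using hi
        · simpa [hj] using hd j hj
    have hq : ∀ d : Fin (rk r) → RTree rk, (∀ j, j ≠ i → d j ∈ (x j).2) →
        0 < p * (∏ j ∈ Finset.univ.erase i, (x j).1) := by
      intro d hd
      refine pos_iff_ne_zero.2 (mul_ne_zero hp.ne' (Finset.prod_ne_zero_iff.2 fun j hj h0 => ?_))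
      have h3 := hd j (Finset.ne_of_mem_erase hj)
      rw [(mem_proper rk).1 (hx j) h0] at h3
      exact h3
    have hle : ∀ q y z : unitInterval, 0 < q → q * y ≤ q * z → y ≤ z := by
      intro q y z hq h
      have h' : (q : ℝ) * y ≤ q * z := h
      exact le_of_mul_le_mul_left h' hq
    have hmono : ∀ q y z : unitInterval, y ≤ z → q * y ≤ q * z :=
      fun q y z h => mul_le_mul_right h q
    apply Prod.ext
    · rw [h1, maxv_fst, maxv_fst, h1, h1]
      exact (show Monotone fun y : unitInterval => _ * y from fun y z h => hmono _ y z h).map_max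
    · ext t
      rw [h2, mem_maxv_snd, h2, h2, h1, h1]
      constructor
      · rintro ⟨d, hd, ht, hi⟩
        rcases (mem_maxv_snd rk a b _).1 hi with ⟨h, hi⟩ | ⟨h, hi⟩
        · exact Or.inl ⟨hmono _ _ _ h, d, hd, ht, hi⟩
        · exact Or.inr ⟨hmono _ _ _ h, d, hd, ht, hi⟩
      · rintro (⟨h, d, hd, ht, hi⟩ | ⟨h, d, hd, ht, hi⟩)
        · exact ⟨d, hd, ht, (mem_maxv_snd rk a b _).2 (Or.inl ⟨hle _ _ _ (hq d hd) h, hi⟩)⟩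
        · exact ⟨d, hd, ht, (mem_maxv_snd rk a b _).2 (Or.inr ⟨hle _ _ _ (hq d hd) h, hi⟩)⟩
  · change Fin (rk r) → Carrier rk at x
    change Fin (rk r) at i
    have hxi : x i = (0, ∅) := hxi
    apply Prod.ext
    · change p * ∏ j, (x j).1 = 0
      rw [Finset.prod_eq_zero (Finset.mem_univ i) (by rw [hxi]), mul_zero]
    · refine Set.eq_empty_of_forall_notMem ?_
      rintro _ ⟨d, hd, -⟩
      have h1 := hd i
      rw [hxi] at h1
      exact h1

variable {S : Type u} {Γ : Signature S} {L : SortedAlgebra.{u, u} Γ}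
  {LM : WRTGLM L (mmonoid rk)}

/-- The supremum of the probabilities is attained only at trees of bounded height. -/
theorem applicable (hL : L.FinitelyDecomposable)
    (h : ∀ r, ∃ p s, 0 < p ∧ p < 1 ∧ LM.wt r = tcOp rk p s) : LM.Applicable := by
  intro a
  have hφ01 : ∀ x : (mmonoid rk).K, 0 ≤ prob rk x ∧ prob rk x ≤ 1 := fun x => x.1.2
  have hD : ∀ r, AdditiveOn (proper rk) ((mmonoid rk).op (LM.wt r)) := by
    intro r
    obtain ⟨p, s, hp, -, hw⟩ := h r
    rw [hw]
    exact tc_additiveOn rk p hp s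
  have hφ : ∀ r, ∃ c, 0 < c ∧ c < 1 ∧
      WRTGLM.ProductFor (prob rk) c ((mmonoid rk).op (LM.wt r)) := by
    intro r
    obtain ⟨p, s, hp, hp1, hw⟩ := h r
    rw [hw]
    exact ⟨p, hp, hp1, prob_tc rk p s⟩
  have hφ' : ∀ i, ∃ c, 0 < c ∧ c ≤ 1 ∧
      WRTGLM.ProductFor (prob rk) c ((mmonoid rk).addId.op ((LM.cnc hL a).wt i)) :=
    WRTGLM.cnc_op (P := fun _ f => ∃ c, 0 < c ∧ c ≤ 1 ∧ WRTGLM.ProductFor (prob rk) c f)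
      (fun r => (hφ r).imp fun c hc => ⟨hc.1, hc.2.1.le, hc.2.2⟩)
      ⟨1, one_pos, le_rfl, .proj⟩ hL a
  have hdec : ∀ i, WRTGLM.DecreasingFor (prob rk)
      ((mmonoid rk).addId.op ((LM.cnc hL a).wt i)) := fun i => by
    obtain ⟨c, hc, hc1, hf⟩ := hφ' i
    exact hf.decreasingFor hφ01 hc.le hc1
  have hgt : ∀ {A} (d : (LM.cnc hL a).G.Deriv A),
      ¬ d.HeightLE (Nat.card (LM.cnc hL a).G.R) →
      ∃ e : (LM.cnc hL a).G.Deriv A, e.HeightLE (Nat.card (LM.cnc hL a).G.R) ∧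
        prob rk ((LM.cnc hL a).weight d) < prob rk ((LM.cnc hL a).weight e) := by
    intro A d hd
    obtain ⟨e, he⟩ := WRTGLM.exists_weight_lt (φ := prob rk) (fun i => by
      obtain ⟨c, hc, -, hf⟩ := hφ' i
      exact hf.strictFor hc) hdec (by
        -- The rules for the goal item do not decrease the probability, but this item
        -- occurs only at the root.
        rintro (⟨r, p⟩ | r) ⟨r', o, hr⟩ x hx i
        · obtain ⟨c, hc, hc1, hf⟩ := hφ r
          exact (hf.le_mul hφ01 hc.le x i).trans_lt (mul_lt_of_lt_one_left (hx i) hc1)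
        · exact absurd hr (WRTGLM.child_ne_none r' o)) d hd
    obtain ⟨e', he', hle⟩ := WRTGLM.exists_heightLE_le hdec e
    exact ⟨e', he', he.trans_le hle⟩
  refine WRTGLM.parserOutputs_of_isum_eq hD hL a (Nat.card (LM.cnc hL a).G.R) fun A T hT => ?_
  let f : (LM.cnc hL a).G.Deriv A → Carrier rk := (LM.cnc hL a).weight
  let B := {d : (LM.cnc hL a).G.Deriv A // d.HeightLE (Nat.card (LM.cnc hL a).G.R)}
  have hs : (⨆ d : T, (f d.1).1) = ⨆ d : B, (f d.1).1 := by
    apply le_antisymm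
    · refine iSup_le fun d => ?_
      obtain ⟨e, he, hle⟩ := WRTGLM.exists_heightLE_le hdec d.1
      exact le_iSup_of_le (⟨e, he⟩ : B) hle
    · exact iSup_le fun d => le_iSup (fun d : T => (f d.1).1) ⟨d.1, hT d.1 d.2⟩
  apply Prod.ext
  · exact hs
  · ext t
    refine (mem_isum rk (fun d : T => f d.1) t).trans
      (Iff.trans ?_ (mem_isum rk (fun d : B => f d.1) t).symm)
    rw [← hs]
    constructor
    · rintro ⟨d, hd, ht⟩
      refine ⟨⟨d.1, ?_⟩, hd, ht⟩
      by_contra hN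
      obtain ⟨e, he, hlt⟩ := hgt d.1 hN
      have h1 : (f e).1 ≤ (f d.1).1 := by
        rw [hd]
        exact le_iSup (fun d : T => (f d.1).1) ⟨e, hT e he⟩
      exact absurd h1 (not_le.2 hlt)
    · rintro ⟨d, hd, ht⟩
      exact ⟨⟨d.1, hT d.1 d.2⟩, hd, ht⟩

end BD

/-! ### The `n`-best M-monoid -/

namespace NBest

variable {n : ℕ}

theorem takeNBest_zero (hn : 0 < n) {ι : Type u} (f : ι → unitInterval) :
    (takeNBest n f).1 ⟨0, hn⟩ = ⨆ i, f i := by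
  refine eq_of_forall_lt_iff fun x => ?_
  rw [lt_takeNBest, lt_iSup_iff]
  simp only [Nat.zero_add, Nat.cast_one, Set.one_le_encard_iff_nonempty]
  rfl

/-- Taking the `n` greatest members of each part of a family first does not change the `n` greatest
members of the family. -/
theorem takeNBest_sigma (hn : 0 < n) {J : Type u} {ι : J → Type u}
    (f : ∀ j, ι j → unitInterval) :
    (takeNBest n fun jk : J × Fin n => (takeNBest n (f jk.1)).1 jk.2) =
      takeNBest n fun p : Σ j, ι j => f p.1 p.2 := by
  -- A number `x` is identified with the tuple `(x, 0, …, 0)`.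
  let unit : unitInterval → Carrier n := fun x =>
    ⟨fun k => if k.1 = 0 then x else 0, fun k l hkl => by
      dsimp only
      split_ifs with h1 h2
      · exact le_rfl
      · exact absurd (Nat.eq_zero_of_le_zero (h1 ▸ hkl)) h2
      · exact bot_le
      · exact le_rfl⟩
  have key : ∀ {I : Type u} (g : I → unitInterval),
      isum n (fun i => unit (g i)) = takeNBest n g := by
    intro I g
    refine takeNBest_congr _ _ fun x => ?_
    rw [← (show Function.Injective fun i : I => ((i, ⟨0, hn⟩) : I × Fin n) from
      fun i j h => congrArg Prod.fst h).encard_image]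
    congr 1
    ext ⟨i, k⟩
    constructor
    · intro (h : x < if k.1 = 0 then g i else 0)
      split_ifs at h with hk
      · exact ⟨i, h, Prod.ext rfl (Fin.ext hk.symm)⟩
      · exact absurd h not_lt_bot
    · rintro ⟨i', h, h'⟩
      cases h'
      exact h
  have hfib : ∀ j, (takeNBest n fun p : {p : Σ j, ι j // p.1 = j} => f p.1.1 p.1.2) =
      takeNBest n (f j) := by
    intro j
    let e : ι j ≃ {p : Σ j, ι j // p.1 = j} :=
      Equiv.ofBijective (fun i => ⟨⟨j, i⟩, rfl⟩)
        ⟨fun i i' h => eq_of_heq (Sigma.mk.inj (congrArg Subtype.val h)).2, by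
          rintro ⟨⟨_, i⟩, rfl⟩
          exact ⟨i, rfl⟩⟩
    exact (takeNBest_congr _ _ (encard_eq_of_equiv e _ _ fun _ => rfl)).symm
  rw [← key fun p : Σ j, ι j => f p.1 p.2, isum_partition (n := n) Sigma.fst]
  simp only [key, hfib]
  rfl

theorem mul_takeNBest (c : unitInterval) {ι : Type u} (f : ι → unitInterval) (k : Fin n) :
    c * (takeNBest n f).1 k = (takeNBest n fun i => c * f i).1 k := by
  change c * sSup _ = sSup _
  have hmono : Monotone fun y : unitInterval => c * y := fun y z h => mul_le_mul_right h c
  have hcont : Continuous fun y : unitInterval => c * y := by fun_prop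
  rw [hmono.map_sSup_of_continuousAt hcont.continuousAt (mul_zero c)]
  apply le_antisymm
  · refine sSup_le_sSup ?_
    rintro _ ⟨x, ⟨s, hs, hx⟩, rfl⟩
    exact ⟨s, hs, fun j hj => hmono (hx j hj)⟩
  · refine sSup_le ?_
    rintro x ⟨s, hs, hx⟩
    obtain ⟨j, hj, hmin⟩ := s.exists_min_image f (Finset.card_pos.1 (by omega))
    exact (hx j hj).trans (le_sSup ⟨f j, ⟨s, hs, hmin⟩, rfl⟩)

theorem takeNBest_equiv {ι κ : Type*} (e : ι ≃ κ) (f : κ → unitInterval) :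
    takeNBest n (fun i => f (e i)) = takeNBest n f :=
  takeNBest_congr _ _ (encard_eq_of_equiv e _ _ fun _ => rfl)

theorem muln_comm (a b : Carrier n) : muln n a b = muln n b a :=
  takeNBest_congr _ _ (encard_eq_of_equiv (Equiv.prodComm _ _) _ _ fun _ => mul_comm _ _)

/-- Both sides consist of the `n` greatest products of a component of `a` with a component of `b`
or `c`. -/
theorem muln_maxn (hn : 0 < n) (a b c : Carrier n) :
    muln n a (maxn n b c) = maxn n (muln n a b) (muln n a c) := by
  have h1 : muln n a (maxn n b c) =
      takeNBest n fun p : Σ _ : Fin n, Fin n ⊕ Fin n => a.1 p.1 * Sum.elim b.1 c.1 p.2 := by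
    rw [← takeNBest_sigma hn fun (i : Fin n) (j : Fin n ⊕ Fin n) => a.1 i * Sum.elim b.1 c.1 j]
    simp only [← mul_takeNBest]
    rfl
  have h2 : maxn n (muln n a b) (muln n a c) =
      takeNBest n fun p : Σ _ : Bool, Fin n × Fin n =>
        a.1 p.2.1 * (if p.1 then b else c).1 p.2.2 := by
    rw [← takeNBest_sigma hn fun (t : Bool) (p : Fin n × Fin n) =>
      a.1 p.1 * (if t then b else c).1 p.2]
    let e : Fin n ⊕ Fin n ≃ Bool × Fin n :=
      { toFun := Sum.elim (fun k => (true, k)) fun k => (false, k)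
        invFun := fun p => if p.1 then .inl p.2 else .inr p.2
        left_inv := by rintro (k | k) <;> rfl
        right_inv := by rintro ⟨_ | _, k⟩ <;> rfl }
    rw [← takeNBest_equiv e]
    unfold maxn
    congr 1
    funext k
    rcases k with k | k <;> rfl
  let e : (Σ _ : Fin n, Fin n ⊕ Fin n) ≃ Σ _ : Bool, Fin n × Fin n :=
    { toFun := fun p => Sum.elim (fun k => ⟨true, p.1, k⟩) (fun k => ⟨false, p.1, k⟩) p.2
      invFun := fun p => ⟨p.2.1, if p.1 then .inl p.2.2 else .inr p.2.2⟩
      left_inv := by rintro ⟨i, k | k⟩ <;> rfl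
      right_inv := by rintro ⟨_ | _, i, k⟩ <;> rfl }
  rw [h1, h2, ← takeNBest_equiv e]
  congr 1
  funext p
  obtain ⟨i, k | k⟩ := p <;> rfl

theorem muln_zero (a : Carrier n) : muln n a (sumOp.{u} n).zero = (sumOp.{u} n).zero := by
  refine ext_lt fun i x => ?_
  unfold muln
  rw [lt_takeNBest, Set.encard_eq_zero.2 (Set.eq_empty_of_forall_notMem fun j hj => ?_)]
  · refine ⟨fun h => absurd h (by simp), fun h => absurd h not_lt_bot⟩
  · have hj : x < a.1 j.1 * 0 := hj
    rw [mul_zero] at hj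
    exact absurd hj not_lt_bot

theorem mmonoid_additiveOn (hn : 0 < n) (ω : (mmonoid.{u} n).Ω) :
    AdditiveOn (K := (mmonoid.{u} n).K) ⊤ ((mmonoid.{u} n).op ω) := by
  rcases ω with ⟨k, κ⟩ | k
  · exact AdditiveOn.foldl (K := (mmonoid.{u} n).K) (muln n)
      (fun a b c => by
        refine (muln_comm _ _).trans ((muln_maxn hn c a b).trans ?_)
        rw [muln_comm c a, muln_comm c b]
        rfl)
      (fun a b c => muln_maxn hn a b c)
      (fun a => (muln_comm _ _).trans (muln_zero.{u} a)) (fun a => muln_zero.{u} a) κ k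
  · exact .const_zero (K := (mmonoid.{u} n).K) ⊤ k

/-- The greatest component, as a real number. -/
noncomputable def best (hn : 0 < n) (x : Carrier n) : ℝ := x.1 ⟨0, hn⟩

theorem best_muln (hn : 0 < n) (a b : Carrier n) :
    best hn (muln n a b) = best hn a * best hn b := by
  have h : (muln n a b).1 ⟨0, hn⟩ = a.1 ⟨0, hn⟩ * b.1 ⟨0, hn⟩ := by
    unfold muln
    rw [takeNBest_zero]
    apply le_antisymm
    · refine iSup_le fun ij => ?_
      exact mul_le_mul' (a.2 (Nat.zero_le _)) (b.2 (Nat.zero_le _))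
    · exact le_iSup (fun ij : Fin n × Fin n => a.1 ij.1 * b.1 ij.2) (⟨0, hn⟩, ⟨0, hn⟩)
  exact congrArg Subtype.val h

theorem productFor_op (hn : 0 < n) (ω : (mmonoid.{u} n).Ω) :
    ∃ c, 0 ≤ c ∧ c ≤ 1 ∧ WRTGLM.ProductFor (best hn) c ((mmonoid.{u} n).op ω) := by
  rcases ω with ⟨k, κ⟩ | k
  · refine ⟨best hn κ, (κ.1 _).2.1, (κ.1 _).2.2, fun x => ?_⟩
    change best hn ((List.ofFn x).foldl (muln n) κ) = best hn κ * ∏ i, best hn (x i)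
    have h : ∀ (l : List (Carrier n)) (κ : Carrier n),
        best hn (l.foldl (muln n) κ) = best hn κ * (l.map (best hn)).prod := by
      intro l
      induction l with
      | nil => simp
      | cons a l ih =>
        intro κ
        rw [List.foldl_cons, ih, best_muln, List.map_cons, List.prod_cons, mul_assoc]
    rw [h, List.map_ofFn, List.prod_ofFn]
    rfl
  · refine ⟨0, le_rfl, zero_le_one, fun x => ?_⟩
    rw [zero_mul]
    rfl

variable {S : Type u} {Γ : Signature S} {L : SortedAlgebra.{u, u} Γ}
  {LM : WRTGLM L (mmonoid.{u} n)}

/-- Either all components above a threshold `x` come from trees of bounded height, or a single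
component that does not yields `n` trees of bounded height whose greatest component exceeds `x`. -/
theorem applicable (hL : L.FinitelyDecomposable) (hn : 0 < n) : LM.Applicable := by
  classical
  intro a
  have hφ01 : ∀ x : (mmonoid.{u} n).K, 0 ≤ best hn x ∧ best hn x ≤ 1 := fun x => (x.1 _).2
  have hdec : ∀ i, WRTGLM.DecreasingFor (best hn)
      ((mmonoid.{u} n).addId.op ((LM.cnc hL a).wt i)) := fun i => by
    obtain ⟨c, hc, hc1, hf⟩ :=
      WRTGLM.cnc_op (P := fun _ f => ∃ c, 0 ≤ c ∧ c ≤ 1 ∧ WRTGLM.ProductFor (best hn) c f)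
        (fun r => productFor_op hn (LM.wt r)) ⟨1, zero_le_one, le_rfl, .proj⟩ hL a i
    exact hf.decreasingFor hφ01 hc hc1
  refine WRTGLM.parserOutputs_of_isum_eq (fun r => mmonoid_additiveOn hn (LM.wt r)) hL a
    (n * Nat.card (LM.cnc hL a).G.R) fun A T hT => ?_
  let f : (LM.cnc hL a).G.Deriv A → Carrier n := (LM.cnc hL a).weight
  let B := {d : (LM.cnc hL a).G.Deriv A // d.HeightLE (n * Nat.card (LM.cnc hL a).G.R)}
  change isum n (fun d : T => f d.1) = isum n fun d : B => f d.1
  let g : B × Fin n → T × Fin n := fun p => (⟨p.1.1, hT _ p.1.2⟩, p.2)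
  have hg : Function.Injective g := by
    rintro ⟨d, k⟩ ⟨d', k'⟩ h
    simp only [g, Prod.mk.injEq, Subtype.mk.injEq] at h
    exact Prod.ext (Subtype.ext h.1) h.2
  refine ext_lt fun i x => ?_
  unfold isum
  rw [lt_takeNBest, lt_takeNBest]
  constructor
  · intro h
    by_cases hbig : ∃ p : T × Fin n, x < (f p.1.1).1 p.2 ∧
        ¬ p.1.1.HeightLE (n * Nat.card (LM.cnc hL a).G.R)
    · obtain ⟨p, hp, hN⟩ := hbig
      obtain ⟨s, hs, hse⟩ := WRTGLM.exists_finset_heightLE hdec n p.1.1 hN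
      let t : Finset (B × Fin n) := s.attach.map
        ⟨fun d => (⟨d.1, (hse d.1 d.2).1⟩, ⟨0, hn⟩), fun d d' h =>
          Subtype.ext (congrArg (fun q : B × Fin n => q.1.1) h)⟩
      have ht : t.card = n := by rw [Finset.card_map, Finset.card_attach, hs]
      have hi : ((i.1 + 1 : ℕ) : ℕ∞) ≤ (t.card : ℕ∞) := Nat.cast_le.2 (ht.symm ▸ i.2)
      refine hi.trans ?_
      rw [← Set.encard_coe_eq_coe_finsetCard]
      refine Set.encard_le_encard fun y hy => ?_
      obtain ⟨d, -, rfl⟩ := Finset.mem_map.1 hy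
      have h1 : (f p.1.1).1 ⟨0, hn⟩ ≤ (f d.1).1 ⟨0, hn⟩ := (hse d.1 d.2).2
      exact (hp.trans_le ((f p.1.1).2 (Nat.zero_le _))).trans_le h1
    · push Not at hbig
      rw [← hg.encard_image]
      refine h.trans (Set.encard_le_encard ?_)
      rintro p hp
      exact ⟨(⟨p.1.1, hbig p hp⟩, p.2), hp, rfl⟩
  · intro h
    refine h.trans ?_
    rw [← hg.encard_image]
    refine Set.encard_le_encard ?_
    rintro _ ⟨p, hp, rfl⟩
    exact hp

end NBest

/-! ### The intersection M-monoid -/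

namespace Intersection

section Applicable

variable {S' : Type u} {Γ' : Signature S'} (G' : RTG Γ') (L' : SortedAlgebra.{u, u} Γ')
  (a' : L'.carrier (G'.sort G'.start))

theorem mem_ruleOp (r : G'.R) (V : Fin (G'.rank r) → Set (Rule G' L' a')) (p : Rule G' L' a') :
    p ∈ ruleOp G' L' a' r V ↔ (∀ i, V i ≠ ∅) ∧ ((∃ i, p ∈ V i) ∨
      ∃ an mem, p = ⟨r, an, mem⟩ ∧ ∀ i : Fin (G'.rank r),
        (⟨G'.child r ((G'.rhs r).occEquiv i), an ((G'.rhs r).occEquiv i)⟩ : NT G' L' a')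
          ∈ Rule.lhs '' V i) := by
  unfold ruleOp
  split_ifs with h
  · obtain ⟨i, hi⟩ := h
    exact ⟨fun h => absurd h (Set.notMem_empty _), fun h => absurd hi (h.1 i)⟩
  · push Not at h
    rw [Set.mem_union, Set.mem_iUnion]
    exact ⟨fun hp => ⟨fun i => (h i).ne_empty, hp⟩, fun hp => hp.2⟩

theorem ruleOp_additiveOn (r : G'.R) :
    AdditiveOn (K := (mmonoid G' L' a').K) ⊤ (ruleOp G' L' a' r) := by
  refine ⟨fun _ _ => trivial, fun x i A B _ _ _ => ?_, fun x i _ hx => ?_⟩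
  · change Fin (G'.rank r) → Set (Rule G' L' a') at x
    change Set (Rule G' L' a') at A B
    change ruleOp G' L' a' r (Function.update x i (A ∪ B)) =
      ruleOp G' L' a' r (Function.update x i A) ∪ ruleOp G' L' a' r (Function.update x i B)
    have hempty : ruleOp G' L' a' r (Function.update x i ∅) = ∅ := by
      refine Set.eq_empty_of_forall_notMem fun p hp => ?_
      exact ((mem_ruleOp ..).1 hp).1 i (Function.update_self ..)
    rcases A.eq_empty_or_nonempty with rfl | hA
    · rw [hempty, Set.empty_union, Set.empty_union]
    rcases B.eq_empty_or_nonempty with rfl | hB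
    · rw [hempty, Set.union_empty, Set.union_empty]
    have hne : ∀ C : Set (Rule G' L' a'), C.Nonempty →
        ((∀ j, Function.update x i C j ≠ ∅) ↔ ∀ j, j ≠ i → x j ≠ ∅) := by
      intro C hC
      refine ⟨fun h j hj => by simpa [hj] using h j, fun h j => ?_⟩
      rcases eq_or_ne j i with rfl | hj
      · simpa using hC.ne_empty
      · simpa [hj] using h j hj
    have hex : ∀ (C : Set (Rule G' L' a')) (p : Rule G' L' a'),
        (∃ j, p ∈ Function.update x i C j) ↔ p ∈ C ∨ ∃ j, j ≠ i ∧ p ∈ x j := by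
      intro C p
      constructor
      · rintro ⟨j, hj⟩
        rcases eq_or_ne j i with rfl | hji
        · exact Or.inl (by simpa using hj)
        · exact Or.inr ⟨j, hji, by simpa [hji] using hj⟩
      · rintro (h | ⟨j, hji, hj⟩)
        · exact ⟨i, by simpa using h⟩
        · exact ⟨j, by simpa [hji] using hj⟩
    have hall : ∀ (C : Set (Rule G' L' a')) (q : Fin (G'.rank r) → NT G' L' a'),
        (∀ j, q j ∈ Rule.lhs '' Function.update x i C j) ↔
          q i ∈ Rule.lhs '' C ∧ ∀ j, j ≠ i → q j ∈ Rule.lhs '' x j := by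
      intro C q
      constructor
      · refine fun h => ⟨?_, fun j hj => ?_⟩
        · simpa only [Function.update_self] using h i
        · simpa only [Function.update_of_ne hj] using h j
      · rintro ⟨h1, h2⟩ j
        rcases eq_or_ne j i with rfl | hj
        · simpa only [Function.update_self] using h1
        · simpa only [Function.update_of_ne hj] using h2 j hj
    ext p
    rw [Set.mem_union, mem_ruleOp, mem_ruleOp, mem_ruleOp, hne _ hA, hne _ hB,
      hne _ (hA.mono Set.subset_union_left), hex, hex, hex, Set.mem_union]
    have h1 : ∀ C : Set (Rule G' L' a'), (∃ an mem, p = ⟨r, an, mem⟩ ∧ ∀ j,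
          (⟨G'.child r ((G'.rhs r).occEquiv j), an ((G'.rhs r).occEquiv j)⟩ : NT G' L' a') ∈
            Rule.lhs '' Function.update x i C j) ↔
        ∃ an mem, p = ⟨r, an, mem⟩ ∧
          (⟨G'.child r ((G'.rhs r).occEquiv i), an ((G'.rhs r).occEquiv i)⟩ : NT G' L' a') ∈
            Rule.lhs '' C ∧ ∀ j, j ≠ i →
          (⟨G'.child r ((G'.rhs r).occEquiv j), an ((G'.rhs r).occEquiv j)⟩ : NT G' L' a') ∈
            Rule.lhs '' x j := by
      intro C
      refine exists_congr fun an => exists_congr fun mem => and_congr Iff.rfl ?_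
      exact hall C fun j => ⟨G'.child r ((G'.rhs r).occEquiv j), an ((G'.rhs r).occEquiv j)⟩
    rw [h1, h1, h1, Set.image_union]
    constructor
    · rintro ⟨h, ((h' | h') | h') | ⟨an, mem, hp, h' | h', h''⟩⟩
      · exact Or.inl ⟨h, Or.inl (Or.inl h')⟩
      · exact Or.inr ⟨h, Or.inl (Or.inl h')⟩
      · exact Or.inl ⟨h, Or.inl (Or.inr h')⟩
      · exact Or.inl ⟨h, Or.inr ⟨an, mem, hp, h', h''⟩⟩
      · exact Or.inr ⟨h, Or.inr ⟨an, mem, hp, h', h''⟩⟩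
    · rintro (⟨h, (h' | h') | ⟨an, mem, hp, h', h''⟩⟩ | ⟨h, (h' | h') | ⟨an, mem, hp, h', h''⟩⟩)
      · exact ⟨h, Or.inl (Or.inl (Or.inl h'))⟩
      · exact ⟨h, Or.inl (Or.inr h')⟩
      · exact ⟨h, Or.inr ⟨an, mem, hp, Or.inl h', h''⟩⟩
      · exact ⟨h, Or.inl (Or.inl (Or.inr h'))⟩
      · exact ⟨h, Or.inl (Or.inr h')⟩
      · exact ⟨h, Or.inr ⟨an, mem, hp, Or.inr h', h''⟩⟩
  · refine Set.eq_empty_of_forall_notMem fun p hp => ?_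
    exact ((mem_ruleOp ..).1 hp).1 i hx

variable {S : Type u} {Γ : Signature S} {L : SortedAlgebra.{u, u} Γ}
  {LM : WRTGLM L (mmonoid G' L' a')}

theorem applicable (hL' : L'.FinitelyDecomposable) (hL : L.FinitelyDecomposable) :
    LM.Applicable := by
  intro a
  have hD : ∀ r, AdditiveOn (K := (mmonoid G' L' a').K) ⊤ ((mmonoid G' L' a').op (LM.wt r)) := by
    intro r
    rcases LM.wt r with r' | k
    · exact ruleOp_additiveOn G' L' a' r'
    · exact .const_zero (K := (mmonoid G' L' a').K) ⊤ k
  have := finite_rule (G := G') (a := a') hL'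
  let w : ∀ {A}, (LM.cnc hL a).G.Deriv A → Set (Rule G' L' a') := (LM.cnc hL a).weight
  -- There are only finitely many rules, hence a height up to which all of them have been found.
  have hex : ∀ q : (LM.cnc hL a).G.N × Rule G' L' a', ∃ n,
      (∃ d : (LM.cnc hL a).G.Deriv q.1, q.2 ∈ w d) →
        ∃ d : (LM.cnc hL a).G.Deriv q.1, d.HeightLE n ∧ q.2 ∈ w d := by
    intro q
    by_cases h : ∃ d : (LM.cnc hL a).G.Deriv q.1, q.2 ∈ w d
    · obtain ⟨d, hd⟩ := h
      obtain ⟨n, hn⟩ := d.exists_heightLE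
      exact ⟨n, fun _ => ⟨d, hn, hd⟩⟩
    · exact ⟨0, fun h' => absurd h' h⟩
  choose n hn using hex
  obtain ⟨N, hN⟩ := Finite.bddAbove_range n
  refine WRTGLM.parserOutputs_of_isum_eq hD hL a N fun A T hT => ?_
  change ⋃ d : T, w d.1 = ⋃ d : {d : (LM.cnc hL a).G.Deriv A // d.HeightLE N}, w d.1
  apply Set.Subset.antisymm
  · refine Set.iUnion_subset fun d p hp => ?_
    obtain ⟨e, he, hpe⟩ := hn (A, p) ⟨d.1, hp⟩
    exact Set.mem_iUnion.2 ⟨⟨e, he.mono (hN ⟨_, rfl⟩)⟩, hpe⟩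
  · exact Set.iUnion_subset fun d => Set.subset_iUnion (fun d : T => w d.1) ⟨d.1, hT _ d.2⟩

end Applicable

end Intersection

/-! ### The intersection of a grammar and a syntactic object -/

namespace Term

variable {S : Type u} {Γ : Signature S} {X : Type u} {sort : X → S} {F : X → Type u}

theorem relabel_annotate {s : S} (t : Term Γ sort s) (an : ∀ o : t.Occ, F (t.label o))
    (h : ∀ o, sort ((t.annotate an).label o).1 = sort ((t.annotate an).label o).1) :
    (t.annotate an).relabel (sortY := sort) (fun o => ((t.annotate an).label o).1) h = t := by
  induction t with
  | var x => rfl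
  | op σ ts ih => exact congrArg (op σ) (funext fun i => ih i (fun o => an ⟨i, o⟩) fun _ => rfl)

theorem eval_annotate (A : SortedAlgebra.{u, v} Γ) {s : S} (t : Term Γ sort s)
    (an : ∀ o : t.Occ, F (t.label o)) (g : ∀ x, F x → A.carrier (sort x)) :
    (t.annotate an).eval A (fun o => g _ ((t.annotate an).label o).2) =
      t.eval A fun o => g _ (an o) := by
  induction t with
  | var x => rfl
  | op σ ts ih => exact congrArg (A.interp σ) (funext fun i => ih i fun o => an ⟨i, o⟩)

theorem exists_annotate_occ {s : S} (t : Term Γ sort s) (an : ∀ o : t.Occ, F (t.label o)) :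
    ∃ (e : t.Occ ≃ (t.annotate an).Occ) (hc : t.count = (t.annotate an).count),
      (∀ o, (t.annotate an).label (e o) = ⟨t.label o, an o⟩) ∧
      ∀ i, (t.annotate an).occEquiv (Fin.cast hc i) = e (t.occEquiv i) := by
  induction t with
  | var x => exact ⟨Equiv.refl _, rfl, fun _ => rfl, fun _ => rfl⟩
  | op σ ts ih =>
    choose e hc he he' using fun i => ih i fun o => an ⟨i, o⟩
    refine ⟨Equiv.sigmaCongrRight e, Finset.sum_congr rfl fun i _ => hc i,
      fun o => he o.1 o.2, fun i => ?_⟩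
    obtain ⟨⟨j, k⟩, rfl⟩ := (finSigmaFinEquiv (n := fun i => (ts i).count)).surjective i
    have h1 : (Fin.cast (Finset.sum_congr rfl fun i _ => hc i)
        (finSigmaFinEquiv (n := fun i => (ts i).count) ⟨j, k⟩) :
        Fin (∑ i, ((ts i).annotate fun o => an ⟨i, o⟩).count)) =
        finSigmaFinEquiv (n := fun i => ((ts i).annotate fun o => an ⟨i, o⟩).count)
          ⟨j, Fin.cast (hc j) k⟩ := by
      apply Fin.ext
      rw [Fin.val_cast, finSigmaFinEquiv_apply, finSigmaFinEquiv_apply]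
      simp [hc]
    change (Equiv.sigmaCongrRight fun i => ((ts i).annotate fun o => an ⟨i, o⟩).occEquiv)
      (finSigmaFinEquiv.symm (Fin.cast _
        (finSigmaFinEquiv (n := fun i => (ts i).count) ⟨j, k⟩))) =
      Equiv.sigmaCongrRight e ((Equiv.sigmaCongrRight fun i => (ts i).occEquiv)
        (finSigmaFinEquiv.symm (finSigmaFinEquiv (n := fun i => (ts i).count) ⟨j, k⟩)))
    rw [h1, Equiv.symm_apply_apply, Equiv.symm_apply_apply]
    exact congrArg (Sigma.mk j) (he' j k)

end Term

namespace Intersection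

variable {S : Type u} {Γ : Signature S} {L : SortedAlgebra.{u, u} Γ} {G : RTG Γ}
  {a : L.carrier (G.sort G.start)}

variable (L a) in
/-- The weight of a syntax tree in the intersection M-monoid. -/
def ruleSet {A : G.N} (d : G.Deriv A) : Set (Rule G L a) := (lm G L a).weight (A := A) d

theorem ruleSet_node (r : G.R) (ds : ∀ o, G.Deriv (G.child r o)) :
    ruleSet L a (.node r ds) =
      ruleOp G L a r fun i => ruleSet L a (ds ((G.rhs r).occEquiv i)) := rfl

/-- The rules in the weight of a tree are closed under passing from nonterminals on right-hand
sides to left-hand sides. -/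
theorem child_mem_of_mem_ruleSet {A : G.N} (d : G.Deriv A) :
    ∀ p ∈ ruleSet L a d, ∀ o, p.child o ∈ Rule.lhs '' ruleSet L a d := by
  induction d with
  | node r ds ih =>
    intro p hp o
    rw [ruleSet_node] at hp ⊢
    have hsub : ∀ i, ruleSet L a (ds ((G.rhs r).occEquiv i)) ⊆
        ruleOp G L a r fun i => ruleSet L a (ds ((G.rhs r).occEquiv i)) :=
      fun i q hq => (mem_ruleOp ..).2 ⟨((mem_ruleOp ..).1 hp).1, Or.inl ⟨i, hq⟩⟩
    rcases ((mem_ruleOp ..).1 hp).2 with ⟨i, hi⟩ | ⟨an, mem, rfl, h⟩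
    · exact Set.image_mono (hsub i) (ih _ p hi o)
    · obtain ⟨i, rfl⟩ := (G.rhs r).occEquiv.surjective o
      exact Set.image_mono (hsub i) (h i)

theorem mem_ruleSet_node (r : G.R) (ds : ∀ o, G.Deriv (G.child r o))
    (an : ∀ o, L.FactorsAt ⟨_, a⟩ (G.sort (G.child r o)))
    (mem : (⟨_, (G.rhs r).eval L fun o => (an o).1⟩ : L.Obj) ∈ L.factors ⟨_, a⟩)
    (h : ∀ o, (⟨G.child r o, an o⟩ : NT G L a) ∈ Rule.lhs '' ruleSet L a (ds o)) :
    ⟨r, an, mem⟩ ∈ ruleSet L a (.node r ds) := by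
  rw [ruleSet_node, mem_ruleOp]
  exact ⟨fun i => (Set.Nonempty.of_image ⟨_, h _⟩).ne_empty, Or.inr ⟨an, mem, rfl, fun i => h _⟩⟩

theorem ruleSet_child_subset (r : G.R) (ds : ∀ o, G.Deriv (G.child r o)) (o : (G.rhs r).Occ)
    (h : ∀ o, (ruleSet L a (ds o)).Nonempty) :
    ruleSet L a (ds o) ⊆ ruleSet L a (.node r ds) := by
  intro p hp
  rw [ruleSet_node, mem_ruleOp]
  obtain ⟨i, rfl⟩ := (G.rhs r).occEquiv.surjective o
  exact ⟨fun i => (h _).ne_empty, Or.inl ⟨i, hp⟩⟩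

/-- The factors to which the direct subtrees evaluate. -/
theorem exists_child_factors (r : G.R) (ds : ∀ o, G.Deriv (G.child r o))
    (b : L.FactorsAt ⟨_, a⟩ (G.sort (G.lhs r))) (hb : (RTG.Deriv.node r ds).value L = b.1) :
    ∃ (an : ∀ o, L.FactorsAt ⟨_, a⟩ (G.sort (G.child r o)))
      (mem : (⟨_, (G.rhs r).eval L fun o => (an o).1⟩ : L.Obj) ∈ L.factors ⟨_, a⟩),
      (∀ o, (ds o).value L = (an o).1) ∧
        b = ⟨(G.rhs r).eval L fun o => (an o).1, mem⟩ := by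
  have hf : ∀ o, (ds o).obj L ∈ L.factors ⟨_, a⟩ := by
    intro o
    refine Relation.ReflTransGen.trans (RTG.Deriv.obj_child_mem_factors L r ds o) ?_
    rw [RTG.Deriv.obj, hb]
    exact b.2
  rw [RTG.Deriv.value_node] at hb
  obtain ⟨b, hbf⟩ := b
  obtain rfl := hb
  exact ⟨fun o => ⟨(ds o).value L, hf o⟩, hbf, fun _ => rfl, rfl⟩

/-- The weight of a tree with value `b` contains the rule at its root, annotated with the values
of its subtrees. -/
theorem lhs_mem_ruleSet {A : G.N} (d : G.Deriv A) (b : L.FactorsAt ⟨_, a⟩ (G.sort A))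
    (hb : d.value L = b.1) : (⟨A, b⟩ : NT G L a) ∈ Rule.lhs '' ruleSet L a d := by
  induction d with
  | node r ds ih =>
    obtain ⟨an, mem, han, rfl⟩ := exists_child_factors r ds b hb
    exact ⟨⟨r, an, mem⟩, mem_ruleSet_node r ds an mem fun o => ih o _ (han o), rfl⟩

/-! ### Syntax trees of the intersection grammar -/

variable {hL : L.FinitelyDecomposable} {V : Set (Rule G L a)}

/-- The occurrences of nonterminals in the right-hand side of a rule of the intersection grammar
correspond to those in the underlying rule of `G`. -/
theorem exists_occ_grammar (p : V) :
    ∃ (f : (G.rhs p.1.r).Occ ≃ ((grammar G hL V).rhs p).Occ)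
      (hc : G.rank p.1.r = (grammar G hL V).rank p),
      (∀ o, (grammar G hL V).child p (f o) = p.1.child o) ∧
      ∀ i, ((grammar G hL V).rhs p).occEquiv (Fin.cast hc i) = f ((G.rhs p.1.r).occEquiv i) :=
  Term.exists_annotate_occ (F := fun A => L.FactorsAt ⟨_, a⟩ (G.sort A)) (G.rhs p.1.r) p.1.an

theorem rank_grammar (p : V) : G.rank p.1.r = (grammar G hL V).rank p :=
  (exists_occ_grammar p).choose_spec.choose

/-- The tree over the rules of `G` that belongs to a tree of the intersection grammar. -/
def mapTree {B : (grammar G hL V).N} (e : (grammar G hL V).Deriv B) : RTree G.rank :=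
  RTree.map (rk := (grammar G hL V).rank) (fun p : V => p.1.r) rank_grammar e.toTree

theorem mapTree_node (p : V) (ds : ∀ o, (grammar G hL V).Deriv ((grammar G hL V).child p o))
    (f : (G.rhs p.1.r).Occ ≃ ((grammar G hL V).rhs p).Occ)
    (hf : ∀ i, ((grammar G hL V).rhs p).occEquiv (Fin.cast (rank_grammar p) i) =
      f ((G.rhs p.1.r).occEquiv i)) :
    mapTree (.node (G := grammar G hL V) p ds) =
      ⟨p.1.r, fun i => mapTree (ds (f ((G.rhs p.1.r).occEquiv i)))⟩ := by
  have h : mapTree (.node (G := grammar G hL V) p ds) =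
    ⟨p.1.r, fun i => mapTree (ds (((grammar G hL V).rhs p).occEquiv
      (Fin.cast (rank_grammar p) i)))⟩ := rfl
  rw [h]
  congr 1
  funext i
  rw [hf i]

theorem value_grammar {B : (grammar G hL V).N} (e : (grammar G hL V).Deriv B) :
    e.value L = B.2.1 := by
  induction e with
  | node p ds ih =>
    rw [RTG.Deriv.value_node]
    have h : (fun o => (ds o).value L) = fun o => ((grammar G hL V).child p o).2.1 := funext ih
    rw [h]
    exact Term.eval_annotate L (G.rhs p.1.r) p.1.an
      (F := fun A => L.FactorsAt ⟨_, a⟩ (G.sort A)) fun A b => b.1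

/-- The direct subtrees of a tree of the intersection grammar satisfy a property of trees and
nonterminals if they do so at the corresponding nonterminals. -/
theorem forall_child_grammar {P : NT G L a → Prop} {p : V} {f : (G.rhs p.1.r).Occ ≃
    ((grammar G hL V).rhs p).Occ} (hf : ∀ o, (grammar G hL V).child p (f o) = p.1.child o)
    (o : (G.rhs p.1.r).Occ) : P ((grammar G hL V).child p (f o)) ↔ P (p.1.child o) := by
  rw [hf]

/-- Each tree of the intersection grammar comes from a syntax tree of `G` whose value is the second
component of the nonterminal. -/
theorem exists_toTree_eq_mapTree {B : (grammar G hL V).N} (e : (grammar G hL V).Deriv B) :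
    ∃ d : G.Deriv B.1, d.value L = B.2.1 ∧ d.toTree = mapTree e := by
  induction e with
  | node p ds ih =>
    obtain ⟨f, hc, hf, hf'⟩ := exists_occ_grammar (hL := hL) p
    have key : ∀ o, ∃ d : G.Deriv (G.child p.1.r o), d.value L = (p.1.an o).1 ∧
        d.toTree = mapTree (ds (f o)) := fun o =>
      (forall_child_grammar hf o (P := fun B => ∃ d : G.Deriv B.1, d.value L = B.2.1 ∧
        d.toTree = mapTree (ds (f o)))).1 (ih (f o))
    choose ds' hv ht using key
    refine ⟨.node p.1.r ds', ?_, ?_⟩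
    · exact (RTG.Deriv.value_node L p.1.r ds').trans
        (congrArg ((G.rhs p.1.r).eval L) (funext hv))
    · rw [mapTree_node p ds f hf']
      exact congrArg (WType.mk p.1.r) (funext fun i => ht _)

/-- The factors in the rules of a tree of the intersection grammar are determined by the
subtrees. -/
theorem toTree_eq_of_mapTree_eq {B : (grammar G hL V).N} (e : (grammar G hL V).Deriv B) :
    ∀ {B' : (grammar G hL V).N} (e' : (grammar G hL V).Deriv B'), mapTree e = mapTree e' →
      e.toTree = e'.toTree := by
  induction e with
  | node p ds ih =>
    intro B' e' h
    cases e' with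
    | node p' ds' =>
      obtain ⟨⟨r, an, mem⟩, hp⟩ := p
      obtain ⟨⟨r', an', mem'⟩, hp'⟩ := p'
      obtain ⟨f, hc, hf, hf'⟩ := exists_occ_grammar (hL := hL) (⟨⟨r, an, mem⟩, hp⟩ : V)
      obtain ⟨g, _, hg, hg'⟩ := exists_occ_grammar (hL := hL) (⟨⟨r', an', mem'⟩, hp'⟩ : V)
      rw [mapTree_node _ ds f hf', mapTree_node _ ds' g hg', WType.mk.injEq] at h
      obtain ⟨hr, h⟩ := h
      change r = r' at hr
      subst hr
      have h := congrFun (eq_of_heq h)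
      have han : an = an' := by
        funext o
        obtain ⟨i, rfl⟩ := (G.rhs r).occEquiv.surjective o
        have h1 := (forall_child_grammar hf _ (P := fun B => ∃ d : G.Deriv B.1,
          d.value L = B.2.1 ∧ d.toTree = mapTree (ds (f ((G.rhs r).occEquiv i))))).1
          (exists_toTree_eq_mapTree _)
        have h2 := (forall_child_grammar hg _ (P := fun B => ∃ d : G.Deriv B.1,
          d.value L = B.2.1 ∧ d.toTree = mapTree (ds' (g ((G.rhs r).occEquiv i))))).1
          (exists_toTree_eq_mapTree _)
        obtain ⟨d1, hv1, ht1⟩ := h1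
        obtain ⟨d2, hv2, ht2⟩ := h2
        have h3 : d1 = d2 := RTG.Deriv.toTree_injective _ (ht1.trans ((h i).trans ht2.symm))
        exact Subtype.ext (hv1.symm.trans ((congrArg _ h3).trans hv2))
      subst han
      simp only [RTG.Deriv.toTree]
      congr 1
      funext i
      refine ih _ _ ?_
      have h1 := h (Fin.cast hc.symm i)
      rw [← hf', ← hg'] at h1
      exact h1

/-- A syntax tree of `G` whose weight is included in `V` is a tree of the intersection grammar. -/
theorem exists_mapTree_eq {A : G.N} (d : G.Deriv A) (b : L.FactorsAt ⟨_, a⟩ (G.sort A))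
    (hb : d.value L = b.1) (hV : ruleSet L a d ⊆ V) :
    ∃ e : (grammar G hL V).Deriv (⟨A, b⟩ : NT G L a), mapTree e = d.toTree := by
  induction d with
  | node r ds ih =>
    obtain ⟨an, mem, han, rfl⟩ := exists_child_factors r ds b hb
    have hlhs := fun o => lhs_mem_ruleSet (ds o) (an o) (han o)
    let p : V := ⟨⟨r, an, mem⟩, hV (mem_ruleSet_node r ds an mem hlhs)⟩
    obtain ⟨f, hc, hf, hf'⟩ := exists_occ_grammar (hL := hL) p
    have key : ∀ o, ∃ e : (grammar G hL V).Deriv ((grammar G hL V).child p (f o)),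
        mapTree e = (ds o).toTree := fun o =>
      (forall_child_grammar hf o (P := fun B => ∃ e : (grammar G hL V).Deriv B,
        mapTree e = (ds o).toTree)).2 (ih o (an o) (han o) ((ruleSet_child_subset r ds o fun o =>
          Set.Nonempty.of_image ⟨_, hlhs o⟩).trans hV))
    choose es hes using key
    refine ⟨RTG.Deriv.node (G := grammar G hL V) p (Equiv.piCongrLeft
      (fun o => (grammar G hL V).Deriv ((grammar G hL V).child p o)) f es), ?_⟩
    refine (mapTree_node p _ f hf').trans ?_
    rw [RTG.Deriv.toTree]
    congr 1
    funext i
    rw [Equiv.piCongrLeft_apply_apply]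
    exact hes _

/-- The output is the union of the weights of all syntax trees of `a`. -/
theorem exists_parserOutputs (L : SortedAlgebra.{u, u} Γ) (hL : L.FinitelyDecomposable)
    (G : RTG Γ) (a : L.carrier (G.sort G.start)) :
    ∃ V : Set (Rule G L a), (lm G L a).ParserOutputs a V ∧
      IsIntersection L G a (grammar G hL V) Sigma.fst ∧
      ∀ p ∈ V, ∀ o, p.child o ∈ Rule.lhs '' V := by
  have hsurj : ∀ d : G.Deriv G.start, d.value L = a →
      ∃ e : (grammar G hL (⋃ d : {d : G.Deriv G.start // d.value L = a},
        ruleSet L a d.1)).Deriv (⟨G.start, a, .refl⟩ : NT G L a), mapTree e = d.toTree :=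
    fun d hd => exists_mapTree_eq d ⟨a, .refl⟩ hd
      (Set.subset_iUnion (fun d : {d : G.Deriv G.start // d.value L = a} => ruleSet L a d.1)
        ⟨d, hd⟩)
  refine ⟨⋃ d : {d : G.Deriv G.start // d.value L = a}, ruleSet L a d.1,
    applicable (LM := lm G L a) G L a hL hL a, ?_, ?_⟩
  · refine ⟨rfl, fun _ => rfl, fun p => p.1.r, rank_grammar, fun p => ⟨rfl, heq_of_eq ?_⟩, ?_, ?_⟩
    · exact (Term.relabel_annotate (F := fun A => L.FactorsAt ⟨_, a⟩ (G.sort A)) (G.rhs p.1.r)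
        p.1.an fun _ => rfl).symm
    · ext x
      constructor
      · rintro ⟨e, rfl⟩
        have he : e.value L = a := value_grammar e
        obtain ⟨d, hd, -⟩ := exists_toTree_eq_mapTree e
        exact ⟨⟨d, congrArg (Sigma.mk (G.sort G.start)) (hd.trans he.symm)⟩,
          congrArg (Sigma.mk (G.sort G.start)) he⟩
      · rintro ⟨⟨d, rfl⟩, hd⟩
        have hd : d.value L = a := eq_of_heq (Sigma.mk.inj hd).2
        obtain ⟨e, -⟩ := hsurj d hd
        exact ⟨e, congrArg (Sigma.mk (G.sort G.start)) ((value_grammar e).trans hd.symm)⟩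
    · refine ⟨?_, ?_, ?_⟩
      · rintro _ ⟨e, rfl⟩
        obtain ⟨d, hd, ht⟩ := exists_toTree_eq_mapTree e
        exact ⟨d, hd, ht⟩
      · rintro _ ⟨e, rfl⟩ _ ⟨e', rfl⟩ h
        exact toTree_eq_of_mapTree_eq e e' h
      · rintro _ ⟨d, hd, rfl⟩
        obtain ⟨e, he⟩ := hsurj d hd
        exact ⟨_, ⟨e, rfl⟩, he⟩
  · intro p hp o
    obtain ⟨d, hd⟩ := Set.mem_iUnion.1 hp
    exact Set.image_mono (Set.subset_iUnion (fun d : {d : G.Deriv G.start // d.value L = a} =>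
      ruleSet L a d.1) d) (child_mem_of_mem_ruleSet d.1 p hd o)

end Intersection

/-! ### Yield algebras -/

/-- The factors of a word are sublists of it, at the sort of the word itself or at an argument sort
of a symbol. -/
theorem yieldAlg_finitelyDecomposable {S : Type u} (Δ : Signature S) [Finite Δ.Op] :
    (yieldAlg Δ).FinitelyDecomposable := by
  intro a
  let W := List {σ : Δ.Op // Δ.ar σ = 0}
  have key : ∀ b ∈ (yieldAlg Δ).factors a, b = a ∨
      b ∈ (fun q : (Σ σ : Δ.Op, Fin (Δ.ar σ)) × W =>
        (⟨Δ.dom q.1.1 q.1.2, q.2⟩ : (yieldAlg Δ).Obj)) ''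
          (Set.univ ×ˢ {l : W | l.Sublist (a.2 : W)}) := by
    intro b hb
    have h : (b.2 : W).Sublist (a.2 : W) ∧ (b = a ∨ ∃ σ i, b.1 = Δ.dom σ i) := by
      induction hb using Relation.ReflTransGen.head_induction_on with
      | refl => exact ⟨List.Sublist.refl _, Or.inl rfl⟩
      | head h _ ih =>
        obtain ⟨σ, x, i, rfl, rfl⟩ := h
        refine ⟨List.Sublist.trans ?_ ih.1, Or.inr ⟨σ, i, rfl⟩⟩
        have h0 : Δ.ar σ ≠ 0 := fun h0 => (Fin.cast h0 i).elim0
        have h1 : (yieldAlg Δ).interp σ x = (List.ofFn x).flatten := dif_neg h0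
        change (x i : W).Sublist ((yieldAlg Δ).interp σ x)
        rw [h1]
        exact List.sublist_flatten_of_mem (List.mem_ofFn.2 ⟨i, rfl⟩)
    rcases h with ⟨h1, h2 | ⟨σ, i, h2⟩⟩
    · exact Or.inl h2
    · obtain ⟨s, l⟩ := b
      obtain rfl := h2
      exact Or.inr ⟨(⟨σ, i⟩, l), ⟨trivial, h1⟩, rfl⟩
  have hfin : {l : W | l.Sublist (a.2 : W)}.Finite :=
    (List.finite_toSet (List.sublists (a.2 : W))).subset fun l hl => List.mem_sublists.2 hl
  exact ((Set.finite_singleton a).union ((Set.finite_univ.prod hfin).image _)).subset key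

/-! ### Algebraic dynamic programming -/

namespace ADP

variable {Γ : Signature Srt.{u}} {K : SortedAlgebra.{u, v} Γ} {h : ObjectiveFunction K}

theorem ObjectiveFunction.idem (s : Srt) (F : Set (K.carrier s)) : h.h s (h.h s F) = h.h s F := by
  have := h.iUnion (I := Unit) s fun _ => F
  simpa only [Set.iUnion_const] using this.symm

theorem ObjectiveFunction.onObj_union (T T' : Set K.Obj) :
    h.onObj (T ∪ T') = h.onObj (h.onObj T ∪ h.onObj T') := by
  have := h.onObj_iUnion (I := Bool) fun b => if b then T else T'
  rw [Set.union_eq_iUnion, Set.union_eq_iUnion]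
  refine Eq.trans ?_ (this.trans ?_)
  · congr 1
    refine Set.iUnion_congr ?_
    rintro (_ | _) <;> rfl
  · congr 1
    refine Set.iUnion_congr ?_
    rintro (_ | _) <;> rfl

theorem ObjectiveFunction.onObj_image (s : Srt) (F : Set (K.carrier s)) :
    h.onObj (Sigma.mk s '' F) = Sigma.mk s '' h.h s F := by
  ext ⟨s', y⟩
  constructor
  · intro hy
    obtain ⟨z, -, hz⟩ := h.onObj_subset _ hy
    obtain rfl : s = s' := (Sigma.mk.inj hz).1
    have h1 : {x | (⟨s, x⟩ : K.Obj) ∈ Sigma.mk s '' F} = F := by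
      ext x
      exact sigma_mk_injective.mem_set_image
    have h2 : y ∈ h.h s {x | (⟨s, x⟩ : K.Obj) ∈ Sigma.mk s '' F} := hy
    rw [h1] at h2
    exact ⟨y, h2, rfl⟩
  · rintro ⟨z, hz, hzy⟩
    rw [← hzy]
    have h1 : {x | (⟨s, x⟩ : K.Obj) ∈ Sigma.mk s '' F} = F := by
      ext x
      exact sigma_mk_injective.mem_set_image
    change z ∈ h.h s {x | (⟨s, x⟩ : K.Obj) ∈ Sigma.mk s '' F}
    rwa [h1]

theorem ObjectiveFunction.onObj_singleton (y : K.Obj) : h.onObj {y} = {y} := by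
  apply (h.onObj_subset _).antisymm
  obtain ⟨z, hz, -⟩ := h.onObj_nonempty (Set.mem_singleton y)
  have h1 : z = y := h.onObj_subset ({y} : Set K.Obj) hz
  rw [h1] at hz
  exact Set.singleton_subset_iff.2 hz

/-- The values of a term if the values of its leaves are chosen from given sets. -/
def termImage {X : Type u} {sort : X → Srt.{u}} {s : Srt.{u}} (t : Term Γ sort s)
    (E : ∀ o : t.Occ, Set (K.carrier (sort (t.label o)))) : Set (K.carrier s) :=
  {y | ∃ x : ∀ o, K.carrier (sort (t.label o)), (∀ o, x o ∈ E o) ∧ y = t.eval K x}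

/-- Bellman's principle for terms.  Symbols of the sort of inputs are nullary, hence trivial. -/
theorem h_termImage (hΓ : IsADPSignature Γ) (hB : h.Bellman) {X : Type u} {sort : X → Srt.{u}}
    {s : Srt.{u}} (t : Term Γ sort s) (E : ∀ o : t.Occ, Set (K.carrier (sort (t.label o)))) :
    h.h s (termImage t E) = h.h s (termImage t fun o => h.h _ (E o)) := by
  induction t with
  | var x =>
    have h1 : ∀ E : ∀ _ : Unit, Set (K.carrier (sort x)),
        termImage (Term.var (Γ := Γ) (sort := sort) x) E = E () := by
      intro E
      ext y
      constructor
      · rintro ⟨z, hz, rfl⟩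
        exact hz ()
      · exact fun hy => ⟨fun _ => y, fun _ => hy, rfl⟩
    exact (congrArg _ (h1 E)).trans ((h.idem _ _).symm.trans
      (congrArg (h.h _) (h1 fun o => h.h _ (E o))).symm)
  | op σ ts ih =>
    have h1 : ∀ E : ∀ o : (Term.op σ ts).Occ, Set (K.carrier (sort ((Term.op σ ts).label o))),
        termImage (Term.op σ ts) E = imageOp σ fun i => termImage (ts i) fun o => E ⟨i, o⟩ := by
      intro E
      ext y
      constructor
      · rintro ⟨z, hz, rfl⟩
        exact ⟨_, fun i => ⟨fun o => z ⟨i, o⟩, fun o => hz _, rfl⟩, rfl⟩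
      · rintro ⟨z, hz, rfl⟩
        choose w hw hw' using hz
        exact ⟨fun o => w o.1 o.2, fun o => hw o.1 o.2,
          congrArg (K.interp σ) (funext hw')⟩
    rcases Nat.eq_zero_or_pos (Γ.ar σ) with h0 | hpos
    · congr 2
      funext o
      exact (Fin.cast h0 o.1).elim0
    · have hcod : Γ.cod σ = .answer := by
        cases hc : Γ.cod σ
        · rfl
        · exact absurd ((hΓ σ).2 hc) hpos.ne'
      refine (congrArg (h.h _) (h1 E)).trans ((hB σ hcod hpos.ne' _).trans (Eq.trans ?_
        ((hB σ hcod hpos.ne' _).symm.trans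
          (congrArg (h.h _) (h1 fun o => h.h _ (E o))).symm)))
      exact congrArg (h.h _) (congrArg (imageOp σ) (funext fun i => ih i _))

/-- The operation of a linear term as an image of sets at the occurrences of its variables. -/
theorem TermOp.image_eq (t : TermOp Γ) (F : Fin t.k → Set K.Obj)
    (hF : ∀ i, ∃ x, (⟨t.srt i, x⟩ : K.Obj) ∈ F i) :
    t.image F = Sigma.mk t.cod ''
      termImage t.t fun o =>
        {x | (⟨t.srt (t.t.label o).down, x⟩ : K.Obj) ∈ F (t.t.label o).down} := by
  classical
  ext y
  constructor
  · rintro ⟨x, hx, rfl⟩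
    exact ⟨_, ⟨fun o => x (t.t.label o).down, fun o => hx _, rfl⟩, rfl⟩
  · rintro ⟨_, ⟨x, hx, rfl⟩, rfl⟩
    -- Since no variable occurs twice, the values at the occurrences extend to an assignment.
    choose z hz using hF
    have key : ∀ i, ∃ y, (⟨t.srt i, y⟩ : K.Obj) ∈ F i ∧
        ∀ o, (hi : (t.t.label o).down = i) → hi ▸ x o = y := by
      intro i
      by_cases hi : ∃ o, (t.t.label o).down = i
      · obtain ⟨o, rfl⟩ := hi
        refine ⟨x o, hx o, fun o' ho' => ?_⟩
        obtain rfl : o' = o := t.linear (ULift.down_injective ho')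
        rfl
      · exact ⟨z i, hz i, fun o ho => absurd ⟨o, ho⟩ hi⟩
    choose y hy hyx using key
    refine ⟨y, hy, ?_⟩
    congr 2
    funext o
    exact hyx _ o rfl

/-- The optimal values of a term depend only on the optimal members of the argument sets. -/
theorem TermOp.onObj_image_congr (hΓ : IsADPSignature Γ) (hB : h.Bellman) (t : TermOp Γ)
    (F F' : Fin t.k → Set K.Obj) (hF : ∀ i, ∃ x, (⟨t.srt i, x⟩ : K.Obj) ∈ F i)
    (hF' : ∀ i, ∃ x, (⟨t.srt i, x⟩ : K.Obj) ∈ F' i)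
    (he : ∀ i, h.h _ {x | (⟨t.srt i, x⟩ : K.Obj) ∈ F i} =
      h.h _ {x | (⟨t.srt i, x⟩ : K.Obj) ∈ F' i}) :
    h.onObj (t.image F) = h.onObj (t.image F') := by
  rw [t.image_eq F hF, t.image_eq F' hF', h.onObj_image, h.onObj_image, h_termImage hΓ hB,
    h_termImage hΓ hB t.t fun o => {x | (⟨t.srt (t.t.label o).down, x⟩ : K.Obj) ∈
      F' (t.t.label o).down}]
  simp only [he]

/-- The element is a set of elements of the sort `s`. -/
def Carrier.OfSort (s : Srt.{u}) (x : Carrier h) : Prop := x ≠ bot ∧ ∀ y ∈ x.elems, y.1 = s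

namespace Carrier

/-- The empty set. -/
abbrev emp : Carrier h := mk ∅ homogeneous_empty

theorem elems_nonempty {x : Carrier h} (hb : x ≠ bot) (he : x ≠ emp) : x.elems.Nonempty := by
  rw [Set.nonempty_iff_ne_empty]
  intro h0
  apply he
  rw [← mk_elems x hb]
  exact mk_congr (congrArg _ h0)

theorem add_eq {x y : Carrier h} (H : (x ≠ bot ∧ y ≠ bot) ∧ Homogeneous (x.elems ∪ y.elems)) :
    add x y = mk _ H.2 := dif_pos H

theorem add_eq_bot {x y : Carrier h}
    (H : ¬ ((x ≠ bot ∧ y ≠ bot) ∧ Homogeneous (x.elems ∪ y.elems))) : add x y = bot := dif_neg H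

theorem add_ne_emp {x y : Carrier h} (hx : x ≠ emp) : add x y ≠ emp := by
  by_cases H : (x ≠ bot ∧ y ≠ bot) ∧ Homogeneous (x.elems ∪ y.elems)
  · intro he
    obtain ⟨z, hz⟩ := elems_nonempty H.1.1 hx
    obtain ⟨z', hz', -⟩ := h.onObj_nonempty (show z ∈ x.elems ∪ y.elems from Or.inl hz)
    have h1 : z' ∈ (add x y).elems := by rwa [add_eq H]
    rw [he, elems_mk, h.onObj_empty] at h1
    exact h1
  · rw [add_eq_bot H]
    exact (mk_ne_bot _ _).symm

theorem ofSort_add {s : Srt.{u}} {x y : Carrier h} (hx : x ≠ emp) :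
    (add x y).OfSort s ↔ x.OfSort s ∧ y.OfSort s := by
  constructor
  · rintro ⟨h1, h2⟩
    have H : (x ≠ bot ∧ y ≠ bot) ∧ Homogeneous (x.elems ∪ y.elems) := by
      by_contra H
      exact h1 (add_eq_bot H)
    rw [add_eq H, elems_mk] at h2
    obtain ⟨s', hs'⟩ := H.2
    obtain ⟨z, hz⟩ := elems_nonempty H.1.1 hx
    obtain ⟨z', hz', -⟩ := h.onObj_nonempty (show z ∈ x.elems ∪ y.elems from Or.inl hz)
    have hs : s' = s := (hs' z' (h.onObj_subset _ hz')).symm.trans (h2 z' hz')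
    subst hs
    exact ⟨⟨H.1.1, fun w hw => hs' w (Or.inl hw)⟩, ⟨H.1.2, fun w hw => hs' w (Or.inr hw)⟩⟩
  · rintro ⟨h1, h2⟩
    have hs : ∀ w ∈ x.elems ∪ y.elems, w.1 = s := by
      rintro w (hw | hw)
      · exact h1.2 w hw
      · exact h2.2 w hw
    have H : (x ≠ bot ∧ y ≠ bot) ∧ Homogeneous (x.elems ∪ y.elems) := ⟨⟨h1.1, h2.1⟩, s, hs⟩
    rw [add_eq H]
    exact ⟨mk_ne_bot _ _, fun w hw => hs w (h.onObj_subset _ hw)⟩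

theorem bot_add (y : Carrier h) : add bot y = bot := add_eq_bot fun H => H.1.1 rfl

theorem add_bot (x : Carrier h) : add x bot = bot := add_eq_bot fun H => H.1.2 rfl

theorem add_emp (x : Carrier h) : add x emp = x := (sumOp.{u} h).add_zero' x

theorem emp_add (x : Carrier h) : add emp x = x := ((sumOp.{u} h).add_comm' _ _).trans (add_emp x)

end Carrier

open Carrier

theorem termOp_emp (t : TermOp Γ) (F : Fin t.k → Carrier h) (i : Fin t.k) (hi : F i = emp) :
    termOp t F = emp := if_pos ⟨i, hi⟩

theorem termOp_ofSort (t : TermOp Γ) (F : Fin t.k → Carrier h) (h1 : ∀ i, F i ≠ emp)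
    (h2 : ∀ i, (F i).OfSort (t.srt i)) :
    termOp t F = mk (t.image fun i => (F i).elems) (t.homogeneous_image _) := by
  have h1' : ¬ ∃ i, F i = emp := fun ⟨i, hi⟩ => h1 i hi
  exact (if_neg h1').trans (if_pos h2)

theorem termOp_bot (t : TermOp Γ) (F : Fin t.k → Carrier h) (h1 : ∀ i, F i ≠ emp) (i : Fin t.k)
    (h2 : ¬ (F i).OfSort (t.srt i)) : termOp t F = bot := by
  have h1' : ¬ ∃ i, F i = emp := fun ⟨i, hi⟩ => h1 i hi
  exact (if_neg h1').trans (if_neg fun h3 => h2 (h3 i))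

theorem TermOp.image_update_union (t : TermOp Γ) (E : Fin t.k → Set K.Obj) (i : Fin t.k)
    (A B : Set K.Obj) : t.image (Function.update E i (A ∪ B)) =
      t.image (Function.update E i A) ∪ t.image (Function.update E i B) := by
  have key : ∀ (C : Set K.Obj) (x : ∀ j, K.carrier (t.srt j)),
      (∀ j, (⟨t.srt j, x j⟩ : K.Obj) ∈ Function.update E i C j) ↔
        (⟨t.srt i, x i⟩ : K.Obj) ∈ C ∧ ∀ j, j ≠ i → (⟨t.srt j, x j⟩ : K.Obj) ∈ E j := by
    intro C x
    refine ⟨fun hx => ⟨by simpa using hx i, fun j hj => by simpa [hj] using hx j⟩, ?_⟩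
    rintro ⟨h1, h2⟩ j
    rcases eq_or_ne j i with rfl | hj
    · simpa using h1
    · simpa [hj] using h2 j hj
  ext y
  simp only [TermOp.image, key, Set.mem_union, Set.mem_ofPred_eq]
  constructor
  · rintro ⟨x, ⟨hx | hx, hx'⟩, rfl⟩
    · exact Or.inl ⟨x, ⟨hx, hx'⟩, rfl⟩
    · exact Or.inr ⟨x, ⟨hx, hx'⟩, rfl⟩
  · rintro (⟨x, ⟨hx, hx'⟩, rfl⟩ | ⟨x, ⟨hx, hx'⟩, rfl⟩)
    · exact ⟨x, ⟨Or.inl hx, hx'⟩, rfl⟩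
    · exact ⟨x, ⟨Or.inr hx, hx'⟩, rfl⟩

theorem Carrier.OfSort.exists_mem {s : Srt.{u}} {x : Carrier h} (hs : x.OfSort s)
    (he : x ≠ emp) : ∃ y, (⟨s, y⟩ : K.Obj) ∈ x.elems := by
  obtain ⟨⟨s', y⟩, hy⟩ := elems_nonempty hs.1 he
  obtain rfl : s' = s := hs.2 _ hy
  exact ⟨y, hy⟩

/-- Bellman's principle makes the operations of the ADP M-monoid additive. -/
theorem termOp_add (hΓ : IsADPSignature Γ) (hB : h.Bellman) (t : TermOp Γ)
    (F : Fin t.k → Carrier h) (i : Fin t.k) (x y : Carrier h) :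
    termOp t (Function.update F i (add x y)) =
      add (termOp t (Function.update F i x)) (termOp t (Function.update F i y)) := by
  by_cases hz : ∃ j, j ≠ i ∧ F j = emp
  · obtain ⟨j, hj, hFj⟩ := hz
    have h1 : ∀ z, termOp t (Function.update F i z) = emp := fun z =>
      termOp_emp t _ j (by rw [Function.update_of_ne hj, hFj])
    rw [h1, h1, h1, add_emp]
  have h0 : termOp t (Function.update F i emp) = emp := termOp_emp t _ i (Function.update_self ..)
  by_cases hx : x = emp
  · rw [hx, emp_add, h0, emp_add]
  by_cases hy : y = emp
  · rw [hy, add_emp, h0, add_emp]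
  have hne : ∀ z, z ≠ emp → ∀ j, Function.update F i z j ≠ emp := by
    intro z hz' j hj
    rcases eq_or_ne j i with rfl | hji
    · rw [Function.update_self] at hj
      exact hz' hj
    · rw [Function.update_of_ne hji] at hj
      exact hz ⟨j, hji, hj⟩
  have hxy : add x y ≠ emp := add_ne_emp hx
  by_cases hok : ∀ j, j ≠ i → (F j).OfSort (t.srt j)
  · have hbot : ∀ z, z ≠ emp → ¬ z.OfSort (t.srt i) →
        termOp t (Function.update F i z) = bot := fun z hz hs =>
      termOp_bot t _ (hne z hz) i (by rwa [Function.update_self])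
    have hall : ∀ z, z.OfSort (t.srt i) → ∀ j, (Function.update F i z j).OfSort (t.srt j) := by
      intro z hs j
      rcases eq_or_ne j i with rfl | hji
      · rwa [Function.update_self]
      · rw [Function.update_of_ne hji]
        exact hok j hji
    by_cases hxs : x.OfSort (t.srt i)
    · by_cases hys : y.OfSort (t.srt i)
      · have hxys := (ofSort_add (y := y) hx).2 ⟨hxs, hys⟩
        have hT : ∀ z : Carrier h, (fun j => (Function.update F i z j).elems) =
            Function.update (fun j => (F j).elems) i z.elems := fun z =>
          funext fun j => Function.apply_update (fun _ => Carrier.elems) F i z j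
        have hxye : (add x y).elems = h.onObj (x.elems ∪ y.elems) := by
          rw [add_eq ⟨⟨hxs.1, hys.1⟩, t.srt i, fun w hw => hw.elim (hxs.2 w) (hys.2 w)⟩, elems_mk]
        rw [termOp_ofSort t _ (hne _ hxy) (hall _ hxys), termOp_ofSort t _ (hne _ hx) (hall _ hxs),
          termOp_ofSort t _ (hne _ hy) (hall _ hys), add_eq ⟨⟨mk_ne_bot _ _, mk_ne_bot _ _⟩, t.cod,
            by
              rintro _ (hw | hw)
              · obtain ⟨_, -, rfl⟩ := h.onObj_subset _ hw
                rfl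
              · obtain ⟨_, -, rfl⟩ := h.onObj_subset _ hw
                rfl⟩]
        apply mk_congr
        rw [elems_mk, elems_mk, ← h.onObj_union]
        simp only [hT]
        rw [← t.image_update_union]
        have hex : ∀ T : Set K.Obj, (∃ z, (⟨t.srt i, z⟩ : K.Obj) ∈ T) →
            ∀ j, ∃ z, (⟨t.srt j, z⟩ : K.Obj) ∈ Function.update (fun j => (F j).elems) i T j := by
          intro T hT' j
          rcases eq_or_ne j i with rfl | hji
          · rwa [Function.update_self]
          · rw [Function.update_of_ne hji]
            exact (hok j hji).exists_mem fun he => hz ⟨j, hji, he⟩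
        refine t.onObj_image_congr hΓ hB _ _ (hex _ (hxys.exists_mem hxy))
          (hex _ ((hxs.exists_mem hx).imp fun _ => Or.inl)) fun j => ?_
        rcases eq_or_ne j i with rfl | hji
        · rw [Function.update_self, Function.update_self, hxye]
          exact h.idem (t.srt j) {x' | (⟨t.srt j, x'⟩ : K.Obj) ∈ x.elems ∪ y.elems}
        · rw [Function.update_of_ne hji, Function.update_of_ne hji]
      · rw [hbot y hy hys, add_bot]
        exact hbot _ hxy fun hs => hys ((ofSort_add hx).1 hs).2
    · rw [hbot x hx hxs, bot_add]
      exact hbot _ hxy fun hs => hxs ((ofSort_add hx).1 hs).1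
  · push Not at hok
    obtain ⟨j, hj, hs⟩ := hok
    have h1 : ∀ z, z ≠ emp → termOp t (Function.update F i z) = bot := fun z hz =>
      termOp_bot t _ (hne z hz) j (by rwa [Function.update_of_ne hj])
    rw [h1 _ hxy, h1 x hx, bot_add]

theorem mmonoid_additiveOn (hΓ : IsADPSignature Γ) (hB : h.Bellman) (ω : (mmonoid h).Ω) :
    AdditiveOn (K := (mmonoid h).K) ⊤ ((mmonoid h).op ω) := by
  rcases ω with t | k
  · exact ⟨fun _ _ => trivial, fun F i x y _ _ _ => termOp_add hΓ hB t F i x y,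
      fun F i _ hi => termOp_emp t F i hi⟩
  · exact .const_zero (K := (mmonoid h).K) ⊤ k

end ADP

/-! ### The ADP problem -/

namespace Term

variable {S : Type u} {Γ : Signature S} {X Y : Type u} {sort : X → S} {sortY : Y → S}

theorem eval_relabel (A : SortedAlgebra.{u, v} Γ) {s : S} (t : Term Γ sort s) (g : t.Occ → Y)
    (hg : ∀ o, sortY (g o) = sort (t.label o)) (x : ∀ y, A.carrier (sortY y)) :
    ((t.relabel g hg).eval A fun o => x ((t.relabel g hg).label o)) =
      t.eval A fun o => hg o ▸ x (g o) := by
  induction t with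
  | var z =>
    have key : ∀ {s : S} (y : Y) (hy : sortY y = s),
        ((hy ▸ var (Γ := Γ) (sort := sortY) y : Term Γ sortY s).eval A fun o => x (label _ o)) =
          hy ▸ x y := by
      rintro _ y rfl
      rfl
    exact key (g ()) (hg ())
  | op σ ts ih =>
    exact congrArg (A.interp σ) (funext fun i => ih i (fun o => g ⟨i, o⟩) fun o => hg ⟨i, o⟩)

end Term

namespace ADP

open Carrier

variable {Γ : Signature Srt.{u}} {K : SortedAlgebra.{u, v} Γ} {h : ObjectiveFunction K}

/-- The element with the only member `y`. -/
def single (h : ObjectiveFunction K) (y : K.Obj) : Carrier h :=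
  mk {y} ⟨y.1, fun _ hz => congrArg Sigma.fst hz⟩

theorem elems_single (y : K.Obj) : (single h y).elems = {y} := h.onObj_singleton y

theorem single_ofSort (y : K.Obj) : (single h y).OfSort y.1 :=
  ⟨mk_ne_bot _ _, by rw [elems_single]; rintro _ rfl; rfl⟩

theorem single_ne_emp (y : K.Obj) : single h y ≠ emp := fun he => by
  have h1 := congrArg Carrier.elems he
  rw [elems_single, elems_mk, h.onObj_empty] at h1
  exact Set.singleton_ne_empty y h1

/-- The weight of a syntax tree is the value of the represented tree. -/
theorem weight_lm (G : RTG Γ) {A : G.N} (d : G.Deriv A) :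
    (lm h G).weight (A := A) d = single h ⟨G.sort A, K.evalGround d.proj⟩ := by
  induction d with
  | node r ds ih =>
    have h1 : (lm h G).weight (.node (G := G) r ds) = termOp (ruleTerm G r) fun i =>
        (lm h G).weight (ds ((G.rhs r).occEquiv i)) := rfl
    have h2 : (fun i : Fin (G.rank r) => (lm h G).weight (ds ((G.rhs r).occEquiv i))) =
        fun i => single h ⟨_, K.evalGround (ds ((G.rhs r).occEquiv i)).proj⟩ :=
      funext fun i => ih _
    refine h1.trans ((congrArg (termOp (ruleTerm G r)) h2).trans ?_)
    refine (termOp_ofSort (ruleTerm G r) _ (fun i => single_ne_emp _) fun i =>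
      single_ofSort _).trans ?_
    apply mk_congr
    congr 1
    simp only [elems_single]
    let x : ∀ i : Fin (G.rank r), K.carrier (G.sort (G.child r ((G.rhs r).occEquiv i))) :=
      fun i => K.evalGround (ds ((G.rhs r).occEquiv i)).proj
    have h3 : (ruleTerm G r).t.eval K (fun o => x ((ruleTerm G r).t.label o).down) =
        K.evalGround (RTG.Deriv.node r ds).proj := by
      refine (Term.eval_relabel K (G.rhs r) _ _ fun i : ULift (Fin (G.rank r)) => x i.down).trans ?_
      refine Eq.trans ?_ ((G.rhs r).evalGround_subst K _).symm
      congr 1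
      funext o
      have key : ∀ (o' : (G.rhs r).Occ) (_ : o' = o)
          (hs : G.sort (G.child r o') = G.sort (G.child r o)),
          hs ▸ K.evalGround (ds o').proj = K.evalGround (ds o).proj := by
        rintro _ rfl _
        rfl
      exact key _ ((G.rhs r).occEquiv.apply_symm_apply o) _
    rw [← h3]
    ext y
    constructor
    · rintro ⟨z, hz, rfl⟩
      obtain rfl : z = x := funext fun i => eq_of_heq (Sigma.mk.inj (hz i)).2
      rfl
    · intro hy
      exact ⟨x, fun i => rfl, hy⟩

/-- The output is the result of the objective function on the values of all candidates, since the
weight of each candidate is the set of its value alone. -/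
theorem exists_parserOutputs [Finite Γ.Op] (h : ObjectiveFunction K) (G : RTG Γ)
    (hΓ : IsADPSignature Γ) (hB : h.Bellman) (hG : G.Nonlooping (yieldAlg Γ))
    (w : List {σ : Γ.Op // Γ.ar σ = 0}) :
    ∃ x : Carrier h, (lm h G).ParserOutputs w x ∧
      x.1 = some (Sigma.mk (G.sort G.start) '' adp h G w) := by
  refine ⟨(lm h G).parse w, WRTGLM.applicable_of_nonlooping
    (fun r => mmonoid_additiveOn hΓ hB _) (yieldAlg_finitelyDecomposable Γ) hG w, ?_⟩
  let D := {d : G.Deriv G.start // d.value (yieldAlg Γ) = w}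
  have h1 : (lm h G).parse w = Carrier.isum fun d : D =>
      single h ⟨G.sort G.start, K.evalGround d.1.proj⟩ :=
    congrArg Carrier.isum (funext fun d : D => weight_lm G d.1)
  have h2 : ⋃ d : D, (single h ⟨G.sort G.start, K.evalGround d.1.proj⟩).elems =
      Sigma.mk (G.sort G.start) '' {y | ∃ t ∈ G.treeLanguage,
        (yieldAlg Γ).evalGround t = w ∧ y = K.evalGround t} := by
    ext y
    simp only [elems_single, Set.mem_iUnion]
    constructor
    · rintro ⟨d, rfl⟩
      exact ⟨_, ⟨d.1.proj, ⟨d.1, rfl⟩, d.2, rfl⟩, rfl⟩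
    · rintro ⟨_, ⟨_, ⟨d, rfl⟩, hd, rfl⟩, rfl⟩
      exact ⟨⟨d, hd⟩, rfl⟩
  have H : (∀ d : D, single h ⟨G.sort G.start, K.evalGround d.1.proj⟩ ≠ bot) ∧
      Homogeneous (⋃ d : D, (single h ⟨G.sort G.start, K.evalGround d.1.proj⟩).elems) := by
    refine ⟨fun d => (single_ofSort _).1, G.sort G.start, ?_⟩
    rw [h2]
    rintro _ ⟨y, -, rfl⟩
    rfl
  rw [h1, isum_eq H]
  refine congrArg some ?_
  rw [h2, h.onObj_image]
  rfl

end ADP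

end MMP

theorem mainTheorem12 :
    -- (1) nonlooping language models weighted with complete semirings
    (∀ {S : Type u} {Γ : MMP.Signature S} (L : MMP.SortedAlgebra.{u, u} Γ)
        (K : Type v) [Semiring K] [MMP.CompleteSemiring.{u, v} K]
        (LM : MMP.WRTGLM L (MMP.semiringMMonoid.{u, v} K)) (hL : L.FinitelyDecomposable),
      (LM.G.Nonlooping L → LM.Applicable) ∧
      -- the inputs whose system of instantiated rules is acyclic (semiring parsing)
      ∀ a, (LM.cnc hL a).G.Acyclic → LM.ParserOutputs a (LM.parse a)) ∧
    -- (2) superior M-monoids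
    (∀ {S : Type u} {Γ : MMP.Signature S} (L : MMP.SortedAlgebra.{u, u} Γ)
        (M : MMP.CompleteMMonoid.{u, v, w}) (LM : MMP.WRTGLM L M),
      L.FinitelyDecomposable → M.Superior → LM.Applicable) ∧
    -- (3) the best derivation M-monoid
    (∀ {S : Type u} {Γ : MMP.Signature S} (L : MMP.SortedAlgebra.{u, u} Γ)
        (R : Type u) (rk : R → ℕ) (LM : MMP.WRTGLM L (MMP.BD.mmonoid rk)),
      L.FinitelyDecomposable →
      (∀ r, ∃ p s, 0 < p ∧ p < 1 ∧ LM.wt r = MMP.BD.tcOp rk p s) → LM.Applicable) ∧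
    -- (4) the `n`-best M-monoid
    (∀ {S : Type u} {Γ : MMP.Signature S} (L : MMP.SortedAlgebra.{u, u} Γ)
        (n : ℕ) (LM : MMP.WRTGLM L (MMP.NBest.mmonoid.{u} n)),
      L.FinitelyDecomposable → 1 ≤ n → LM.Applicable) ∧
    -- (5) intersection M-monoids
    (∀ {S' : Type u} {Γ' : MMP.Signature S'} (L' : MMP.SortedAlgebra.{u, u} Γ')
        (G' : MMP.RTG Γ') (a' : L'.carrier (G'.sort G'.start))
        {S : Type u} {Γ : MMP.Signature S} (L : MMP.SortedAlgebra.{u, u} Γ)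
        (LM : MMP.WRTGLM L (MMP.Intersection.mmonoid G' L' a')),
      L'.FinitelyDecomposable → L.FinitelyDecomposable → LM.Applicable) ∧
    -- the intersection of a grammar and a syntactic object
    (∀ {S : Type u} {Γ : MMP.Signature S} (L : MMP.SortedAlgebra.{u, u} Γ)
        (hL : L.FinitelyDecomposable) (G : MMP.RTG Γ) (a : L.carrier (G.sort G.start)),
      ∃ V : Set (MMP.Intersection.Rule G L a),
        (MMP.Intersection.lm G L a).ParserOutputs a V ∧
        MMP.IsIntersection L G a (MMP.Intersection.grammar G hL V) Sigma.fst ∧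
        ∀ p ∈ V, ∀ o, p.child o ∈ MMP.Intersection.Rule.lhs '' V) ∧
    -- (6) nonlooping yield grammars with ADP M-monoids
    (∀ {Γ : MMP.Signature MMP.ADP.Srt.{u}} (K : MMP.SortedAlgebra.{u, v} Γ)
        (h : MMP.ADP.ObjectiveFunction K) {S : Type u} (Δ : MMP.Signature S) [Finite Δ.Op]
        (LM : MMP.WRTGLM (MMP.yieldAlg Δ) (MMP.ADP.mmonoid h)),
      MMP.ADP.IsADPSignature Γ → h.Bellman → LM.G.Nonlooping (MMP.yieldAlg Δ) →
      LM.Applicable) ∧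
    -- the ADP problem
    (∀ {Γ : MMP.Signature MMP.ADP.Srt.{u}} [Finite Γ.Op] (K : MMP.SortedAlgebra.{u, v} Γ)
        (h : MMP.ADP.ObjectiveFunction K) (G : MMP.RTG Γ),
      MMP.ADP.IsADPSignature Γ → h.Bellman → G.Nonlooping (MMP.yieldAlg Γ) →
      G.sort G.start = MMP.ADP.Srt.answer →
      ∀ w : List {σ : Γ.Op // Γ.ar σ = 0}, ∃ x : MMP.ADP.Carrier h,
        (MMP.ADP.lm h G).ParserOutputs w x ∧
        x.1 = some (Sigma.mk (G.sort G.start) '' MMP.ADP.adp h G w)) := by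
  refine ⟨fun L K _ _ LM hL => ⟨?_, ?_⟩, ?_, ?_, ?_, ?_, ?_, ?_, ?_⟩
  · exact MMP.WRTGLM.applicable_of_nonlooping
      (fun r => MMP.semiringMMonoid_additiveOn K (LM.wt r)) hL
  · exact MMP.WRTGLM.parserOutputs_of_acyclic
      (fun r => MMP.semiringMMonoid_additiveOn K (LM.wt r)) hL
  · exact fun _ _ _ hL hM => MMP.WRTGLM.applicable_of_superior hL hM
  · exact fun _ _ rk _ hL h => MMP.BD.applicable rk hL h
  · exact fun _ _ _ hL hn => MMP.NBest.applicable hL hn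
  · exact fun L' G' a' _ _ _ _ hL' hL => MMP.Intersection.applicable G' L' a' hL' hL
  · exact MMP.Intersection.exists_parserOutputs
  · exact fun _ _ _ Δ _ _ hΓ hB h => MMP.WRTGLM.applicable_of_nonlooping
      (fun _ => MMP.ADP.mmonoid_additiveOn hΓ hB _) (MMP.yieldAlg_finitelyDecomposable Δ) h
  · exact fun _ h G hΓ hB hG _ w => MMP.ADP.exists_parserOutputs h G hΓ hB hG w
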